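/- Setting. Let $d\ge 1$, let $z$ be a random data point with law $P$ on a measurable space $\mathcal Z$, let $f:\mathbb R^d\times\mathcal Z\to\mathbb R$ be measurable and $P$-integrable in $z$ and, for every $z$, differentiable and $L$-Lipschitz in $x$ ($L>0$), and let $F(x)=\mathbb E_z f(x,z)$ be bounded below with $F(x_1)-\inf F\le F^*$. Write $\|\nabla F(x)\|_\delta=\inf\{\|g\|: g\in\operatorname{conv}\{\nabla F(y):\|y-x\|<\delta\}\}$. Algorithm with parameters $K,T,B_1,B_2,r,D,\eta,\sigma$, on a dataset of $M\ge K(B_1+B_2(T-1))$ points. The dataset is cut into disjoint batches $Z_t^k$ ($1\le k\le K$, $1\le t\le T$) of size $B_1$ for $t=1$ and $B_2$ for $t\ge2$; leftover points are not used. Start at $x_1^1=x_1$. In epoch $k$ and round $t$ set $$\Delta_1^k=0,\qquad \Delta_t^k=\Pi_D(\Delta_{t-1}^k-\eta\tilde g_{t-1}^k)\ (t\ge2),\qquad w_t^k=x_t^k+s_t^k\Delta_t^k,\qquad x_{t+1}^k=x_t^k+\Delta_t^k,$$ with $s_t^k$ uniform on $[0,1]$ and $\Pi_D$ the projection onto $\{\|y\|\le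 D\}$ (projected online subgradient descent), and put $x_1^{k+1}=x_{T+1}^k$. The oracle is $$g_1^k=\frac1{B_1}\sum_{i=1}^{B_1}\frac1d\sum_{j=1}^d\frac{d}{2r}\bigl(f(w_1^k+ru_{ij},z_i)-f(w_1^k-ru_{ij},z_i)\bigr)u_{ij},$$ $$g_t^k=g_{t-1}^k+\frac1{B_2}\sum_{i=1}^{B_2}\frac1d\sum_{j=1}^d\frac{d}{r}\bigl(f(w_t^k+ru_{ij},z_i)-f(w_{t-1}^k+ru_{ij},z_i)\bigr)u_{ij}\quad(t\ge2),$$ where $z_i$ runs through the batch $Z_t^k$ and the $u_{ij}$ are fresh and uniform on the unit sphere, and $$\tilde g_t^k=g_t^k+\sum_{(a,b)\in\mathrm{Node}(t)}\xi_b^k,\qquad \xi_b^k\sim N(0,\sigma^2I)\ (1\le b\le T),$$ where $\mathrm{Node}(t)$ is the greedy splitting of $\{1,\dots,t\}$ into dyadic intervals $(a,b)$, longest first, e.g. $\mathrm{Node}(7)=\{(1,4),(5,6),(7,7)\}$. All random draws are independent. The output $\overline w$ is $\frac1T\sum_{t=1}^Tw_t^k$ for $k$ uniform in $\{1,\dots,K\}$.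 Theorem. There are universal constants $C>0$ and $p\in\mathbb N$ such that for all such data, all $\delta>0$, $0<\epsilon\le L$, $\rho>0$, and every integer $$M\ \ge\ C\,X\log(X+2)^p,\qquad X=d\Bigl(\frac{F^*L^2}{\delta\epsilon^3}+\frac{L^3}{\epsilon^3}\Bigr)+d^{3/2}\Bigl(\frac{F^*L}{\rho\delta\epsilon^2}+\frac{L^2}{\rho\epsilon^2}\Bigr),$$ the following holds for the algorithm run on $M$ data points with $r=\delta/2$, $B_1=T+1$, $B_2=1$, $D=r/T$, $\sigma=\dfrac{\sqrt{2\ln T}\,4dL}{T\rho}$, $K=\lfloor M/(2T)\rfloor$, $$T=\left\lceil\max\left\{\Bigl(\tfrac{\sqrt d\,LrM}{F^*+Lr}\Bigr)^{2/3},\Bigl(\tfrac{d^{3/2}LrM}{(F^*+Lr)\rho}\Bigr)^{1/2}\right\}\right\rceil$$ and stepsize $\eta=D/(G\sqrt T)$, $G^2=\frac{240\,dL^2}{T}+3L^2+3\bigl(\frac{8\ln(T)\,d^{3/2}L}{T\rho}\bigr)^2$. (i) For every $\alpha>1$ the output is $(\alpha,\alpha\rho^2/2)$-RDP: for any two datasets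 in $\mathcal Z^M$ that differ in at most one data point, the Rényi divergence of order $\alpha$ between the two laws of $\overline w$ is at most $\alpha\rho^2/2$. (ii) If the $M$ data points are i.i.d. with law $P$, then $\|\nabla F(\overline w)\|_\delta$ is integrable and $\mathbb E\|\nabla F(\overline w)\|_\delta\le\epsilon$, that is, $\overline w$ is a $(\delta,\epsilon)$-stationary point of $F$ in expectation. -/

import Mathlib

open MeasureTheory ProbabilityTheory

noncomputable section

namespace PrivateO2NC

/-- The space `ℝ^d` with its Euclidean norm. -/
abbrev Vec (d : ℕ) : Type := EuclideanSpace ℝ (Fin d)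

/-! ### Goldstein stationarity -/

/-- The Goldstein `δ`-subdifferential: the convex hull of the gradients on the open ball. -/
def goldsteinSubdiff {d : ℕ} (h : Vec d → ℝ) (δ : ℝ) (x : Vec d) : Set (Vec d) :=
  convexHull ℝ (gradient h '' Metric.ball x δ)

/-- `‖∇h(x)‖_δ`, the infimum of the norms of the elements of the Goldstein `δ`-subdifferential. -/
def goldsteinNorm {d : ℕ} (h : Vec d → ℝ) (δ : ℝ) (x : Vec d) : ℝ :=
  sInf ((fun g => ‖g‖) '' goldsteinSubdiff h δ x)

/-! ### Rényi differential privacy -/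

/-- The Rényi divergence `D_α(μ‖ν) = (α - 1)⁻¹ log ∫ (dμ/dν)^α dν` of order `α > 1`
(`+∞` when `μ` is not absolutely continuous with respect to `ν`). -/
def renyiDiv {R : Type*} [MeasurableSpace R] (α : ℝ) (μ ν : Measure R) : EReal :=
  open Classical in
  if μ ≪ ν then (((α - 1)⁻¹ : ℝ) : EReal) * ENNReal.log (∫⁻ x, (μ.rnDeriv ν x) ^ α ∂ν) else ⊤

/-- Two datasets of size `M` are neighboring if they agree except possibly at one data point. -/
def Neighboring {Z : Type*} {M : ℕ} (S S' : Fin M → Z) : Prop :=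
  ∃ q : Fin M, ∀ i : Fin M, i ≠ q → S i = S' i

/-- A randomized algorithm, given by the law `A S` of its output on each dataset `S`, is
`(α, r)`-RDP. -/
def IsRDP {Z R : Type*} [MeasurableSpace R] {M : ℕ} (A : (Fin M → Z) → Measure R) (α r : ℝ) :
    Prop :=
  ∀ S S' : Fin M → Z, Neighboring S S' → renyiDiv α (A S) (A S') ≤ (r : EReal)

/-! ### The basic laws -/

/-- The uniform probability distribution on the unit sphere, as a measure on `ℝ^d`. -/
def sphereUniform (d : ℕ) : Measure (Vec d) :=
  (((volume : Measure (Vec d)).toSphere Set.univ)⁻¹ • (volume : Measure (Vec d)).toSphere).map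
    Subtype.val

/-- The Gaussian distribution `N(0, σ² I)` on `ℝ^d`. -/
def isoGaussian (d : ℕ) (σ : ℝ) : Measure (Vec d) :=
  (stdGaussian (Vec d)).map (fun x => σ • x)

/-- The uniform distribution on `[0, 1]`. -/
def unitUniform : Measure ℝ := volume.restrict (Set.Icc 0 1)

instance isProbabilityMeasure_sphereUniform (d : ℕ) [NeZero d] :
    IsProbabilityMeasure (sphereUniform d) := by
  have h0 : (volume : Measure (Vec d)).toSphere ≠ 0 := Measure.toSphere_ne_zero _
  have : IsProbabilityMeasure (((volume : Measure (Vec d)).toSphere Set.univ)⁻¹ •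
      (volume : Measure (Vec d)).toSphere) := by
    constructor
    rw [Measure.smul_apply, smul_eq_mul]
    exact ENNReal.inv_mul_cancel (fun h => h0 (Measure.measure_univ_eq_zero.mp h))
      (measure_ne_top _ _)
  exact Measure.isProbabilityMeasure_map measurable_subtype_coe.aemeasurable

instance isProbabilityMeasure_isoGaussian (d : ℕ) (σ : ℝ) :
    IsProbabilityMeasure (isoGaussian d σ) :=
  Measure.isProbabilityMeasure_map (by fun_prop)

instance isProbabilityMeasure_unitUniform : IsProbabilityMeasure unitUniform :=
  ⟨by simp [unitUniform]⟩

/-! ### The tree mechanism -/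

/-- One pass of the loop of `NODE(t)`: the state is the current `k` with the current set `S` of
nodes `(a, b)`, and the pass tries the dyadic length `2 ^ (⌈log₂ t⌉ - i)`. -/
def nodeStep (t : ℕ) (st : ℕ × Finset (ℕ × ℕ)) (i : ℕ) : ℕ × Finset (ℕ × ℕ) :=
  let k' := st.1 + 2 ^ (Nat.clog 2 t - i)
  if k' ≤ t then (k', insert (st.1 + 1, k') st.2) else st

/-- The set of nodes `NODE(t)`. For example `NODE(7) = {(1,4), (5,6), (7,7)}`. -/
def nodes (t : ℕ) : Finset (ℕ × ℕ) :=
  ((List.range (Nat.clog 2 t + 1)).foldl (nodeStep t) (0, ∅)).2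

/-- The noise `TREE(t)`, built from the stored samples `ξ_1, ξ_2, …`. -/
def treeNoise {d : ℕ} (ξ : ℕ → Vec d) (t : ℕ) : Vec d :=
  ∑ p ∈ nodes t, ξ p.2

/-! ### The zeroth-order estimators -/

/-- `GRAD_{f,δ}(x, z_{1:b})`. The losses `v i = f(·, z_i)` of the data points of the batch and the
directions `u i j` are given. -/
def gradEst {d : ℕ} (δ : ℝ) (b : ℕ) (v : ℕ → Vec d → ℝ) (u : ℕ → Fin d → Vec d) (x : Vec d) :
    Vec d :=
  (b : ℝ)⁻¹ • ∑ i ∈ Finset.range b, (d : ℝ)⁻¹ • ∑ j : Fin d,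
    ((d : ℝ) / (2 * δ) * (v i (x + δ • u i j) - v i (x - δ • u i j))) • u i j

/-- `DIFF_{f,δ}(x, y, z_{1:b})`, the estimator of the difference of the gradients at `x` and
`y`. -/
def diffEst {d : ℕ} (δ : ℝ) (b : ℕ) (v : ℕ → Vec d → ℝ) (u : ℕ → Fin d → Vec d) (x y : Vec d) :
    Vec d :=
  (b : ℝ)⁻¹ • ∑ i ∈ Finset.range b, (d : ℝ)⁻¹ • ∑ j : Fin d,
    ((d : ℝ) / δ * (v i (x + δ • u i j) - v i (y + δ • u i j))) • u i j

/-! ### The algorithm -/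

/-- The parameters: `K` epochs of `T` rounds, batch sizes `B₁` (first round of an epoch) and `B₂`
(later rounds), smoothing radius `δ`, domain bound `D` and stepsize `η` of the projected online
subgradient descent, standard deviations `σ t` of the tree mechanism. -/
structure Params where
  K : ℕ
  T : ℕ
  B₁ : ℕ
  B₂ : ℕ
  δ : ℝ
  D : ℝ
  η : ℝ
  σ : ℕ → ℝ

/-- The number of data points used by one epoch. -/
def Params.epochSize (c : Params) : ℕ := c.B₁ + c.B₂ * (c.T - 1)

/-- Projection onto the closed Euclidean ball of radius `D` around the origin. -/
def projBall {d : ℕ} (D : ℝ) (x : Vec d) : Vec d := if ‖x‖ ≤ D then x else (D / ‖x‖) • x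

/-- `projBall D x` lies in the ball and is a nearest point of it to `x`. -/
theorem projBall_spec {d : ℕ} {D : ℝ} (hD : 0 ≤ D) (x : Vec d) :
    ‖projBall D x‖ ≤ D ∧ ∀ y : Vec d, ‖y‖ ≤ D → ‖x - projBall D x‖ ≤ ‖x - y‖ := by
  unfold projBall
  split_ifs with h
  · exact ⟨h, fun y _ => by simp⟩
  · have hx : 0 < ‖x‖ := lt_of_le_of_lt hD (not_le.mp h)
    have h1 : D / ‖x‖ ≤ 1 := (div_le_one hx).2 (not_le.mp h).le
    refine ⟨?_, fun y hy => ?_⟩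
    · rw [norm_smul, Real.norm_of_nonneg (by positivity)]
      exact (div_mul_cancel₀ D hx.ne').le
    · have h2 : x - (D / ‖x‖) • x = (1 - D / ‖x‖) • x := by rw [sub_smul, one_smul]
      rw [h2, norm_smul, Real.norm_of_nonneg (by linarith), sub_mul, one_mul,
        div_mul_cancel₀ D hx.ne']
      have := norm_sub_norm_le x y
      linarith

/-- The loss `f(·, z)` of the data point number `n` (from `0`) of the dataset `S`. The algorithm
only queries numbers `n < K * epochSize`, which is at most `M` in its intended use. -/
def dataLoss {d M : ℕ} {Z : Type*} (f : Vec d → Z → ℝ) (S : Fin M → Z) (n : ℕ) (x : Vec d) : ℝ :=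
  if h : n < M then f x (S ⟨n, h⟩) else 0

/-- The random draws of one run: the `s_t^k` (at `(k, t)`), the tree samples `ξ_t^k` (at `(k, t)`),
the directions `u` (at `(n, j)`, for the data point number `n` and `j = 1, …, d`) and the index of
the epoch that is output. Epochs are counted from `0` and rounds from `1`; only finitely many of
the draws are used. -/
abbrev Tape (d K : ℕ) : Type :=
  (ℕ × ℕ → ℝ) × (ℕ × ℕ → Vec d) × (ℕ × Fin d → Vec d) × Fin K

/-- The law of the random draws: all of them are independent. -/
def tapeLaw (d : ℕ) (c : Params) : Measure (Tape d c.K) :=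
  (Measure.infinitePi fun _ : ℕ × ℕ => unitUniform).prod
    ((Measure.infinitePi fun p : ℕ × ℕ => isoGaussian d (c.σ p.2)).prod
      ((Measure.infinitePi fun _ : ℕ × Fin d => sphereUniform d).prod
        (uniformOn (Set.univ : Set (Fin c.K)))))

/-- The variables of round `t` of an epoch: the iterate `x_t`, the increment `Δ_t`, the query point
`w_t`, the nonprivate estimate `g_t` and the private estimate `g̃_t`. -/
structure RoundState (d : ℕ) where
  x : Vec d
  Δ : Vec d
  w : Vec d
  g : Vec d
  gPriv : Vec d

/-- The state of round `n + 1` of an epoch that starts at `x₁`. The losses `v` and directions `u`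
of the data points of the epoch are numbered from `0`: the first `B₁` are the batch of round `1`,
the next `B₂` that of round `2`, and so on. -/
def roundState {d : ℕ} (c : Params) (v : ℕ → Vec d → ℝ) (u : ℕ → Fin d → Vec d) (s : ℕ → ℝ)
    (ξ : ℕ → Vec d) (x₁ : Vec d) : ℕ → RoundState d
  | 0 =>
    let w := x₁ + s 1 • (0 : Vec d)
    let g := gradEst c.δ c.B₁ v u w
    { x := x₁, Δ := 0, w := w, g := g, gPriv := g + treeNoise ξ 1 }
  | n + 1 =>
    let p := roundState c v u s ξ x₁ n
    let x := p.x + p.Δ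
    let Δ := projBall c.D (p.Δ - c.η • p.gPriv)
    let w := x + s (n + 2) • Δ
    let o := c.B₁ + c.B₂ * n
    let g := p.g + diffEst c.δ c.B₂ (fun i => v (o + i)) (fun i => u (o + i)) w p.w
    { x := x, Δ := Δ, w := w, g := g, gPriv := g + treeNoise ξ (n + 2) }

section Run

variable {d M : ℕ} {Z : Type*} (c : Params) (f : Vec d → Z → ℝ) (x₁ : Vec d) (S : Fin M → Z)
  (ω : Tape d c.K)

/-- The state of round `n + 1` of epoch `k`, when this epoch starts at `x`. Epoch `k` uses the data
points number `k * epochSize, …, (k + 1) * epochSize - 1`. -/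
def epochState (k : ℕ) (x : Vec d) (n : ℕ) : RoundState d :=
  roundState c (fun i => dataLoss f S (k * c.epochSize + i))
    (fun i j => ω.2.2.1 (k * c.epochSize + i, j)) (fun t => ω.1 (k, t)) (fun t => ω.2.1 (k, t)) x n

/-- The starting point `x_1^k` of epoch `k`, where `x_1^{k+1} = x_{T+1}^k = x_T^k + Δ_T^k`. -/
def epochStart : ℕ → Vec d
  | 0 => x₁
  | k + 1 =>
    let last := epochState c f S ω k (epochStart k) (c.T - 1)
    last.x + last.Δ

/-- The average `w̄^k = (1/T) ∑_t w_t^k` of the query points of epoch `k`. -/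
def epochAverage (k : ℕ) : Vec d :=
  (c.T : ℝ)⁻¹ • ∑ n ∈ Finset.range c.T, (epochState c f S ω k (epochStart c f x₁ S ω k) n).w

/-- The output `w̄` of the run on the dataset `S` with the random draws `ω`. -/
def output : Vec d := epochAverage c f x₁ S ω (ω.2.2.2 : ℕ)

end Run

/-- The law of the output on the dataset `S`. -/
def outputLaw {d M : ℕ} {Z : Type*} (c : Params) (f : Vec d → Z → ℝ) (x₁ : Vec d)
    (S : Fin M → Z) : Measure (Vec d) :=
  (tapeLaw d c).map (output c f x₁ S)

/-! ### The choice of the parameters -/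

/-- The number of rounds
`T = ⌈max {(√d L δ M / (F* + L δ))^(2/3), (d^(3/2) L δ M / ((F* + L δ) ρ))^(1/2)}⌉`. -/
def chosenT (d M : ℕ) (L δ ρ Fstar : ℝ) : ℕ :=
  ⌈max ((√(d : ℝ) * L * δ * M / (Fstar + L * δ)) ^ (2 / 3 : ℝ))
    (((d : ℝ) ^ (3 / 2 : ℝ) * L * δ * M / ((Fstar + L * δ) * ρ)) ^ (1 / 2 : ℝ))⌉₊

/-- An upper bound of the root mean square norm of the private gradient estimates; the stepsize of
the online subgradient descent is tuned to it. -/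
def gradBound (d T : ℕ) (L ρ : ℝ) : ℝ :=
  √(3 * (80 * d * L ^ 2 / T) + 3 * L ^ 2
    + 3 * (8 * Real.log T * (d : ℝ) ^ (3 / 2 : ℝ) * L / (T * ρ)) ^ 2)

/-- The parameters for a dataset of size `M` and smoothing radius `δ`:
`B₁ = T + 1`, `B₂ = 1`, `D = δ / T`, `K = ⌊M / (2T)⌋`, `σ_t = √(2 ln T) 4 d L / (B₂ T ρ)`, and the
stepsize `η = D / (G √T)`. -/
def chosenParams (d M : ℕ) (L δ ρ Fstar : ℝ) : Params :=
  let T := chosenT d M L δ ρ Fstar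
  { K := M / (2 * T)
    T := T
    B₁ := T + 1
    B₂ := 1
    δ := δ
    D := δ / T
    η := (δ / T) / (gradBound d T L ρ * √(T : ℝ))
    σ := fun _ => √(2 * Real.log T) * 4 * d * L / ((1 : ℕ) * T * ρ) }

/-- The dataset is large enough for the run. -/
theorem chosenParams_size (d M : ℕ) (L δ ρ Fstar : ℝ) :
    (chosenParams d M L δ ρ Fstar).K * (chosenParams d M L δ ρ Fstar).epochSize ≤ M := by
  simp only [chosenParams, Params.epochSize]
  generalize chosenT d M L δ ρ Fstar = T
  rcases Nat.eq_zero_or_pos T with rfl | hT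
  · simp
  · have h : T + 1 + 1 * (T - 1) = 2 * T := by omega
    rw [h]
    exact Nat.div_mul_le_self M (2 * T)

/-- The rate `d (F* L² / (δ ε³) + L³ / ε³) + d^(3/2) (F* L / (ρ δ ε²) + L² / (ρ ε²))`. -/
def dataRate (d : ℕ) (L δ ε ρ Fstar : ℝ) : ℝ :=
  d * (Fstar * L ^ 2 / (δ * ε ^ 3) + L ^ 3 / ε ^ 3)
    + (d : ℝ) ^ (3 / 2 : ℝ) * (Fstar * L / (ρ * δ * ε ^ 2) + L ^ 2 / (ρ * ε ^ 2))

end PrivateO2NC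

end

open MeasureTheory ProbabilityTheory

set_option linter.unusedSectionVars false

noncomputable section

namespace PrivateO2NC

/-! ### The nodes of the tree mechanism -/

/-! Privacy. Suppose two datasets differ in one point, read in round `m + 1` of epoch `k`. The
estimates `g_t` are sums of increments, so along a fixed trajectory the replacement of that point
changes `g_t` by one and the same vector `q` in all rounds `t > m` of the epoch and leaves the
earlier ones alone. Exactly one node of the splitting of `{1, …, t}` contains round `m + 1` if `t >
m`, and none otherwise (`sum_nodeEnds_ite`). Adding `q` to the samples of the at most `log₂ T + 1`
nodes through this round therefore undoes the change: both runs see the same private estimates and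
return the same output (`roundState_coupled`, `output_coupled`). The vector `q` is random, but it
does not involve the shifted samples, so the Cameron–Martin formula applies conditionally, one node
at a time (`lintegral_tapeLaw_shift`). The output law on one dataset is thus a reweighting of the
run on the other, and data processing (`renyiDiv_le_of_density`) bounds the Rényi divergence by a
moment of the weight. Since `‖q‖ ≤ 4dL/T`, the chosen `σ` yields `αρ²/2`.

Utility. Let `F_r` be the average of `F` over balls of radius `r`. The uniform draw `s_t` makes
`E⟨∇F_r(w_t), Δ_t⟩` equal to `E[F_r(x_{t+1}) - F_r(x_t)]` (`integral_inner_Δ`), and these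
differences telescope to at least `-(F* + Lr)`. The `Δ_t` come from online subgradient descent; its
regret against the vector of norm `D` opposite to `∑ ∇F_r(w_t)` bounds the norm of this sum
(`mul_norm_sum_le`, `epoch_bound`). All `w_t` of an epoch lie within `TD = r` of their average, and
`∇F_r(w_t)` averages gradients of `F` within `r` of `w_t`. Hence the mean of the `∇F_r(w_t)`
controls the Goldstein norm with radius `2r = δ` (`goldsteinNorm_le_norm_average`).

The divergence theorem on the ball (`integral_smul_sphereUniform`) makes the estimators unbiased for
`∇F_r`, so their errors form a martingale. For one data point whose single-direction estimate is
bounded by `B`, the average over `d` directions together with `‖E φ(u)u‖² ≤ B²/d` brings the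
variance down to `8B²/d`. The accumulated mean square error is at most `40dL²/T` (`estError_bound`).
With `a` and `b` bounding the root mean squares of this error and of the tree noise, the result is
`(F* + Lr)/(Kr) + G/√T + 2(a + b)` (`integral_goldsteinNorm_output_le`). The choice of `T` balances
these terms, and the lower bound on `M` makes their sum at most `ε` (`total_error_le`).

Independence is used throughout in the form `Resample`: redrawing one coordinate preserves the joint
law, and a quantity ignores that coordinate when the redraw does not change it. -/

/-- The exponents of the binary expansion of `t`. -/
def bitExponents (t : ℕ) : Finset ℕ :=
  (Finset.range (Nat.clog 2 t + 1)).filter fun j => Odd (t / 2 ^ j)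

/-- Taking dyadic lengths greedily reads off the binary digits of `t` from the top. The loop
invariant is that the running endpoint is `t` with all digits below the current exponent cleared,
and that each digit `1` met so far has contributed its node. -/
theorem foldl_nodeStep (t m : ℕ) (hm : m ≤ Nat.clog 2 t + 1) :
    (List.range m).foldl (nodeStep t) (0, ∅) =
      (2 ^ (Nat.clog 2 t + 1 - m) * (t / 2 ^ (Nat.clog 2 t + 1 - m)),
        ((Finset.Ico (Nat.clog 2 t + 1 - m) (Nat.clog 2 t + 1)).filter
          fun j => Odd (t / 2 ^ j)).image
          fun j => (2 ^ j * (t / 2 ^ j) - 2 ^ j + 1, 2 ^ j * (t / 2 ^ j))) := by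
  induction m with
  | zero =>
    have h1 : t ≤ 2 ^ Nat.clog 2 t := Nat.le_pow_clog (by norm_num) t
    -- The extra exponent makes the initial quotient vanish even when `t` is a power of two.
    have h2 : t < 2 ^ (Nat.clog 2 t + 1) := by
      rw [pow_succ]
      have := Nat.one_le_two_pow (n := Nat.clog 2 t)
      omega
    simp [Nat.div_eq_of_lt h2]
  | succ m ih =>
    rw [List.range_succ, List.foldl_append, ih (by omega)]
    generalize hj : Nat.clog 2 t - m = j
    have hj1 : Nat.clog 2 t + 1 - m = j + 1 := by omega
    have hj2 : Nat.clog 2 t + 1 - (m + 1) = j := by omega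
    have hjc : j ≤ Nat.clog 2 t := by omega
    simp only [List.foldl_cons, List.foldl_nil, hj1, hj2, nodeStep, hj]
    have hI : Finset.Ico j (Nat.clog 2 t + 1) = insert j (Finset.Ico (j + 1) (Nat.clog 2 t + 1)) := by
      ext i; simp; omega
    have hdd : t / 2 ^ (j + 1) = t / 2 ^ j / 2 := by rw [pow_succ, Nat.div_div_eq_div_mul]
    have hle : ∀ a : ℕ, 2 ^ j * a ≤ t ↔ a ≤ t / 2 ^ j := fun a => by
      rw [Nat.le_div_iff_mul_le (by positivity), mul_comm]
    rw [hI, Finset.filter_insert]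
    by_cases ho : Odd (t / 2 ^ j)
    · obtain ⟨a, ha⟩ := ho
      have h3 : t / 2 ^ (j + 1) = a := by omega
      have h4 : 2 ^ (j + 1) * a + 2 ^ j = 2 ^ j * (2 * a + 1) := by ring
      have h5 : 2 ^ j * (2 * a + 1) - 2 ^ j = 2 ^ (j + 1) * a := by rw [← h4]; omega
      rw [h3, h4, if_pos ((hle _).2 ha.ge), ha, if_pos ⟨a, rfl⟩, Finset.image_insert, ha, h5]
    · rw [Nat.not_odd_iff_even] at ho
      obtain ⟨a, ha⟩ := ho
      have h3 : t / 2 ^ (j + 1) = a := by omega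
      have h4 : 2 ^ (j + 1) * a + 2 ^ j = 2 ^ j * (2 * a + 1) := by ring
      have h5 : ¬ Odd (t / 2 ^ j) := by rw [Nat.not_odd_iff_even]; exact ⟨a, ha⟩
      rw [h3, h4, if_neg (by rw [hle]; omega), if_neg h5, ha]
      congr 1
      ring

theorem nodes_eq (t : ℕ) :
    nodes t = (bitExponents t).image
      fun j => (2 ^ j * (t / 2 ^ j) - 2 ^ j + 1, 2 ^ j * (t / 2 ^ j)) := by
  rw [nodes, foldl_nodeStep t _ le_rfl, bitExponents, Finset.range_eq_Ico]
  simp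

/-- The exponent is the 2-adic valuation. Distinct nodes thus have distinct endpoints, and the noise
may be indexed by endpoints alone. -/
theorem two_pow_mul_odd_inj {i j a b : ℕ} (ha : Odd a) (hb : Odd b)
    (h : 2 ^ i * a = 2 ^ j * b) : i = j := by
  have key : ∀ {i j a b : ℕ}, Odd a → 2 ^ i * a = 2 ^ j * b → j ≤ i := by
    intro i j a b ha h
    by_contra! hij
    obtain ⟨k, rfl⟩ := Nat.exists_eq_add_of_lt hij
    have : a = 2 * (2 ^ k * b) := by
      have h2 : 2 ^ i * a = 2 ^ i * (2 * (2 ^ k * b)) := by rw [h]; ring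
      exact Nat.eq_of_mul_eq_mul_left (by positivity) h2
    rw [this] at ha
    exact (Nat.not_odd_iff_even.2 (even_two_mul _)) ha
  exact le_antisymm (key hb h.symm) (key ha h)

theorem odd_of_mem_bitExponents {t j : ℕ} (hj : j ∈ bitExponents t) : Odd (t / 2 ^ j) :=
  (Finset.mem_filter.1 hj).2

theorem mem_bitExponents {t j : ℕ} : j ∈ bitExponents t ↔ Odd (t / 2 ^ j) := by
  refine ⟨odd_of_mem_bitExponents, fun h => Finset.mem_filter.2 ⟨Finset.mem_range.2 ?_, h⟩⟩
  by_contra! hc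
  have h1 : t ≤ 2 ^ Nat.clog 2 t := Nat.le_pow_clog (by norm_num) t
  have h2 : 2 ^ Nat.clog 2 t < 2 ^ j := Nat.pow_lt_pow_right (by norm_num) (by omega)
  rw [Nat.div_eq_of_lt (by omega)] at h
  exact absurd h (by decide)

/-- The endpoints of the nodes. -/
def nodeEnds (t : ℕ) : Finset ℕ := (bitExponents t).image fun j => 2 ^ j * (t / 2 ^ j)

theorem treeNoise_eq {d : ℕ} (ξ : ℕ → Vec d) (t : ℕ) :
    treeNoise ξ t = ∑ b ∈ nodeEnds t, ξ b := by
  rw [treeNoise, nodes_eq, nodeEnds, Finset.sum_image, Finset.sum_image]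
  · intro i hi j hj h
    exact two_pow_mul_odd_inj (odd_of_mem_bitExponents hi) (odd_of_mem_bitExponents hj) h
  · intro i hi j hj h
    exact two_pow_mul_odd_inj (odd_of_mem_bitExponents hi) (odd_of_mem_bitExponents hj)
      (Prod.ext_iff.1 h).2

theorem le_of_mem_nodeEnds {t b : ℕ} (hb : b ∈ nodeEnds t) : b ≤ t := by
  obtain ⟨j, -, rfl⟩ := Finset.mem_image.1 hb
  exact Nat.mul_div_le t _

theorem card_nodeEnds_le (t : ℕ) : (nodeEnds t).card ≤ Nat.log 2 t + 1 := by
  refine Finset.card_image_le.trans ?_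
  rw [← Finset.card_range (Nat.log 2 t + 1)]
  refine Finset.card_le_card fun j hj => Finset.mem_range.2 ?_
  have h := odd_of_mem_bitExponents hj
  have h1 : 2 ^ j ≤ t := by
    by_contra! hc
    rw [Nat.div_eq_of_lt hc] at h
    exact absurd h (by decide)
  exact Nat.lt_succ_of_le (Nat.le_log_of_pow_le (by norm_num) h1)

/-- The endpoints `b ≤ T` of the nodes that contain `a + 1`. -/
def nodeEndsThrough (a T : ℕ) : Finset ℕ :=
  ((Finset.range (Nat.log 2 T + 1)).filter fun j => Odd (a / 2 ^ j + 1)).image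
    fun j => 2 ^ j * (a / 2 ^ j + 1)

theorem card_nodeEndsThrough_le (a T : ℕ) : (nodeEndsThrough a T).card ≤ Nat.log 2 T + 1 := by
  refine Finset.card_image_le.trans ((Finset.card_filter_le _ _).trans ?_)
  simp

theorem lt_of_mem_nodeEndsThrough {a T b : ℕ} (hb : b ∈ nodeEndsThrough a T) : a < b := by
  obtain ⟨j, -, rfl⟩ := Finset.mem_image.1 hb
  exact Nat.lt_mul_div_succ a (by positivity)

/-- At the leading binary digit where the two numbers differ, `t` has a `1` and `a` a `0`, and all
higher digits agree. It is found as the level just below the first one at which the truncations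
coincide. -/
theorem exists_bit_of_lt {a t : ℕ} (h : a < t) :
    ∃ j, Odd (t / 2 ^ j) ∧ t / 2 ^ j = a / 2 ^ j + 1 := by
  have hex : ∃ j, t / 2 ^ j = a / 2 ^ j := by
    refine ⟨t, ?_⟩
    have h1 : t < 2 ^ t := Nat.lt_two_pow_self
    rw [Nat.div_eq_of_lt h1, Nat.div_eq_of_lt (h.trans h1)]
  classical
  have hspec := Nat.find_spec hex
  have hmin := fun m => Nat.find_min hex (m := m)
  rcases hk : Nat.find hex with _ | j
  · rw [hk] at hspec
    simp at hspec
    omega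
  · rw [hk] at hspec hmin
    have h1 := hmin j (by omega)
    have h2 : a / 2 ^ j ≤ t / 2 ^ j := Nat.div_le_div_right h.le
    rw [pow_succ, ← Nat.div_div_eq_div_mul, ← Nat.div_div_eq_div_mul] at hspec
    refine ⟨j, ?_, ?_⟩
    · rw [Nat.odd_iff]; omega
    · omega

/-- If `t / 2 ^ i` is odd and exceeds `a / 2 ^ i` by one, the two truncations agree at every level
above `i`, so no higher level can have the same property. -/
theorem bit_unique {a t i j : ℕ} (hi : Odd (t / 2 ^ i)) (hi' : t / 2 ^ i = a / 2 ^ i + 1)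
    (hj : Odd (t / 2 ^ j)) (hj' : t / 2 ^ j = a / 2 ^ j + 1) : i = j := by
  have key : ∀ {i j : ℕ}, Odd (t / 2 ^ i) → t / 2 ^ i = a / 2 ^ i + 1 →
      t / 2 ^ j = a / 2 ^ j + 1 → j ≤ i := by
    intro i j hi hi' hj'
    by_contra! hij
    obtain ⟨k, rfl⟩ := Nat.exists_eq_add_of_lt hij
    have hs : ∀ x : ℕ, x / 2 ^ (i + k + 1) = x / 2 ^ i / 2 / 2 ^ k := fun x => by
      rw [Nat.div_div_eq_div_mul, Nat.div_div_eq_div_mul]; congr 1; ring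
    rw [hs, hs] at hj'
    have : t / 2 ^ i / 2 = a / 2 ^ i / 2 := by
      rw [Nat.odd_iff] at hi; omega
    rw [this] at hj'
    omega
  exact le_antisymm (key hj hj' hi') (key hi hi' hj')

/-- Exactly one node of `nodes t` contains `a + 1` when `a < t`, and none otherwise. -/
theorem sum_nodeEnds_ite {E : Type*} [AddCommMonoid E] {a t T : ℕ} (htT : t ≤ T) (q : E) :
    (∑ b ∈ nodeEnds t, if b ∈ nodeEndsThrough a T then q else 0) = if a < t then q else 0 := by
  split_ifs with h
  · obtain ⟨j, hj, hj'⟩ := exists_bit_of_lt h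
    rw [Finset.sum_eq_single (2 ^ j * (t / 2 ^ j))]
    · rw [if_pos]
      refine Finset.mem_image.2 ⟨j, Finset.mem_filter.2 ⟨Finset.mem_range.2 ?_, hj' ▸ hj⟩, by rw [hj']⟩
      have : 2 ^ j ≤ T := by
        by_contra! hc
        rw [Nat.div_eq_of_lt (htT.trans_lt hc)] at hj'
        exact Nat.succ_ne_zero _ hj'.symm
      exact Nat.lt_succ_of_le (Nat.le_log_of_pow_le (by norm_num) this)
    · intro b hb hne
      rw [if_neg]
      intro hb'
      obtain ⟨i, hi, rfl⟩ := Finset.mem_image.1 hb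
      obtain ⟨i', hi', he⟩ := Finset.mem_image.1 hb'
      have ho := odd_of_mem_bitExponents hi
      have ho' := (Finset.mem_filter.1 hi').2
      have hii := two_pow_mul_odd_inj ho' ho he
      subst hii
      have he2 := Nat.eq_of_mul_eq_mul_left (by positivity) he
      have := bit_unique ho he2.symm hj hj'
      subst this
      exact hne rfl
    · intro hn
      exact absurd (Finset.mem_image.2 ⟨j, mem_bitExponents.2 hj, rfl⟩) hn
  · refine Finset.sum_eq_zero fun b hb => if_neg fun hb' => ?_
    have := le_of_mem_nodeEnds hb
    have := lt_of_mem_nodeEndsThrough hb'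
    omega

/-! ### Resampling one coordinate -/

/-- Replacing a part of `ω`, in the way described by `m`, by an independent draw from `ν` does not
change the law `μ` of `ω`. -/
def Resample {Ω Y : Type*} [MeasurableSpace Ω] [MeasurableSpace Y] (μ : Measure Ω)
    (m : Ω → Y → Ω) (ν : Measure Y) : Prop :=
  MeasurePreserving (Function.uncurry m) (μ.prod ν) μ

section Resample

variable {Ω Ω' Y : Type*} [MeasurableSpace Ω] [MeasurableSpace Ω'] [MeasurableSpace Y]
  {μ : Measure Ω} {μ' : Measure Ω'} {ν : Measure Y} {m : Ω → Y → Ω}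

/-- Finite-dimensional boxes determine the product law, and the preimage of a box under the redraw
is again a product: the box without its `i`-th side, times that side for the new draw. -/
theorem resample_update_infinitePi {ι : Type*} [DecidableEq ι] {X : ι → Type*}
    [∀ i, MeasurableSpace (X i)]
    (μ : (i : ι) → Measure (X i)) [∀ i, IsProbabilityMeasure (μ i)] (i : ι) :
    Resample (Measure.infinitePi μ) (fun ω x => Function.update ω i x) (μ i) := by
  have hm : Measurable (Function.uncurry fun (ω : (i : ι) → X i) (x : X i) =>
      Function.update ω i x) := by
    refine measurable_pi_lambda _ fun j => ?_
    by_cases hj : j = i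
    · subst hj
      simpa [Function.uncurry_def] using measurable_snd
    · simp only [Function.uncurry_def, Function.update_of_ne hj]
      exact (measurable_pi_apply j).comp measurable_fst
  refine ⟨hm, Measure.eq_infinitePi _ fun s t ht => ?_⟩
  rw [Measure.map_apply hm (MeasurableSet.pi s.countable_toSet fun j _ => ht j)]
  have hpre : (Function.uncurry fun (ω : (i : ι) → X i) (x : X i) => Function.update ω i x) ⁻¹'
      (Set.pi s t) = (Set.pi (s.erase i : Finset ι) t) ×ˢ (if i ∈ s then t i else Set.univ) := by
    ext ⟨ω, x⟩
    simp only [Set.mem_preimage, Function.uncurry_apply_pair, Set.mem_pi, Set.mem_prod,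
      Finset.mem_coe, Finset.mem_erase]
    constructor
    · intro h
      refine ⟨fun j hj => ?_, ?_⟩
      · simpa [Function.update_of_ne hj.1] using h j hj.2
      · split_ifs with hi
        · simpa using h i hi
        · trivial
    · rintro ⟨h1, h2⟩ j hj
      by_cases hji : j = i
      · subst hji
        simpa [hj] using h2
      · simpa [Function.update_of_ne hji] using h1 j ⟨hji, hj⟩
  rw [hpre, Measure.prod_prod, Measure.infinitePi_pi _ fun j _ => ht j]
  split_ifs with hi
  · exact Finset.prod_erase_mul _ _ hi
  · rw [measure_univ, mul_one, Finset.erase_eq_of_notMem hi]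

theorem resample_update_pi {ι : Type*} [Fintype ι] [DecidableEq ι] {X : ι → Type*}
    [∀ i, MeasurableSpace (X i)]
    (μ : (i : ι) → Measure (X i)) [∀ i, IsProbabilityMeasure (μ i)] (i : ι) :
    Resample (Measure.pi μ) (fun ω x => Function.update ω i x) (μ i) := by
  rw [← Measure.infinitePi_eq_pi]
  exact resample_update_infinitePi μ i

theorem resample_const (ν : Measure Y) (μ : Measure Y) [SFinite ν] [IsProbabilityMeasure μ] :
    Resample μ (fun _ y => y) μ :=
  measurePreserving_snd

theorem Resample.fst [SFinite μ] [SFinite μ'] [SFinite ν] (h : Resample μ m ν) :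
    Resample (μ.prod μ') (fun ω y => (m ω.1 y, ω.2)) ν := by
  have h1 : MeasurePreserving (fun p : (Ω × Ω') × Y => ((p.1.1, p.2), p.1.2))
      ((μ.prod μ').prod ν) ((μ.prod ν).prod μ') := by
    refine ⟨by fun_prop, ?_⟩
    have h2 : MeasurePreserving (Prod.map id Prod.swap) (μ.prod (μ'.prod ν))
      (μ.prod (ν.prod μ')) := (MeasurePreserving.id μ).prod Measure.measurePreserving_swap
    have h3 := (measurePreserving_prodAssoc μ ν μ').symm.comp
      (h2.comp (measurePreserving_prodAssoc μ μ' ν))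
    exact h3.map_eq
  exact (h.prod (MeasurePreserving.id μ')).comp h1

theorem Resample.snd [SFinite μ] [SFinite μ'] [SFinite ν] (h : Resample μ m ν) :
    Resample (μ'.prod μ) (fun ω y => (ω.1, m ω.2 y)) ν :=
  ((MeasurePreserving.id μ').prod h).comp (measurePreserving_prodAssoc μ' μ ν)

theorem Resample.lintegral [SFinite ν] (h : Resample μ m ν) {φ : Ω → ENNReal}
    (hφ : Measurable φ) : ∫⁻ ω, φ ω ∂μ = ∫⁻ ω, ∫⁻ y, φ (m ω y) ∂ν ∂μ := by
  rw [← h.lintegral_comp hφ]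
  exact lintegral_prod _ (hφ.comp h.measurable).aemeasurable

theorem Resample.integral {E : Type*} [NormedAddCommGroup E] [NormedSpace ℝ E] [SFinite μ]
    [SFinite ν] (h : Resample μ m ν) {φ : Ω → E} (hφ : Integrable φ μ) :
    ∫ ω, φ ω ∂μ = ∫ ω, ∫ y, φ (m ω y) ∂ν ∂μ := by
  have h1 : Integrable (φ ∘ Function.uncurry m) (μ.prod ν) := h.integrable_comp_of_integrable hφ
  conv_lhs => rw [← h.map_eq]
  rw [integral_map h.measurable.aemeasurable (by rw [h.map_eq]; exact hφ.1)]
  exact integral_prod _ h1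

/-- The orthogonality of the increments of a martingale, in terms of resampling. -/
theorem Resample.integral_norm_add_sq_le {E : Type*} [NormedAddCommGroup E]
    [InnerProductSpace ℝ E] [CompleteSpace E] [IsProbabilityMeasure μ] [IsProbabilityMeasure ν]
    (h : Resample μ m ν) {A X : Ω → E} {c : ℝ} (hA : MemLp A 2 μ) (hX : MemLp X 2 μ)
    (hAm : ∀ ω y, A (m ω y) = A ω)
    (hX0 : ∀ ω, ∫ y, X (m ω y) ∂ν = 0)
    (hXc : ∀ᵐ ω ∂μ, ∫ y, ‖X (m ω y)‖ ^ 2 ∂ν ≤ c) :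
    ∫ ω, ‖A ω + X ω‖ ^ 2 ∂μ ≤ ∫ ω, ‖A ω‖ ^ 2 ∂μ + c := by
  have iA : Integrable (fun ω => ‖A ω‖ ^ 2) μ := hA.integrable_norm_pow (by norm_num)
  have iX : Integrable (fun ω => ‖X ω‖ ^ 2) μ := hX.integrable_norm_pow (by norm_num)
  have iAX : Integrable (fun ω => inner ℝ (A ω) (X ω)) μ := 
    (hA.norm.integrable_mul hX.norm).mono' (hA.1.inner hX.1)
      (Filter.Eventually.of_forall fun ω => norm_inner_le_norm _ _)
  -- In the inner integral `A` is constant and `X` has mean zero.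
  have hcross : ∫ ω, inner ℝ (A ω) (X ω) ∂μ = 0 := by
    rw [h.integral iAX]
    have iXm : ∀ᵐ ω ∂μ, Integrable (fun y => X (m ω y)) ν := by
      have h1 : Integrable (X ∘ Function.uncurry m) (μ.prod ν) :=
        h.integrable_comp_of_integrable (hX.integrable (by norm_num))
      exact h1.prod_right_ae
    rw [← integral_zero Ω ℝ (μ := μ)]
    refine integral_congr_ae ?_
    filter_upwards [iXm] with ω hω
    simp only [hAm]
    rw [integral_inner hω, hX0, inner_zero_right]
  have hsq : ∫ ω, ‖X ω‖ ^ 2 ∂μ ≤ c := by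
    rw [h.integral iX]
    refine (integral_mono_of_nonneg (Filter.Eventually.of_forall fun ω => by positivity)
      (integrable_const c) hXc).trans ?_
    simp
  calc ∫ ω, ‖A ω + X ω‖ ^ 2 ∂μ
      = ∫ ω, (‖A ω‖ ^ 2 + 2 * inner ℝ (A ω) (X ω) + ‖X ω‖ ^ 2) ∂μ := by
        simp_rw [norm_add_sq_real]
    _ = ∫ ω, ‖A ω‖ ^ 2 ∂μ + 2 * ∫ ω, inner ℝ (A ω) (X ω) ∂μ + ∫ ω, ‖X ω‖ ^ 2 ∂μ := by
        rw [integral_add (f := fun ω => ‖A ω‖ ^ 2 + 2 * inner ℝ (A ω) (X ω))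
          (iA.add (iAX.const_mul 2)) iX, integral_add iA (iAX.const_mul 2), integral_const_mul]
    _ ≤ _ := by rw [hcross]; linarith

end Resample

/-! ### The isotropic Gaussian distribution -/

section Gaussian

variable {d : ℕ}

open Complex in
-- The integral factors over the coordinates into complex moment generating functions at `h j + i t
-- j`. This one formula yields both the exponential moments and the characteristic functions needed
-- for Cameron–Martin.
theorem integral_cexp_stdGaussian (h t : Vec d) :
    ∫ x, cexp ((inner ℝ h x : ℝ) + (inner ℝ t x : ℝ) * I) ∂(stdGaussian (Vec d)) =
      cexp (((‖h‖ ^ 2 / 2 - ‖t‖ ^ 2 / 2 : ℝ) : ℂ) + (inner ℝ h t : ℝ) * I) := by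
  rw [← map_pi_eq_stdGaussian, integral_map (by fun_prop) (by fun_prop)]
  have h1 : ∀ x : Fin d → ℝ, cexp ((inner ℝ h (WithLp.toLp 2 x) : ℝ)
      + (inner ℝ t (WithLp.toLp 2 x) : ℝ) * I) = ∏ j, cexp (((h j : ℂ) + t j * I) * x j) := by
    intro x
    rw [← Complex.exp_sum]
    congr 1
    simp only [PiLp.inner_apply, RCLike.inner_apply, conj_trivial]
    push_cast
    rw [Finset.sum_mul, ← Finset.sum_add_distrib]
    refine Finset.sum_congr rfl fun j _ => ?_
    ring
  simp_rw [h1]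
  rw [integral_fintype_prod_eq_prod (fun j (y : ℝ) => cexp (((h j : ℂ) + t j * I) * y))]
  have h2 : ∀ j : Fin d, ∫ y : ℝ, cexp (((h j : ℂ) + t j * I) * y) ∂(gaussianReal 0 1) =
      cexp (((h j : ℂ) + t j * I) ^ 2 / 2) := by
    intro j
    have := complexMGF_id_gaussianReal (μ := 0) (v := 1) ((h j : ℂ) + t j * I)
    simpa [complexMGF] using this
  simp_rw [h2]
  rw [← Complex.exp_sum]
  congr 1
  simp only [EuclideanSpace.norm_sq_eq, PiLp.inner_apply, RCLike.inner_apply, conj_trivial,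
    Real.norm_eq_abs, sq_abs]
  push_cast
  rw [Finset.sum_div, Finset.sum_div, Finset.sum_mul, ← Finset.sum_sub_distrib,
    ← Finset.sum_add_distrib]
  refine Finset.sum_congr rfl fun j _ => ?_
  linear_combination (t j : ℂ) ^ 2 / 2 * Complex.I_sq

/-- Without integrability the Bochner integral would be `0` by convention, while
`integral_cexp_stdGaussian` evaluates it to an exponential. -/
theorem integrable_exp_inner_stdGaussian (h : Vec d) :
    Integrable (fun x => Real.exp (inner ℝ h x)) (stdGaussian (Vec d)) := by
  have h1 := integral_cexp_stdGaussian h 0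
  by_contra hn
  have h2 : ¬ Integrable (fun x : Vec d => Complex.exp ((inner ℝ h x : ℝ)
      + (inner ℝ (0 : Vec d) x : ℝ) * Complex.I)) (stdGaussian (Vec d)) := by
    intro hi
    refine hn (hi.norm.congr (Filter.Eventually.of_forall fun x => ?_))
    simp [Complex.norm_exp]
  rw [integral_undef h2] at h1
  exact Complex.exp_ne_zero _ h1.symm

theorem integral_exp_inner_stdGaussian (h : Vec d) :
    ∫ x, Real.exp (inner ℝ h x) ∂(stdGaussian (Vec d)) = Real.exp (‖h‖ ^ 2 / 2) := by
  have h1 := integral_cexp_stdGaussian h 0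
  have h2 : ∀ x : Vec d, Complex.exp ((inner ℝ h x : ℝ)
      + (inner ℝ (0 : Vec d) x : ℝ) * Complex.I) = ((Real.exp (inner ℝ h x) : ℝ) : ℂ) := by
    intro x; simp
  simp_rw [h2, integral_complex_ofReal] at h1
  have h3 : Complex.exp (((‖h‖ ^ 2 / 2 - ‖(0 : Vec d)‖ ^ 2 / 2 : ℝ) : ℂ)
      + (inner ℝ h (0 : Vec d) : ℝ) * Complex.I) = ((Real.exp (‖h‖ ^ 2 / 2) : ℝ) : ℂ) := by
    simp
  rw [h3] at h1
  exact_mod_cast h1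

/-- The Cameron–Martin formula for the standard Gaussian distribution. -/
theorem stdGaussian_tilted_inner (h : Vec d) :
    (stdGaussian (Vec d)).tilted (fun x => inner ℝ h x) =
      (stdGaussian (Vec d)).map (fun x => x + h) := by
  have hi := integrable_exp_inner_stdGaussian h
  have := isProbabilityMeasure_tilted hi
  have : IsProbabilityMeasure ((stdGaussian (Vec d)).map (fun x => x + h)) :=
    Measure.isProbabilityMeasure_map (by fun_prop)
  refine Measure.ext_of_charFun ?_
  ext t
  rw [charFun_apply, charFun_apply, integral_tilted, integral_exp_inner_stdGaussian,
    integral_map (by fun_prop) (by fun_prop)]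
  have h1 : ∀ x : Vec d, (Real.exp (inner ℝ h x) / Real.exp (‖h‖ ^ 2 / 2)) •
      Complex.exp ((inner ℝ x t : ℝ) * Complex.I) =
      (Complex.exp (-(‖h‖ ^ 2 / 2 : ℝ))) * Complex.exp ((inner ℝ h x : ℝ)
      + (inner ℝ t x : ℝ) * Complex.I) := by
    intro x
    rw [Complex.real_smul, ← Real.exp_sub, Complex.ofReal_exp, ← Complex.exp_add,
      ← Complex.exp_add, real_inner_comm t x]
    congr 1
    push_cast
    ring
  have h2 : ∀ x : Vec d, Complex.exp ((inner ℝ (x + h) t : ℝ) * Complex.I) =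
      Complex.exp ((inner ℝ h t : ℝ) * Complex.I) * Complex.exp ((inner ℝ (0 : Vec d) x : ℝ)
      + (inner ℝ t x : ℝ) * Complex.I) := by
    intro x
    rw [← Complex.exp_add, inner_add_left, real_inner_comm t x, inner_zero_left]
    congr 1
    push_cast
    ring
  simp_rw [h1, h2]
  rw [integral_const_mul, integral_const_mul, integral_cexp_stdGaussian, integral_cexp_stdGaussian,
    ← Complex.exp_add, ← Complex.exp_add]
  congr 1
  simp
  ring

/-- The density at `x` of the law `N(-q, σ² I)` with respect to `N(0, σ² I)`. -/
def shiftDensity (σ : ℝ) (q x : Vec d) : ℝ :=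
  Real.exp (-(inner ℝ q x) / σ ^ 2 - ‖q‖ ^ 2 / (2 * σ ^ 2))

theorem shiftDensity_pos (σ : ℝ) (q x : Vec d) : 0 < shiftDensity σ q x := Real.exp_pos _

theorem lintegral_isoGaussian_shift {σ : ℝ} (hσ : 0 < σ) (q : Vec d) {φ : Vec d → ENNReal}
    (hφ : Measurable φ) :
    ∫⁻ x, φ x ∂(isoGaussian d σ) =
      ∫⁻ x, φ (x + q) * ENNReal.ofReal (shiftDensity σ q x) ∂(isoGaussian d σ) := by
  have hm : Measurable fun x : Vec d => ENNReal.ofReal (shiftDensity σ q x) := by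
    unfold shiftDensity; fun_prop
  have hm' : Measurable fun x : Vec d => φ (x + q) * ENNReal.ofReal (shiftDensity σ q x) :=
    (hφ.comp (by fun_prop)).mul hm
  rw [isoGaussian, lintegral_map hφ (by fun_prop), lintegral_map hm' (by fun_prop)]
  have hψ : Measurable fun x : Vec d => φ (σ • x + q) := hφ.comp (by fun_prop)
  -- In the coordinates of the standard Gaussian the translation by `-q` has size `1 / σ`, so the
  -- tilt is along `-(σ⁻¹) • q`.
  have h1 := lintegral_map (μ := stdGaussian (Vec d)) hψ
    (by fun_prop : Measurable fun x : Vec d => x + (-(σ⁻¹) • q))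
  rw [← stdGaussian_tilted_inner, lintegral_tilted, integral_exp_inner_stdGaussian] at h1
  have h2 : ∀ x : Vec d, φ (σ • (x + -σ⁻¹ • q) + q) = φ (σ • x) := by
    intro x
    congr 1
    rw [smul_add, smul_smul, mul_neg, mul_inv_cancel₀ hσ.ne']
    simp
  simp_rw [h2] at h1
  rw [← h1]
  refine lintegral_congr fun x => ?_
  rw [mul_comm]
  congr 2
  rw [shiftDensity, ← Real.exp_sub, inner_smul_left, inner_smul_right, norm_smul, mul_pow]
  congr 1
  simp
  field_simp

/-- The exponential moment contributes `α²‖q‖²/(2σ²)` and the normalization `-α‖q‖²/(2σ²)`. This is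
the price of shifting one node. -/
theorem lintegral_shiftDensity_rpow {σ : ℝ} (hσ : 0 < σ) (q : Vec d) (α : ℝ) :
    ∫⁻ x, ENNReal.ofReal (shiftDensity σ q x ^ α) ∂(isoGaussian d σ) =
      ENNReal.ofReal (Real.exp (α * (α - 1) * ‖q‖ ^ 2 / (2 * σ ^ 2))) := by
  have hm : Measurable fun x : Vec d => ENNReal.ofReal (shiftDensity σ q x ^ α) := by
    unfold shiftDensity; fun_prop
  rw [isoGaussian, lintegral_map hm (by fun_prop)]
  have h1 : ∀ x : Vec d, shiftDensity σ q (σ • x) ^ α =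
      Real.exp (inner ℝ (-(α / σ) • q) x) * Real.exp (-α * ‖q‖ ^ 2 / (2 * σ ^ 2)) := by
    intro x
    rw [shiftDensity, ← Real.exp_mul, ← Real.exp_add, inner_smul_left, inner_smul_right]
    congr 1
    simp
    field_simp
    ring
  simp_rw [h1]
  rw [← ofReal_integral_eq_lintegral_ofReal
    ((integrable_exp_inner_stdGaussian _).mul_const _)
    (Filter.Eventually.of_forall fun x => by positivity), integral_mul_const,
    integral_exp_inner_stdGaussian, ← Real.exp_add, norm_smul]
  congr 2
  rw [mul_pow, Real.norm_eq_abs, sq_abs]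
  field_simp
  ring

theorem memLp_isoGaussian (d : ℕ) (σ : ℝ) : MemLp (fun x : Vec d => x) 2 (isoGaussian d σ) := by
  rw [isoGaussian, memLp_map_measure_iff (by fun_prop) (by fun_prop)]
  exact (IsGaussian.memLp_two_id (μ := stdGaussian (Vec d))).const_smul σ

theorem integral_isoGaussian (d : ℕ) (σ : ℝ) : ∫ x, x ∂(isoGaussian d σ) = 0 := by
  rw [isoGaussian, integral_map (by fun_prop) (by fun_prop), integral_smul,
    integral_id_stdGaussian, smul_zero]

theorem integral_norm_sq_isoGaussian (d : ℕ) (σ : ℝ) :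
    ∫ x, ‖x‖ ^ 2 ∂(isoGaussian d σ) = d * σ ^ 2 := by
  rw [isoGaussian, integral_map (by fun_prop) (by fun_prop), ← map_pi_eq_stdGaussian,
    integral_map (by fun_prop) (by fun_prop)]
  simp_rw [norm_smul, mul_pow, EuclideanSpace.norm_sq_eq, Real.norm_eq_abs, sq_abs]
  have hi : ∀ i : Fin d, Integrable (fun x : Fin d → ℝ => x i ^ 2)
      (Measure.pi fun _ => gaussianReal 0 1) := fun i =>
    integrable_comp_eval (μ := fun _ : Fin d => gaussianReal 0 1) (i := i)
      (f := fun y : ℝ => y ^ 2) (memLp_id_gaussianReal 2).integrable_sq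
  rw [integral_const_mul, integral_finsetSum _ fun i _ => hi i]
  have h1 : ∀ i : Fin d, ∫ x : Fin d → ℝ, x i ^ 2 ∂(Measure.pi fun _ => gaussianReal 0 1) = 1 := by
    intro i
    rw [integral_comp_eval (μ := fun _ : Fin d => gaussianReal 0 1) (i := i)
      (f := fun y : ℝ => y ^ 2) (by fun_prop)]
    have h2 := variance_eq_sub (memLp_id_gaussianReal (μ := 0) (v := 1) 2)
    rw [variance_id_gaussianReal] at h2
    simpa [integral_id_gaussianReal] using h2.symm
  simp_rw [h1]
  simp [mul_comm]

end Gaussian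

/-! ### Data processing for the Rényi divergence -/

section Renyi

variable {Ω R : Type*} [MeasurableSpace Ω] [MeasurableSpace R]

/-- If `g ≤ ∫ g^(α-1) p` type estimates hold for a bounded function `g`, Hölder's inequality
absorbs the power of `g`. -/
theorem lintegral_rpow_le_of_le_mul {Q : Measure Ω} {g p : Ω → ENNReal} {α : ℝ}
    (hα : 1 < α) (hg : Measurable g) (hp : Measurable p) (hfin : ∫⁻ ω, g ω ^ α ∂Q ≠ ⊤)
    (h : ∫⁻ ω, g ω ^ α ∂Q ≤ ∫⁻ ω, g ω ^ (α - 1) * p ω ∂Q) :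
    ∫⁻ ω, g ω ^ α ∂Q ≤ ∫⁻ ω, p ω ^ α ∂Q := by
  set I := ∫⁻ ω, g ω ^ α ∂Q with hI
  rcases eq_or_ne I 0 with h0 | h0
  · rw [h0]; exact zero_le
  have hc : (α / (α - 1)).HolderConjugate α := by
    rw [Real.holderConjugate_iff]
    refine ⟨by rw [lt_div_iff₀ (by linarith)]; linarith, ?_⟩
    have : α - 1 ≠ 0 := by linarith
    field_simp
    ring
  have h1 := ENNReal.lintegral_mul_le_Lp_mul_Lq Q hc (hg.pow_const (α - 1)).aemeasurable
    hp.aemeasurable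
  have h2 : ∀ ω, (g ω ^ (α - 1)) ^ (α / (α - 1)) = g ω ^ α := fun ω => by
    rw [← ENNReal.rpow_mul]
    congr 1
    have : α - 1 ≠ 0 := by linarith
    field_simp
  simp only [Pi.mul_apply, h2] at h1
  have h3 : I ≤ I ^ (1 / (α / (α - 1))) * (∫⁻ ω, p ω ^ α ∂Q) ^ (1 / α) := h.trans h1
  have hα0 : α ≠ 0 := by linarith
  have hsplit : I = I ^ (1 / (α / (α - 1))) * I ^ (1 / α) := by
    rw [← ENNReal.rpow_add _ _ h0 hfin]
    have : (1 / (α / (α - 1)) + 1 / α) = 1 := by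
      rw [one_div_div]; field_simp; ring
    rw [this, ENNReal.rpow_one]
  have hexp : 0 ≤ 1 / (α / (α - 1)) := by
    rw [one_div_div]; exact div_nonneg (by linarith) (by linarith)
  have h4 : I ^ (1 / α) ≤ (∫⁻ ω, p ω ^ α ∂Q) ^ (1 / α) := by
    have h5 : I ^ (1 / (α / (α - 1))) ≠ 0 := by
      simp [ENNReal.rpow_eq_zero_iff, h0, hfin]
    have h6 : I ^ (1 / (α / (α - 1))) ≠ ⊤ :=
      ENNReal.rpow_ne_top_of_nonneg hexp hfin
    rw [← ENNReal.mul_le_mul_iff_right h5 h6, ← hsplit]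
    exact h3
  exact (ENNReal.rpow_le_rpow_iff (by positivity)).1 h4

/-- Data processing: the density of the image law cannot have a larger `α`-moment than the density
upstairs. The power `α - 1` of the Radon–Nikodym derivative is used as the test function and Hölder
absorbs it; since this divides by a moment, the derivative is first truncated at `n`, and monotone
convergence removes the truncation. -/
theorem lintegral_rnDeriv_rpow_le {Q : Measure Ω} [IsProbabilityMeasure Q]
    {μ ν : Measure R} [IsFiniteMeasure μ]
    [IsFiniteMeasure ν] {Φ : Ω → R} {p : Ω → ENNReal} {α : ℝ} (hα : 1 < α)
    (hΦ : Measurable Φ) (hp : Measurable p) (hν : ν = Q.map Φ)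
    (hμ : ∀ φ : R → ENNReal, Measurable φ → ∫⁻ x, φ x ∂μ = ∫⁻ ω, φ (Φ ω) * p ω ∂Q) :
    ∫⁻ x, (μ.rnDeriv ν x) ^ α ∂ν ≤ ∫⁻ ω, p ω ^ α ∂Q := by
  have hmr := Measure.measurable_rnDeriv μ ν
  have hα1 : 0 < α - 1 := by linarith
  have key : ∀ n : ℕ, ∫⁻ x, (min (μ.rnDeriv ν x) n) ^ α ∂ν ≤ ∫⁻ ω, p ω ^ α ∂Q := by
    intro n
    have hgm : Measurable fun x => min (μ.rnDeriv ν x) (n : ENNReal) := hmr.min measurable_const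
    have hfin : ∫⁻ x, (min (μ.rnDeriv ν x) n) ^ α ∂ν ≠ ⊤ := by
      refine ne_top_of_le_ne_top ?_ (lintegral_mono (g := fun _ => (n : ENNReal) ^ α)
        fun x => ENNReal.rpow_le_rpow (min_le_right _ _) (by linarith))
      rw [lintegral_const]
      exact ENNReal.mul_ne_top (ENNReal.rpow_ne_top_of_nonneg (by linarith)
        (ENNReal.natCast_ne_top n)) (measure_ne_top _ _)
    -- One factor of the truncation is replaced by the full derivative, which turns `ν` into (a part
    -- of) `μ`.
    have hle : ∫⁻ x, (min (μ.rnDeriv ν x) n) ^ α ∂ν ≤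
        ∫⁻ x, (min (μ.rnDeriv ν x) n) ^ (α - 1) ∂μ := by
      calc ∫⁻ x, (min (μ.rnDeriv ν x) n) ^ α ∂ν
          ≤ ∫⁻ x, μ.rnDeriv ν x * (min (μ.rnDeriv ν x) n) ^ (α - 1) ∂ν := by
            refine lintegral_mono fun x => ?_
            have : α = 1 + (α - 1) := by ring
            conv_lhs => rw [this, ENNReal.rpow_add_of_nonneg _ _ zero_le_one hα1.le,
              ENNReal.rpow_one]
            gcongr
            exact min_le_left _ _
        _ = ∫⁻ x, (min (μ.rnDeriv ν x) n) ^ (α - 1) ∂(ν.withDensity (μ.rnDeriv ν)) := by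
            rw [lintegral_withDensity_eq_lintegral_mul _ hmr (hgm.pow_const _)]
            rfl
        _ ≤ _ := lintegral_mono' (Measure.withDensity_rnDeriv_le μ ν) le_rfl
    rw [hμ _ (hgm.pow_const _)] at hle
    have heq : ∫⁻ x, (min (μ.rnDeriv ν x) n) ^ α ∂ν =
        ∫⁻ ω, (min (μ.rnDeriv ν (Φ ω)) n) ^ α ∂Q := by
      conv_lhs => rw [hν]
      rw [← hν, hν, lintegral_map (by rw [← hν]; exact hgm.pow_const _) hΦ]
    rw [heq] at hle hfin ⊢
    exact lintegral_rpow_le_of_le_mul hα (hgm.comp hΦ) hp hfin hle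
  have hmono : ∫⁻ x, (μ.rnDeriv ν x) ^ α ∂ν = ⨆ n : ℕ, ∫⁻ x, (min (μ.rnDeriv ν x) n) ^ α ∂ν := by
    rw [← lintegral_iSup (fun n => (hmr.min measurable_const).pow_const _)]
    · refine lintegral_congr_ae ?_
      filter_upwards [Measure.rnDeriv_lt_top μ ν] with x hx
      obtain ⟨n, hn⟩ := ENNReal.exists_nat_gt hx.ne
      refine le_antisymm ?_ (iSup_le fun k =>
        ENNReal.rpow_le_rpow (min_le_left _ _) (by linarith))
      refine le_iSup_of_le n ?_
      rw [min_eq_left hn.le]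
    · intro a b hab x
      refine ENNReal.rpow_le_rpow (min_le_min le_rfl ?_) (by linarith)
      exact_mod_cast hab
  rw [hmono]
  exact iSup_le key

theorem renyiDiv_le_of_density {Q : Measure Ω} [IsProbabilityMeasure Q]
    {μ ν : Measure R} [IsFiniteMeasure μ]
    [IsFiniteMeasure ν] {Φ : Ω → R} {p : Ω → ENNReal} {α c : ℝ} (hα : 1 < α)
    (hΦ : Measurable Φ) (hp : Measurable p) (hν : ν = Q.map Φ)
    (hμ : ∀ φ : R → ENNReal, Measurable φ → ∫⁻ x, φ x ∂μ = ∫⁻ ω, φ (Φ ω) * p ω ∂Q)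
    (hc : ∫⁻ ω, p ω ^ α ∂Q ≤ ENNReal.ofReal (Real.exp ((α - 1) * c))) :
    renyiDiv α μ ν ≤ (c : EReal) := by
  have hac : μ ≪ ν := by
    refine Measure.AbsolutelyContinuous.mk fun s hs h0 => ?_
    rw [hν, Measure.map_apply hΦ hs] at h0
    rw [← lintegral_indicator_one hs, hμ _ (measurable_one.indicator hs)]
    refine lintegral_eq_zero_of_ae_eq_zero ?_
    have h1 : ∀ᵐ ω ∂Q, ω ∉ Φ ⁻¹' s := measure_eq_zero_iff_ae_notMem.1 h0
    filter_upwards [h1] with ω hω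
    have : Φ ω ∉ s := hω
    simp [this]
  have h1 := (lintegral_rnDeriv_rpow_le hα hΦ hp hν hμ).trans hc
  have h2 : ENNReal.log (∫⁻ x, (μ.rnDeriv ν x) ^ α ∂ν) ≤ (((α - 1) * c : ℝ) : EReal) := by
    refine (ENNReal.log_monotone h1).trans_eq ?_
    rw [ENNReal.log_ofReal_of_pos (Real.exp_pos _), Real.log_exp]
  have hα1 : 0 < α - 1 := by linarith
  rw [renyiDiv, if_pos hac]
  calc (((α - 1)⁻¹ : ℝ) : EReal) * ENNReal.log (∫⁻ x, (μ.rnDeriv ν x) ^ α ∂ν)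
      ≤ (((α - 1)⁻¹ : ℝ) : EReal) * (((α - 1) * c : ℝ) : EReal) := by
        refine mul_le_mul_of_nonneg_left h2 ?_
        exact_mod_cast (inv_pos.2 hα1).le
    _ = (c : EReal) := by
        rw [← EReal.coe_mul, inv_mul_cancel_left₀ hα1.ne']

end Renyi

/-! ### The state of a round: dependence on the data and on the draws -/

section Round

variable {d : ℕ} {c : Params}

/-- The number of data points of an epoch that are used before round `n + 1`. -/
def Params.dataBefore (c : Params) : ℕ → ℕ
  | 0 => 0
  | n + 1 => c.B₁ + c.B₂ * n

theorem Params.dataBefore_le_epochSize {n : ℕ} (hn : n ≤ c.T) :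
    c.dataBefore n ≤ c.epochSize := by
  cases n with
  | zero => exact Nat.zero_le _
  | succ n =>
    exact Nat.add_le_add_left (Nat.mul_le_mul_left _ (by omega)) _

/-- The summand of `g_{n+1}` that is contributed by round `n + 1`, as a function of the query
points of the rounds `n + 1` and `n`. -/
def gradIncrement (c : Params) (v : ℕ → Vec d → ℝ) (u : ℕ → Fin d → Vec d) :
    ℕ → Vec d → Vec d → Vec d
  | 0, w, _ => gradEst c.δ c.B₁ v u w
  | n + 1, w, w' =>
    diffEst c.δ c.B₂ (fun i => v (c.B₁ + c.B₂ * n + i)) (fun i => u (c.B₁ + c.B₂ * n + i)) w w'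

theorem gradEst_congr {δ : ℝ} {b : ℕ} {v v' : ℕ → Vec d → ℝ} {u u' : ℕ → Fin d → Vec d} (x : Vec d)
    (hv : ∀ i < b, v i = v' i) (hu : ∀ i < b, u i = u' i) :
    gradEst δ b v u x = gradEst δ b v' u' x := by
  unfold gradEst
  congr 1
  refine Finset.sum_congr rfl fun i hi => ?_
  rw [hv i (Finset.mem_range.1 hi), hu i (Finset.mem_range.1 hi)]

theorem diffEst_congr {δ : ℝ} {b : ℕ} {v v' : ℕ → Vec d → ℝ} {u u' : ℕ → Fin d → Vec d}
    (x y : Vec d) (hv : ∀ i < b, v i = v' i) (hu : ∀ i < b, u i = u' i) :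
    diffEst δ b v u x y = diffEst δ b v' u' x y := by
  unfold diffEst
  congr 1
  refine Finset.sum_congr rfl fun i hi => ?_
  rw [hv i (Finset.mem_range.1 hi), hu i (Finset.mem_range.1 hi)]

theorem gradIncrement_congr {v v' : ℕ → Vec d → ℝ} {u u' : ℕ → Fin d → Vec d} (n : ℕ) (w w' : Vec d)
    (hv : ∀ i, c.dataBefore n ≤ i → i < c.dataBefore (n + 1) → v i = v' i)
    (hu : ∀ i, c.dataBefore n ≤ i → i < c.dataBefore (n + 1) → u i = u' i) :
    gradIncrement c v u n w w' = gradIncrement c v' u' n w w' := by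
  cases n with
  | zero =>
    have hb : c.dataBefore (0 + 1) = c.B₁ := by simp [Params.dataBefore]
    rw [hb] at hv hu
    exact gradEst_congr _ (fun i hi => hv i (Nat.zero_le _) hi) fun i hi => hu i (Nat.zero_le _) hi
  | succ n =>
    have hb : c.dataBefore (n + 1 + 1) = c.B₁ + c.B₂ * n + c.B₂ := by
      simp [Params.dataBefore]; ring
    rw [hb] at hv hu
    exact diffEst_congr _ _ (fun i hi => hv _ (Nat.le_add_right _ _) (Nat.add_lt_add_left hi _))
      (fun i hi => hu _ (Nat.le_add_right _ _) (Nat.add_lt_add_left hi _))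

theorem treeNoise_congr {ξ ξ' : ℕ → Vec d} {t : ℕ} (h : ∀ b ≤ t, ξ b = ξ' b) :
    treeNoise ξ t = treeNoise ξ' t := by
  rw [treeNoise_eq, treeNoise_eq]
  exact Finset.sum_congr rfl fun b hb => h b (le_of_mem_nodeEnds hb)

theorem roundState_congr {v v' : ℕ → Vec d → ℝ} {u u' : ℕ → Fin d → Vec d} {s s' : ℕ → ℝ}
    {ξ ξ' : ℕ → Vec d} (x : Vec d) (n : ℕ)
    (hv : ∀ i < c.dataBefore (n + 1), v i = v' i) (hu : ∀ i < c.dataBefore (n + 1), u i = u' i)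
    (hs : ∀ t ≤ n + 1, s t = s' t) (hξ : ∀ b ≤ n + 1, ξ b = ξ' b) :
    roundState c v u s ξ x n = roundState c v' u' s' ξ' x n := by
  induction n with
  | zero =>
    simp only [roundState, hs 1 le_rfl, treeNoise_congr hξ]
    have := gradIncrement_congr (c := c) 0 (x + s' 1 • (0 : Vec d)) 0 (fun i _ hi => hv i hi)
      (fun i _ hi => hu i hi)
    simp only [gradIncrement] at this
    rw [this]
  | succ n ih =>
    have hle : c.dataBefore (n + 1) ≤ c.dataBefore (n + 1 + 1) := by
      simp only [Params.dataBefore]; gcongr; omega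
    have ih' := ih (fun i hi => hv i (hi.trans_le hle)) (fun i hi => hu i (hi.trans_le hle))
      (fun t ht => hs t (by omega)) (fun b hb => hξ b (by omega))
    simp only [roundState, ih', hs (n + 2) le_rfl, treeNoise_congr hξ]
    have := fun w w' => gradIncrement_congr (c := c) (n + 1) w w' (fun i _ hi => hv i hi)
      (fun i _ hi => hu i hi)
    simp only [gradIncrement] at this
    rw [this]

/-- `x_{n+1}` and `Δ_{n+1}` depend on what happens before round `n + 1`. -/
theorem roundState_x_Δ_congr {v v' : ℕ → Vec d → ℝ} {u u' : ℕ → Fin d → Vec d} {s s' : ℕ → ℝ}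
    {ξ ξ' : ℕ → Vec d} (x : Vec d) (n : ℕ)
    (hv : ∀ i < c.dataBefore n, v i = v' i) (hu : ∀ i < c.dataBefore n, u i = u' i)
    (hs : ∀ t ≤ n, s t = s' t) (hξ : ∀ b ≤ n, ξ b = ξ' b) :
    (roundState c v u s ξ x n).x = (roundState c v' u' s' ξ' x n).x ∧
      (roundState c v u s ξ x n).Δ = (roundState c v' u' s' ξ' x n).Δ := by
  cases n with
  | zero => simp [roundState]
  | succ n => simp only [roundState, roundState_congr x n hv hu hs hξ, and_self]

theorem roundState_w (v : ℕ → Vec d → ℝ) (u : ℕ → Fin d → Vec d) (s : ℕ → ℝ) (ξ : ℕ → Vec d)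
    (x : Vec d) (n : ℕ) :
    (roundState c v u s ξ x n).w =
      (roundState c v u s ξ x n).x + s (n + 1) • (roundState c v u s ξ x n).Δ := by
  cases n <;> rfl

/-- A query point uses the interpolation draw of its own round, but neither the batch nor the tree
sample of that round. Both the unbiasedness of the increments and the admissibility of the noise
shift rest on this. -/
theorem roundState_w_congr {v v' : ℕ → Vec d → ℝ} {u u' : ℕ → Fin d → Vec d} {s s' : ℕ → ℝ}
    {ξ ξ' : ℕ → Vec d} (x : Vec d) (n : ℕ)
    (hv : ∀ i < c.dataBefore n, v i = v' i) (hu : ∀ i < c.dataBefore n, u i = u' i)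
    (hs : ∀ t ≤ n + 1, s t = s' t) (hξ : ∀ b ≤ n, ξ b = ξ' b) :
    (roundState c v u s ξ x n).w = (roundState c v' u' s' ξ' x n).w := by
  have h := roundState_x_Δ_congr x n hv hu (fun t ht => hs t (by omega)) hξ
  rw [roundState_w, roundState_w, h.1, h.2, hs (n + 1) le_rfl]

theorem roundState_gPriv (v : ℕ → Vec d → ℝ) (u : ℕ → Fin d → Vec d) (s : ℕ → ℝ) (ξ : ℕ → Vec d)
    (x : Vec d) (n : ℕ) :
    (roundState c v u s ξ x n).gPriv = (roundState c v u s ξ x n).g + treeNoise ξ (n + 1) := by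
  cases n <;> rfl

theorem norm_roundState_Δ_le (hD : 0 ≤ c.D) (v : ℕ → Vec d → ℝ) (u : ℕ → Fin d → Vec d) (s : ℕ → ℝ)
    (ξ : ℕ → Vec d) (x : Vec d) (n : ℕ) : ‖(roundState c v u s ξ x n).Δ‖ ≤ c.D := by
  cases n with
  | zero => simpa [roundState] using hD
  | succ n => exact (projBall_spec hD _).1

/-- The difference is the unused part of one increment plus the used part of the next, each of norm
at most `D`. This stability keeps the difference estimator small. -/
theorem norm_roundState_w_sub_le (hD : 0 ≤ c.D) (v : ℕ → Vec d → ℝ) (u : ℕ → Fin d → Vec d)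
    {s : ℕ → ℝ} (hs : ∀ t, s t ∈ Set.Icc (0 : ℝ) 1) (ξ : ℕ → Vec d) (x : Vec d) (n : ℕ) :
    ‖(roundState c v u s ξ x (n + 1)).w - (roundState c v u s ξ x n).w‖ ≤ 2 * c.D := by
  have h1 := norm_roundState_Δ_le hD v u s ξ x n
  have h2 := norm_roundState_Δ_le hD v u s ξ x (n + 1)
  have hx : (roundState c v u s ξ x (n + 1)).x =
      (roundState c v u s ξ x n).x + (roundState c v u s ξ x n).Δ := rfl
  have he : (roundState c v u s ξ x (n + 1)).w - (roundState c v u s ξ x n).w =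
      (1 - s (n + 1)) • (roundState c v u s ξ x n).Δ
        + s (n + 2) • (roundState c v u s ξ x (n + 1)).Δ := by
    rw [roundState_w, roundState_w, hx, sub_smul, one_smul]
    abel
  rw [he]
  refine (norm_add_le _ _).trans ?_
  rw [norm_smul, norm_smul, Real.norm_of_nonneg (by linarith [(hs (n + 1)).2]),
    Real.norm_of_nonneg (hs (n + 2)).1]
  have h3 := mul_le_mul (by linarith [(hs (n + 1)).1] : 1 - s (n + 1) ≤ 1) h1 (norm_nonneg _)
    zero_le_one
  have h4 := mul_le_mul (hs (n + 2)).2 h2 (norm_nonneg _) zero_le_one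
  linarith

/-! ### Measurability -/

theorem measurable_projBall (D : ℝ) : Measurable (projBall (d := d) D) := by
  unfold projBall
  refine Measurable.ite (measurableSet_le (by fun_prop) (by fun_prop)) measurable_id ?_
  exact (measurable_const.div measurable_norm).smul measurable_id

variable {Ω : Type*} [MeasurableSpace Ω]

theorem measurable_treeNoise {ξ : Ω → ℕ → Vec d} (hξ : ∀ b, Measurable fun ω => ξ ω b) (t : ℕ) :
    Measurable fun ω => treeNoise (ξ ω) t := by
  unfold treeNoise
  exact Finset.measurable_sum _ fun p _ => hξ p.2

theorem measurable_gradIncrement {v : Ω → ℕ → Vec d → ℝ} {u : Ω → ℕ → Fin d → Vec d}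
    (hv : ∀ i, Measurable fun p : Ω × Vec d => v p.1 i p.2)
    (hu : ∀ i j, Measurable fun ω => u ω i j) (n : ℕ) {w w' : Ω → Vec d} (hw : Measurable w)
    (hw' : Measurable w') :
    Measurable fun ω => gradIncrement c (v ω) (u ω) n (w ω) (w' ω) := by
  have hv' : ∀ i (y : Ω → Vec d), Measurable y → Measurable fun ω => v ω i (y ω) :=
    fun i y hy => (hv i).comp (measurable_id.prodMk hy)
  cases n with
  | zero =>
    simp only [gradIncrement, gradEst]
    refine Measurable.fun_const_smul (Finset.measurable_sum _ fun i _ =>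
      Measurable.fun_const_smul (Finset.measurable_sum _ fun j _ => ?_) _) _
    have h1 := hv' i (fun ω => w ω + c.δ • u ω i j) (by fun_prop)
    have h2 := hv' i (fun ω => w ω - c.δ • u ω i j) (by fun_prop)
    exact ((h1.sub h2).const_mul _).smul (hu i j)
  | succ n =>
    simp only [gradIncrement, diffEst]
    refine Measurable.fun_const_smul (Finset.measurable_sum _ fun i _ =>
      Measurable.fun_const_smul (Finset.measurable_sum _ fun j _ => ?_) _) _
    have h1 := hv' (c.B₁ + c.B₂ * n + i)
      (fun ω => w ω + c.δ • u ω (c.B₁ + c.B₂ * n + i) j) (by fun_prop)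
    have h2 := hv' (c.B₁ + c.B₂ * n + i)
      (fun ω => w' ω + c.δ • u ω (c.B₁ + c.B₂ * n + i) j) (by fun_prop)
    exact ((h1.sub h2).const_mul _).smul (hu _ j)

theorem measurable_roundState {v : Ω → ℕ → Vec d → ℝ} {u : Ω → ℕ → Fin d → Vec d} {s : Ω → ℕ → ℝ}
    {ξ : Ω → ℕ → Vec d} {x : Ω → Vec d} (hv : ∀ i, Measurable fun p : Ω × Vec d => v p.1 i p.2)
    (hu : ∀ i j, Measurable fun ω => u ω i j) (hs : ∀ t, Measurable fun ω => s ω t)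
    (hξ : ∀ b, Measurable fun ω => ξ ω b) (hx : Measurable x) (n : ℕ) :
    Measurable (fun ω => (roundState c (v ω) (u ω) (s ω) (ξ ω) (x ω) n).x) ∧
    Measurable (fun ω => (roundState c (v ω) (u ω) (s ω) (ξ ω) (x ω) n).Δ) ∧
    Measurable (fun ω => (roundState c (v ω) (u ω) (s ω) (ξ ω) (x ω) n).w) ∧
    Measurable (fun ω => (roundState c (v ω) (u ω) (s ω) (ξ ω) (x ω) n).g) ∧
    Measurable (fun ω => (roundState c (v ω) (u ω) (s ω) (ξ ω) (x ω) n).gPriv) := by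
  induction n with
  | zero =>
    have hw : Measurable fun ω => x ω + s ω 1 • (0 : Vec d) :=
      hx.add ((hs 1).smul measurable_const)
    have hg := measurable_gradIncrement (c := c) hv hu 0 hw hw
    exact ⟨hx, measurable_const, hw, hg, hg.add (measurable_treeNoise hξ 1)⟩
  | succ n ih =>
    obtain ⟨h1, h2, h3, h4, h5⟩ := ih
    have h6 := h1.add h2
    have h7 := (measurable_projBall (d := d) c.D).comp (h2.sub (h5.const_smul c.η))
    have h8 := h6.add ((hs (n + 2)).smul h7)
    have h9 := h4.add (measurable_gradIncrement (c := c) hv hu (n + 1) h8 h3)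
    exact ⟨h6, h7, h8, h9, h9.add (measurable_treeNoise hξ _)⟩

end Round

/-! ### The whole run: dependence on earlier epochs and joint measurability. -/

section Run

variable {d M : ℕ} {Z : Type*} {c : Params} {f : Vec d → Z → ℝ} {x₁ : Vec d}

theorem epochStart_congr {S S' : Fin M → Z} {ω ω' : Tape d c.K} (k : ℕ)
    (hS : ∀ n < k * c.epochSize, dataLoss f S n = dataLoss f S' n)
    (hu : ∀ n < k * c.epochSize, ∀ j, ω.2.2.1 (n, j) = ω'.2.2.1 (n, j))
    (hs : ∀ k' < k, ∀ t, ω.1 (k', t) = ω'.1 (k', t))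
    (hξ : ∀ k' < k, ∀ t, ω.2.1 (k', t) = ω'.2.1 (k', t)) :
    epochStart c f x₁ S ω k = epochStart c f x₁ S' ω' k := by
  induction k with
  | zero => rfl
  | succ k ih =>
    have hk : k * c.epochSize ≤ (k + 1) * c.epochSize := Nat.mul_le_mul_right _ (by omega)
    have hlt : ∀ i, i < c.dataBefore (c.T - 1 + 1) → k * c.epochSize + i < (k + 1) * c.epochSize := by
      intro i hi
      rw [Nat.add_mul, one_mul]
      exact Nat.add_lt_add_left hi _
    simp only [epochStart, epochState]
    rw [ih (fun n hn => hS n (hn.trans_le hk)) (fun n hn => hu n (hn.trans_le hk))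
      (fun k' hk' => hs k' (by omega)) (fun k' hk' => hξ k' (by omega)),
      roundState_congr _ (c.T - 1) (fun i hi => hS _ (hlt i hi))
        (fun i hi => funext fun j => hu _ (hlt i hi) j) (fun t _ => hs k (by omega) t)
        (fun t _ => hξ k (by omega) t)]

theorem dataLoss_lipschitz {L : ℝ} (hL : 0 ≤ L)
    (hf : ∀ (z : Z) (x y : Vec d), |f x z - f y z| ≤ L * ‖x - y‖)
    (S : Fin M → Z) (n : ℕ) (x y : Vec d) : |dataLoss f S n x - dataLoss f S n y| ≤ L * ‖x - y‖ := by
  unfold dataLoss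
  split_ifs with h
  · exact hf _ _ _
  · simpa using mul_nonneg hL (norm_nonneg _)

variable [MeasurableSpace Z]

theorem measurable_dataLoss (hf : Measurable fun p : Vec d × Z => f p.1 p.2) (n : ℕ) :
    Measurable fun p : (Fin M → Z) × Vec d => dataLoss f p.1 n p.2 := by
  unfold dataLoss
  split_ifs with h
  · exact hf.comp (measurable_snd.prodMk ((measurable_pi_apply _).comp measurable_fst))
  · exact measurable_const

theorem measurable_epochState (hf : Measurable fun p : Vec d × Z => f p.1 p.2) (k : ℕ)
    {x : (Fin M → Z) × Tape d c.K → Vec d} (hx : Measurable x) (n : ℕ) :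
    Measurable (fun q => (epochState c f q.1 q.2 k (x q) n).x) ∧
    Measurable (fun q => (epochState c f q.1 q.2 k (x q) n).Δ) ∧
    Measurable (fun q => (epochState c f q.1 q.2 k (x q) n).w) ∧
    Measurable (fun q => (epochState c f q.1 q.2 k (x q) n).g) ∧
    Measurable (fun q => (epochState c f q.1 q.2 k (x q) n).gPriv) := by
  refine measurable_roundState (fun i => ?_) (fun i j => ?_) (fun t => ?_) (fun t => ?_) hx n
  · exact (measurable_dataLoss hf _).comp
      ((measurable_fst.comp measurable_fst).prodMk measurable_snd)
  · fun_prop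
  · fun_prop
  · fun_prop

theorem measurable_epochStart (hf : Measurable fun p : Vec d × Z => f p.1 p.2) (k : ℕ) :
    Measurable (fun q : (Fin M → Z) × Tape d c.K => epochStart c f x₁ q.1 q.2 k) := by
  induction k with
  | zero => exact measurable_const
  | succ k ih =>
    obtain ⟨h1, h2, -⟩ := measurable_epochState (c := c) hf k ih (c.T - 1)
    exact h1.add h2

theorem measurable_epochAverage (hf : Measurable fun p : Vec d × Z => f p.1 p.2) (k : ℕ) :
    Measurable (fun q : (Fin M → Z) × Tape d c.K => epochAverage c f x₁ q.1 q.2 k) := by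
  unfold epochAverage
  exact Measurable.fun_const_smul (Finset.measurable_sum _ fun n _ =>
    (measurable_epochState hf k (measurable_epochStart hf k) n).2.2.1) _

theorem measurable_output (hf : Measurable fun p : Vec d × Z => f p.1 p.2) :
    Measurable (fun q : (Fin M → Z) × Tape d c.K => output c f x₁ q.1 q.2) := by
  -- The epoch that is output is random; since the index set is finite, measurability for each fixed
  -- index suffices.
  have h : Measurable fun p : Fin c.K × ((Fin M → Z) × Tape d c.K) =>
      epochAverage c f x₁ p.2.1 p.2.2 (p.1 : ℕ) :=
    measurable_from_prod_countable_right fun k => measurable_epochAverage hf k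
  have hi : Measurable fun q : (Fin M → Z) × Tape d c.K => q.2.2.2.2 := by fun_prop
  have he : (fun q : (Fin M → Z) × Tape d c.K => output c f x₁ q.1 q.2) =
      (fun p : Fin c.K × ((Fin M → Z) × Tape d c.K) =>
        epochAverage c f x₁ p.2.1 p.2.2 (p.1 : ℕ)) ∘ fun q => (q.2.2.2.2, q) := by
    funext q
    simp only [output, Function.comp_apply]
  rw [he]
  refine h.comp ?_
  exact hi.prodMk measurable_id

theorem measurable_uncurry_of_differentiable (hm : ∀ x : Vec d, Measurable (f x))
    (hd : ∀ z : Z, Differentiable ℝ fun x => f x z) :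
    Measurable fun p : Vec d × Z => f p.1 p.2 :=
  measurable_uncurry_of_continuous_of_measurable (u := f) (fun z => (hd z).continuous) hm

end Run

/-! ### Shifting the noise of the tree mechanism -/

section Tape

variable {d : ℕ} [NeZero d] {c : Params}

/-- Replace the tree sample at `p` by `x`. -/
def updateNoise {K : ℕ} (p : ℕ × ℕ) (ω : Tape d K) (x : Vec d) : Tape d K :=
  (ω.1, Function.update ω.2.1 p x, ω.2.2)

/-- Replace the draw `s` at `p` by `x`. -/
def updateInterp {K : ℕ} (p : ℕ × ℕ) (ω : Tape d K) (x : ℝ) : Tape d K :=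
  (Function.update ω.1 p x, ω.2)

/-- Replace the direction at `p` by `x`. -/
def updateDir {K : ℕ} (p : ℕ × Fin d) (ω : Tape d K) (x : Vec d) : Tape d K :=
  (ω.1, ω.2.1, Function.update ω.2.2.1 p x, ω.2.2.2)

/-- Add `h` to the tree samples at the elements of `J`. -/
def shiftNoise {K : ℕ} (J : Finset (ℕ × ℕ)) (h : Vec d) (ω : Tape d K) : Tape d K :=
  (ω.1, fun p => if p ∈ J then ω.2.1 p + h else ω.2.1 p, ω.2.2)

instance [NeZero c.K] : IsProbabilityMeasure (uniformOn (Set.univ : Set (Fin c.K))) :=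
  isProbabilityMeasure_uniformOn Set.finite_univ Set.univ_nonempty

instance [NeZero c.K] : IsProbabilityMeasure (tapeLaw d c) := by
  unfold tapeLaw; infer_instance

variable [NeZero c.K]

theorem resample_updateNoise (p : ℕ × ℕ) :
    Resample (tapeLaw d c) (updateNoise p) (isoGaussian d (c.σ p.2)) :=
  Resample.snd (Resample.fst
    (resample_update_infinitePi (fun p : ℕ × ℕ => isoGaussian d (c.σ p.2)) p))

theorem resample_updateInterp (p : ℕ × ℕ) :
    Resample (tapeLaw d c) (updateInterp p) unitUniform :=
  Resample.fst (resample_update_infinitePi (fun _ : ℕ × ℕ => unitUniform) p)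

theorem resample_updateDir (p : ℕ × Fin d) :
    Resample (tapeLaw d c) (updateDir p) (sphereUniform d) :=
  Resample.snd (Resample.snd (Resample.fst
    (resample_update_infinitePi (fun _ : ℕ × Fin d => sphereUniform d) p)))

theorem resample_index :
    Resample (tapeLaw d c) (fun ω k => (ω.1, ω.2.1, ω.2.2.1, k))
      (uniformOn (Set.univ : Set (Fin c.K))) :=
  Resample.snd (Resample.snd (Resample.snd
    (resample_const (uniformOn (Set.univ : Set (Fin c.K))) (uniformOn Set.univ))))

theorem measurable_shiftNoise {K : ℕ} (J : Finset (ℕ × ℕ)) {q : Tape d K → Vec d}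
    (hq : Measurable q) : Measurable fun ω : Tape d K => shiftNoise J (q ω) ω := by
  unfold shiftNoise
  have h : Measurable fun ω : Tape d K => fun p => if p ∈ J then ω.2.1 p + q ω else ω.2.1 p := by
    refine measurable_pi_lambda _ fun p => ?_
    split_ifs <;> fun_prop
  exact measurable_fst.prodMk (h.prodMk (measurable_snd.comp measurable_snd))

theorem shiftNoise_updateNoise {K : ℕ} {J : Finset (ℕ × ℕ)} {p : ℕ × ℕ} (hp : p ∉ J) (h x : Vec d)
    (ω : Tape d K) :
    shiftNoise J h (updateNoise p ω (x + h)) = shiftNoise (insert p J) h (updateNoise p ω x) := by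
  unfold shiftNoise updateNoise
  refine Prod.ext rfl (Prod.ext ?_ rfl)
  funext b
  by_cases hb : b = p
  · subst hb; simp [hp]
  · simp [hb]

theorem measurable_shiftDensity_comp {K : ℕ} (σ : ℝ) (p : ℕ × ℕ) {q : Tape d K → Vec d}
    (hq : Measurable q) : Measurable fun ω : Tape d K => shiftDensity σ (q ω) (ω.2.1 p) := by
  have hp : Measurable fun ω : Tape d K => ω.2.1 p := by fun_prop
  unfold shiftDensity
  fun_prop

/-- An adaptive Cameron–Martin formula. The shift is random but insensitive to the samples in `J`,
so when one of these is redrawn with everything else fixed it acts as a constant, and the nodes can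
be treated one after another. -/
theorem lintegral_tapeLaw_shift {σ : ℝ} (hσ : 0 < σ) (hc : ∀ t, c.σ t = σ) {q : Tape d c.K → Vec d}
    (hq : Measurable q) (J : Finset (ℕ × ℕ))
    (hqJ : ∀ p ∈ J, ∀ ω x, q (updateNoise p ω x) = q ω)
    {φ : Tape d c.K → ENNReal} (hφ : Measurable φ) :
    ∫⁻ ω, φ ω ∂(tapeLaw d c) =
      ∫⁻ ω, φ (shiftNoise J (q ω) ω) * ∏ p ∈ J, ENNReal.ofReal (shiftDensity σ (q ω) (ω.2.1 p))
        ∂(tapeLaw d c) := by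
  induction J using Finset.induction_on with
  | empty => simp [shiftNoise]
  | insert p J hp ih =>
    have hmeas : ∀ J : Finset (ℕ × ℕ), Measurable fun ω : Tape d c.K =>
        φ (shiftNoise J (q ω) ω) *
          ∏ p ∈ J, ENNReal.ofReal (shiftDensity σ (q ω) (ω.2.1 p)) := fun J =>
      (hφ.comp (measurable_shiftNoise J hq)).mul (Finset.measurable_prod _ fun p _ =>
        (measurable_shiftDensity_comp σ p hq).ennreal_ofReal)
    rw [ih fun p' hp' => hqJ p' (Finset.mem_insert_of_mem hp'),
      (resample_updateNoise p).lintegral (hmeas J),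
      (resample_updateNoise p).lintegral (hmeas (insert p J)), hc]
    refine lintegral_congr fun ω => ?_
    have hup : Measurable fun x => updateNoise p ω x :=
      measurable_const.prodMk ((measurable_update ω.2.1).prodMk measurable_const)
    refine (lintegral_isoGaussian_shift hσ (q ω) ((hmeas J).comp hup)).trans ?_
    refine lintegral_congr fun x => ?_
    have h1 : ∀ y, q (updateNoise p ω y) = q ω := hqJ p (Finset.mem_insert_self _ _) ω
    have h2 : ∀ y, ∀ b ∈ J, (updateNoise p ω y).2.1 b = ω.2.1 b := fun y b hb => by
      have : b ≠ p := fun h => hp (h ▸ hb)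
      simp [updateNoise, this]
    have hprod : ∀ y, ∏ b ∈ J, ENNReal.ofReal (shiftDensity σ (q ω) ((updateNoise p ω y).2.1 b)) =
        ∏ b ∈ J, ENNReal.ofReal (shiftDensity σ (q ω) (ω.2.1 b)) := fun y =>
      Finset.prod_congr rfl fun b hb => by rw [h2 _ b hb]
    simp only [Function.comp_apply]
    rw [h1, h1, shiftNoise_updateNoise hp, Finset.prod_insert hp,
      hprod, hprod]
    simp only [updateNoise, Function.update_self]
    ring

/-- Integrating out one shifted sample leaves a factor that depends only on `q`. The weight `G` is
there to carry these factors through the induction. -/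
theorem lintegral_prod_shiftDensity_rpow {σ : ℝ} (hσ : 0 < σ) (hc : ∀ t, c.σ t = σ) (α : ℝ)
    {q : Tape d c.K → Vec d} (hq : Measurable q) (J : Finset (ℕ × ℕ))
    (hqJ : ∀ p ∈ J, ∀ ω x, q (updateNoise p ω x) = q ω) {G : Tape d c.K → ENNReal}
    (hG : Measurable G) (hGJ : ∀ p ∈ J, ∀ ω x, G (updateNoise p ω x) = G ω) :
    ∫⁻ ω, (∏ p ∈ J, ENNReal.ofReal (shiftDensity σ (q ω) (ω.2.1 p) ^ α)) * G ω ∂(tapeLaw d c) =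
      ∫⁻ ω, ENNReal.ofReal (Real.exp (α * (α - 1) * ‖q ω‖ ^ 2 / (2 * σ ^ 2))) ^ J.card * G ω
        ∂(tapeLaw d c) := by
  induction J using Finset.induction_on generalizing G with
  | empty => simp
  | insert p J hp ih =>
    have hD : ∀ b, Measurable fun ω : Tape d c.K =>
        ENNReal.ofReal (shiftDensity σ (q ω) (ω.2.1 b) ^ α) := fun b =>
      ((measurable_shiftDensity_comp σ b hq).pow_const α).ennreal_ofReal
    have hP : Measurable fun ω : Tape d c.K =>
        ∏ b ∈ J, ENNReal.ofReal (shiftDensity σ (q ω) (ω.2.1 b) ^ α) :=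
      Finset.measurable_prod _ fun b _ => hD b
    have hE : Measurable fun ω : Tape d c.K =>
        ENNReal.ofReal (Real.exp (α * (α - 1) * ‖q ω‖ ^ 2 / (2 * σ ^ 2))) := by
      fun_prop
    have hJ : ∀ b ∈ J, ∀ ω x, q (updateNoise b ω x) = q ω := fun b hb =>
      hqJ b (Finset.mem_insert_of_mem hb)
    have h1 : ∀ ω y, q (updateNoise p ω y) = q ω := hqJ p (Finset.mem_insert_self _ _)
    have h2 : ∀ (ω : Tape d c.K) (y : Vec d), ∀ b ∈ J, (updateNoise p ω y).2.1 b = ω.2.1 b := fun ω y b hb => by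
      have : b ≠ p := fun h => hp (h ▸ hb)
      simp [updateNoise, this]
    have hstep : ∫⁻ ω, (∏ b ∈ insert p J, ENNReal.ofReal (shiftDensity σ (q ω) (ω.2.1 b) ^ α)) * G ω
        ∂(tapeLaw d c) =
        ∫⁻ ω, (∏ b ∈ J, ENNReal.ofReal (shiftDensity σ (q ω) (ω.2.1 b) ^ α)) *
          (ENNReal.ofReal (Real.exp (α * (α - 1) * ‖q ω‖ ^ 2 / (2 * σ ^ 2))) * G ω)
          ∂(tapeLaw d c) := by
      have hM : Measurable fun ω : Tape d c.K =>
          (∏ b ∈ insert p J, ENNReal.ofReal (shiftDensity σ (q ω) (ω.2.1 b) ^ α)) * G ω :=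
        (Finset.measurable_prod _ fun b _ => hD b).mul hG
      rw [(resample_updateNoise p).lintegral hM, hc]
      refine lintegral_congr fun ω => ?_
      rw [← lintegral_shiftDensity_rpow hσ, mul_left_comm, mul_comm,
        ← lintegral_const_mul]
      · refine lintegral_congr fun x => ?_
        rw [Finset.prod_insert hp, h1, hGJ p (Finset.mem_insert_self _ _),
          Finset.prod_congr (s₁ := J) rfl fun b hb => by rw [h2 ω x b hb]]
        simp only [updateNoise, Function.update_self]
        ring
      · unfold shiftDensity; fun_prop
    have hEG : Measurable fun ω : Tape d c.K =>
        ENNReal.ofReal (Real.exp (α * (α - 1) * ‖q ω‖ ^ 2 / (2 * σ ^ 2))) * G ω := hE.mul hG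
    rw [hstep, ih hJ hEG, Finset.card_insert_of_notMem hp]
    · refine lintegral_congr fun ω => ?_
      ring
    · intro b hb ω x
      simp only [hJ b hb, hGJ b (Finset.mem_insert_of_mem hb)]

/-! ### Almost sure properties of the draws -/

theorem sphereUniform_norm_eq : ∀ᵐ u ∂(sphereUniform d), ‖u‖ = 1 := by
  unfold sphereUniform
  rw [ae_map_iff measurable_subtype_coe.aemeasurable (measurableSet_eq_fun measurable_norm
    measurable_const)]
  exact Filter.Eventually.of_forall fun u => by simp

theorem tapeLaw_ae_interp : ∀ᵐ ω ∂(tapeLaw d c), ∀ p, ω.1 p ∈ Set.Icc (0 : ℝ) 1 := by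
  rw [ae_all_iff]
  intro p
  have h : MeasurePreserving (fun ω : Tape d c.K => ω.1 p) (tapeLaw d c) unitUniform :=
    (measurePreserving_eval_infinitePi (fun _ : ℕ × ℕ => unitUniform) p).comp
      measurePreserving_fst
  have h2 : ∀ᵐ x ∂unitUniform, x ∈ Set.Icc (0 : ℝ) 1 := ae_restrict_mem measurableSet_Icc
  exact h.quasiMeasurePreserving.ae h2

theorem tapeLaw_ae_dir : ∀ᵐ ω ∂(tapeLaw d c), ∀ p, ‖ω.2.2.1 p‖ = 1 := by
  rw [ae_all_iff]
  intro p
  have h : MeasurePreserving (fun ω : Tape d c.K => ω.2.2.1 p) (tapeLaw d c) (sphereUniform d) :=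
    (measurePreserving_eval_infinitePi (fun _ : ℕ × Fin d => sphereUniform d) p).comp
      (measurePreserving_fst.comp (measurePreserving_snd.comp measurePreserving_snd))
  exact h.quasiMeasurePreserving.ae sphereUniform_norm_eq

end Tape

/-! ### Sensitivity of the estimators -/

section Sensitivity

variable {d : ℕ} {c : Params}

theorem norm_smul_sum_smul_le {a : Fin d → ℝ} {e : Fin d → Vec d} {B : ℝ} (hB : 0 ≤ B)
    (ha : ∀ j, |a j| ≤ B) (he : ∀ j, ‖e j‖ = 1) : ‖(d : ℝ)⁻¹ • ∑ j, a j • e j‖ ≤ B := by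
  rcases Nat.eq_zero_or_pos d with rfl | hd
  · simpa using hB
  have hd' : (0 : ℝ) < d := by exact_mod_cast hd
  rw [norm_smul, Real.norm_of_nonneg (by positivity), inv_mul_le_iff₀ hd']
  refine (norm_sum_le _ _).trans ((Finset.sum_le_sum (g := fun _ => B) fun j _ => ?_).trans_eq ?_)
  · rw [norm_smul, he, mul_one]; exact ha j
  · simp

theorem abs_gradTerm_le {δ L : ℝ} (hδ : 0 < δ) {v : Vec d → ℝ}
    (hv : ∀ x y, |v x - v y| ≤ L * ‖x - y‖) {e : Vec d} (he : ‖e‖ = 1) (x : Vec d) :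
    |(d : ℝ) / (2 * δ) * (v (x + δ • e) - v (x - δ • e))| ≤ d * L := by
  have h1 := hv (x + δ • e) (x - δ • e)
  have h2 : x + δ • e - (x - δ • e) = (2 * δ) • e := by
    rw [mul_smul, two_smul]; abel
  rw [h2, norm_smul, he, mul_one, Real.norm_of_nonneg (by positivity)] at h1
  rw [abs_mul, abs_of_nonneg (by positivity)]
  calc (d : ℝ) / (2 * δ) * |v (x + δ • e) - v (x - δ • e)|
      ≤ (d : ℝ) / (2 * δ) * (L * (2 * δ)) := by gcongr
    _ = d * L := by field_simp

theorem abs_diffTerm_le {δ L : ℝ} (hδ : 0 < δ) {v : Vec d → ℝ}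
    (hv : ∀ x y, |v x - v y| ≤ L * ‖x - y‖) (e x y : Vec d) :
    |(d : ℝ) / δ * (v (x + δ • e) - v (y + δ • e))| ≤ d / δ * (L * ‖x - y‖) := by
  have h1 := hv (x + δ • e) (y + δ • e)
  rw [add_sub_add_right_eq_sub] at h1
  rw [abs_mul, abs_of_nonneg (by positivity)]
  exact mul_le_mul_of_nonneg_left h1 (by positivity)

theorem norm_gradEst_sub_le {δ L : ℝ} (hδ : 0 < δ) (hL : 0 ≤ L) {b i₀ : ℕ} {v v' : ℕ → Vec d → ℝ}
    {u : ℕ → Fin d → Vec d} (hv : ∀ i x y, |v i x - v i y| ≤ L * ‖x - y‖)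
    (hv' : ∀ i x y, |v' i x - v' i y| ≤ L * ‖x - y‖) (hu : ∀ i j, ‖u i j‖ = 1)
    (hne : ∀ i, i ≠ i₀ → v i = v' i) (x : Vec d) :
    ‖gradEst δ b v u x - gradEst δ b v' u x‖ ≤ 2 * d * L / b := by
  have key : ∀ (v : ℕ → Vec d → ℝ), (∀ i x y, |v i x - v i y| ≤ L * ‖x - y‖) → ∀ i,
      ‖(d : ℝ)⁻¹ • ∑ j, ((d : ℝ) / (2 * δ) * (v i (x + δ • u i j) - v i (x - δ • u i j))) • u i j‖
        ≤ d * L := fun v hv i =>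
    norm_smul_sum_smul_le (by positivity) (fun j => abs_gradTerm_le hδ (hv i) (hu i j) x) (hu i)
  unfold gradEst
  rw [← smul_sub, ← Finset.sum_sub_distrib, norm_smul, norm_inv, Real.norm_natCast,
    div_eq_inv_mul (2 * d * L)]
  gcongr
  by_cases hi : i₀ ∈ Finset.range b
  · rw [Finset.sum_eq_single_of_mem i₀ hi fun i _ hii => by rw [hne i hii, sub_self]]
    refine (norm_sub_le _ _).trans ?_
    linarith [key v hv i₀, key v' hv' i₀]
  · rw [Finset.sum_eq_zero, norm_zero]
    · positivity
    · intro i hib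
      rw [hne i fun h => hi (h ▸ hib), sub_self]

theorem norm_diffEst_one_le {δ L : ℝ} (hδ : 0 < δ) (hL : 0 ≤ L) {v : ℕ → Vec d → ℝ}
    {u : ℕ → Fin d → Vec d} (hv : ∀ i x y, |v i x - v i y| ≤ L * ‖x - y‖)
    (hu : ∀ i j, ‖u i j‖ = 1) (x y : Vec d) :
    ‖diffEst δ 1 v u x y‖ ≤ d / δ * (L * ‖x - y‖) := by
  unfold diffEst
  simp only [Nat.cast_one, inv_one, one_smul, Finset.range_one, Finset.sum_singleton]
  exact norm_smul_sum_smul_le (by positivity) (fun j => abs_diffTerm_le hδ (hv 0) _ x y) (hu 0)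

/-! ### Coupling of the runs on neighboring datasets -/

/-- If the losses change only in the batch of round `m + 1`, the change of the estimates is undone
by a shift of the noise in the nodes that contain this round. -/
theorem roundState_coupled {v v' : ℕ → Vec d → ℝ} {u : ℕ → Fin d → Vec d} {s : ℕ → ℝ}
    {ξ ξ' : ℕ → Vec d} {x q : Vec d} (m : ℕ)
    (hv : ∀ i, i < c.dataBefore m ∨ c.dataBefore (m + 1) ≤ i → v' i = v i)
    (hq : q = gradIncrement c v u m (roundState c v u s ξ x m).w (roundState c v u s ξ x (m - 1)).w
      - gradIncrement c v' u m (roundState c v u s ξ x m).w (roundState c v u s ξ x (m - 1)).w)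
    (hξ : ∀ b, ξ' b = ξ b + if b ∈ nodeEndsThrough m c.T then q else 0) (n : ℕ) (hn : n < c.T) :
    (roundState c v' u s ξ' x n).x = (roundState c v u s ξ x n).x ∧
    (roundState c v' u s ξ' x n).Δ = (roundState c v u s ξ x n).Δ ∧
    (roundState c v' u s ξ' x n).w = (roundState c v u s ξ x n).w ∧
    (roundState c v' u s ξ' x n).g = (roundState c v u s ξ x n).g - (if m ≤ n then q else 0) ∧
    (roundState c v' u s ξ' x n).gPriv = (roundState c v u s ξ x n).gPriv := by
  -- Every partial sum from round `m + 1` on contains exactly one shifted node, so its noise moves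
  -- by exactly `q`.
  have htree : ∀ n < c.T,
      treeNoise ξ' (n + 1) = treeNoise ξ (n + 1) + if m ≤ n then q else 0 := by
    intro n hn
    rw [treeNoise_eq, treeNoise_eq]
    simp_rw [hξ]
    rw [Finset.sum_add_distrib, sum_nodeEnds_ite (by omega)]
    simp only [Nat.lt_succ_iff]
  have hmono : Monotone c.dataBefore := by
    refine monotone_nat_of_le_succ fun n => ?_
    cases n with
    | zero => exact Nat.zero_le _
    | succ n => simp only [Params.dataBefore]; gcongr; omega
  have hinc : ∀ n w w', n ≠ m → gradIncrement c v' u n w w' = gradIncrement c v u n w w' := by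
    intro n w w' hnm
    refine gradIncrement_congr n w w' (fun i h1 h2 => hv i ?_) fun _ _ _ => rfl
    rcases lt_or_gt_of_ne hnm with h | h
    · exact Or.inl (h2.trans_le (hmono h))
    · exact Or.inr ((hmono h).trans h1)
  induction n with
  | zero =>
    have hg : (roundState c v' u s ξ' x 0).g =
        (roundState c v u s ξ x 0).g - (if m ≤ 0 then q else 0) := by
      rcases Nat.eq_zero_or_pos m with rfl | hm
      · rw [if_pos le_rfl, hq]
        simp only [roundState, gradIncrement]
        abel
      · rw [if_neg (by omega), sub_zero]
        exact hinc 0 (x + s 1 • (0 : Vec d)) 0 (by omega)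
    refine ⟨rfl, rfl, rfl, hg, ?_⟩
    rw [roundState_gPriv, roundState_gPriv, hg, htree 0 hn]
    abel
  | succ n ih =>
    obtain ⟨h1, h2, h3, h4, h5⟩ := ih (by omega)
    have hx : (roundState c v' u s ξ' x (n + 1)).x = (roundState c v u s ξ x (n + 1)).x := by
      simp only [roundState, h1, h2]
    have hΔ : (roundState c v' u s ξ' x (n + 1)).Δ = (roundState c v u s ξ x (n + 1)).Δ := by
      simp only [roundState, h2, h5]
    have hw : (roundState c v' u s ξ' x (n + 1)).w = (roundState c v u s ξ x (n + 1)).w := by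
      rw [roundState_w, roundState_w, hx, hΔ]
    have hstep : ∀ (v : ℕ → Vec d → ℝ) (ξ : ℕ → Vec d), (roundState c v u s ξ x (n + 1)).g =
        (roundState c v u s ξ x n).g + gradIncrement c v u (n + 1) (roundState c v u s ξ x (n + 1)).w
          (roundState c v u s ξ x n).w := fun v ξ => rfl
    have hg : (roundState c v' u s ξ' x (n + 1)).g =
        (roundState c v u s ξ x (n + 1)).g - (if m ≤ n + 1 then q else 0) := by
      rw [hstep, hstep, hw, h3, h4]
      rcases eq_or_ne (n + 1) m with hm | hm
      · subst hm
        rw [if_neg (by omega), if_pos le_rfl, hq]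
        simp only [Nat.add_sub_cancel]
        abel
      · rw [hinc _ _ _ hm]
        have : m ≤ n ↔ m ≤ n + 1 := by omega
        simp only [this]
        abel
    refine ⟨hx, hΔ, hw, hg, ?_⟩
    rw [roundState_gPriv, roundState_gPriv, hg, htree (n + 1) hn]
    abel

end Sensitivity

/-! ### The privacy guarantee for the whole run. -/

section Privacy

variable {d M : ℕ} {Z : Type*} {c : Params} {f : Vec d → Z → ℝ} {x₁ : Vec d}

/-- The change of the estimate of round `m + 1` of epoch `k` when `S'` is replaced by `S`, along
the run on `S'`. -/
def incrementChange (c : Params) (f : Vec d → Z → ℝ) (x₁ : Vec d) (S S' : Fin M → Z) (k m : ℕ)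
    (ω : Tape d c.K) : Vec d :=
  let w := fun n => (epochState c f S' ω k (epochStart c f x₁ S' ω k) n).w
  let u := fun i j => ω.2.2.1 (k * c.epochSize + i, j)
  gradIncrement c (fun i => dataLoss f S' (k * c.epochSize + i)) u m (w m) (w (m - 1)) -
    gradIncrement c (fun i => dataLoss f S (k * c.epochSize + i)) u m (w m) (w (m - 1))

/-- The tree samples that are shifted. -/
def shiftedNodes (c : Params) (k m : ℕ) : Finset (ℕ × ℕ) :=
  (nodeEndsThrough m c.T).image fun b => (k, b)

theorem mem_shiftedNodes {k m : ℕ} {p : ℕ × ℕ} :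
    p ∈ shiftedNodes c k m ↔ p.1 = k ∧ p.2 ∈ nodeEndsThrough m c.T := by
  unfold shiftedNodes
  rw [Finset.mem_image]
  constructor
  · rintro ⟨b, hb, rfl⟩; exact ⟨rfl, hb⟩
  · rintro ⟨h1, h2⟩; exact ⟨p.2, h2, by rw [← h1]⟩

/-- Epoch `k` is covered by `roundState_coupled`, and the other epochs see unchanged data and noise.
What passes between epochs is the starting point, whose equality is carried along by induction. -/
theorem output_coupled {S S' : Fin M → Z} {ω : Tape d c.K} {k m : ℕ} (hm : m < c.T)
    (hS : ∀ n, n < k * c.epochSize + c.dataBefore m ∨ k * c.epochSize + c.dataBefore (m + 1) ≤ n →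
      dataLoss f S n = dataLoss f S' n) :
    output c f x₁ S (shiftNoise (shiftedNodes c k m) (incrementChange c f x₁ S S' k m ω) ω) =
      output c f x₁ S' ω := by
  set q := incrementChange c f x₁ S S' k m ω with hq
  set ω' := shiftNoise (shiftedNodes c k m) q ω with hω'
  have hξ : ∀ k' b, ω'.2.1 (k', b) =
      if k' = k ∧ b ∈ nodeEndsThrough m c.T then ω.2.1 (k', b) + q else ω.2.1 (k', b) := by
    intro k' b
    simp only [hω', shiftNoise, mem_shiftedNodes]
  have hle : c.dataBefore (m + 1) ≤ c.epochSize := Params.dataBefore_le_epochSize hm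
  have hother : ∀ k', k' ≠ k → ∀ i < c.epochSize,
      dataLoss f S (k' * c.epochSize + i) = dataLoss f S' (k' * c.epochSize + i) := by
    intro k' hk' i hi
    refine hS _ ?_
    rcases lt_or_gt_of_ne hk' with h | h
    · left
      have : (k' + 1) * c.epochSize ≤ k * c.epochSize := Nat.mul_le_mul_right _ h
      rw [Nat.add_mul, one_mul] at this
      omega
    · right
      have : (k + 1) * c.epochSize ≤ k' * c.epochSize := Nat.mul_le_mul_right _ h
      rw [Nat.add_mul, one_mul] at this
      omega
  have hstate : ∀ k' n, n < c.T → epochStart c f x₁ S ω' k' = epochStart c f x₁ S' ω k' →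
      (epochState c f S ω' k' (epochStart c f x₁ S ω' k') n).x =
        (epochState c f S' ω k' (epochStart c f x₁ S' ω k') n).x ∧
      (epochState c f S ω' k' (epochStart c f x₁ S ω' k') n).Δ =
        (epochState c f S' ω k' (epochStart c f x₁ S' ω k') n).Δ ∧
      (epochState c f S ω' k' (epochStart c f x₁ S ω' k') n).w =
        (epochState c f S' ω k' (epochStart c f x₁ S' ω k') n).w := by
    intro k' n hn hstart
    rw [hstart]
    by_cases hk : k' = k
    · subst hk
      have h := roundState_coupled (c := c)
        (v := fun i => dataLoss f S' (k' * c.epochSize + i))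
        (v' := fun i => dataLoss f S (k' * c.epochSize + i))
        (u := fun i j => ω.2.2.1 (k' * c.epochSize + i, j)) (s := fun t => ω.1 (k', t))
        (ξ := fun t => ω.2.1 (k', t)) (ξ' := fun t => ω'.2.1 (k', t))
        (x := epochStart c f x₁ S' ω k') m (q := q)
        (fun i hi => hS _ (by omega)) hq
        (fun b => by
          rw [hξ]
          by_cases hb : b ∈ nodeEndsThrough m c.T <;> simp [hb]) n hn
      exact ⟨h.1, h.2.1, h.2.2.1⟩
    · have h : epochState c f S ω' k' (epochStart c f x₁ S' ω k') n =
          epochState c f S' ω k' (epochStart c f x₁ S' ω k') n := by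
        refine roundState_congr _ n (fun i hi => hother k' hk i ?_) (fun _ _ => rfl)
          (fun _ _ => rfl) fun b _ => ?_
        · exact hi.trans_le (Params.dataBefore_le_epochSize hn)
        · rw [hξ, if_neg fun h => hk h.1]
      rw [h]
      exact ⟨rfl, rfl, rfl⟩
  have hstart : ∀ k', epochStart c f x₁ S ω' k' = epochStart c f x₁ S' ω k' := by
    intro k'
    induction k' with
    | zero => rfl
    | succ k' ih =>
      obtain ⟨h1, h2, -⟩ := hstate k' (c.T - 1) (by omega) ih
      simp only [epochStart, h1, h2]
  unfold output epochAverage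
  have hidx : ω'.2.2 = ω.2.2 := rfl
  rw [hidx]
  congr 1
  exact Finset.sum_congr rfl fun n hn => (hstate _ n (Finset.mem_range.1 hn) (hstart _)).2.2

/-- Nodes through round `m + 1` end at some `b > m`, whereas the query points of rounds up to `m +
1` only involve samples with `b ≤ m` of this epoch and those of earlier epochs. -/
theorem incrementChange_updateNoise {S S' : Fin M → Z} {k m : ℕ} {p : ℕ × ℕ}
    (hp : p ∈ shiftedNodes c k m) (ω : Tape d c.K) (x : Vec d) :
    incrementChange c f x₁ S S' k m (updateNoise p ω x) = incrementChange c f x₁ S S' k m ω := by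
  rw [mem_shiftedNodes] at hp
  have hlt := lt_of_mem_nodeEndsThrough hp.2
  have hξ : ∀ k' b, (k' ≠ k ∨ b ≤ m) → (updateNoise p ω x).2.1 (k', b) = ω.2.1 (k', b) := by
    intro k' b h
    have : (k', b) ≠ p := by
      rintro rfl
      have h1 := hp.1
      simp only at h1 hlt
      omega
    simp [updateNoise, this]
  have hstart : epochStart c f x₁ S' (updateNoise p ω x) k = epochStart c f x₁ S' ω k :=
    epochStart_congr k (fun _ _ => rfl) (fun _ _ _ => rfl) (fun _ _ _ => rfl)
      fun k' hk' t => hξ k' t (Or.inl hk'.ne)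
  have hw : ∀ n ≤ m,
      (epochState c f S' (updateNoise p ω x) k (epochStart c f x₁ S' ω k) n).w =
        (epochState c f S' ω k (epochStart c f x₁ S' ω k) n).w := fun n hn =>
    roundState_w_congr _ n (fun _ _ => rfl) (fun _ _ => rfl) (fun _ _ => rfl)
      fun b hb => hξ k b (Or.inr (hb.trans hn))
  simp only [incrementChange, hstart, hw m le_rfl, hw (m - 1) (Nat.sub_le _ _)]
  rfl

/-- In the first round one of `T + 1` summands of norm at most `dL` changes. In a later round the
batch is a single point and the query points are within `2D = 2δ/T` of each other, so each of the
two difference estimates has norm at most `2dL/T`. -/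
theorem norm_incrementChange_le {L : ℝ} (hL : 0 ≤ L) (hδ : 0 < c.δ) (hB₁ : c.B₁ = c.T + 1)
    (hB₂ : c.B₂ = 1) (hD : c.D = c.δ / c.T)
    (hT : 0 < c.T) (hf : ∀ (z : Z) (x y : Vec d), |f x z - f y z| ≤ L * ‖x - y‖)
    {S S' : Fin M → Z} {k m i₀ : ℕ}
    (hS : ∀ n, n ≠ k * c.epochSize + i₀ → dataLoss f S n = dataLoss f S' n)
    {ω : Tape d c.K} (hs : ∀ p, ω.1 p ∈ Set.Icc (0 : ℝ) 1) (hu : ∀ p, ‖ω.2.2.1 p‖ = 1) :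
    ‖incrementChange c f x₁ S S' k m ω‖ ≤ 4 * d * L / c.T := by
  have hT' : (0 : ℝ) < c.T := by exact_mod_cast hT
  have hD0 : 0 ≤ c.D := by rw [hD]; positivity
  unfold incrementChange
  cases m with
  | zero =>
    simp only [gradIncrement]
    refine (norm_gradEst_sub_le hδ hL (i₀ := i₀) (fun _ => dataLoss_lipschitz hL hf _ _)
      (fun _ => dataLoss_lipschitz hL hf _ _) (fun _ _ => hu _) (fun i hi => ?_) _).trans ?_
    · exact (hS _ (by omega)).symm
    · rw [hB₁]
      push_cast
      gcongr
      · norm_num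
      · linarith
  | succ m =>
    simp only [gradIncrement, hB₂, Nat.add_sub_cancel]
    have hw : ‖(epochState c f S' ω k (epochStart c f x₁ S' ω k) (m + 1)).w -
        (epochState c f S' ω k (epochStart c f x₁ S' ω k) m).w‖ ≤ 2 * c.D :=
      norm_roundState_w_sub_le hD0 _ _ (fun _ => hs _) _ _ m
    have key : ∀ S : Fin M → Z, ‖diffEst c.δ 1
        (fun i => dataLoss f S (k * c.epochSize + (c.B₁ + 1 * m + i)))
        (fun i j => ω.2.2.1 (k * c.epochSize + (c.B₁ + 1 * m + i), j))
        (epochState c f S' ω k (epochStart c f x₁ S' ω k) (m + 1)).w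
        (epochState c f S' ω k (epochStart c f x₁ S' ω k) m).w‖ ≤ 2 * d * L / c.T := by
      intro S
      refine (norm_diffEst_one_le hδ hL (fun _ => dataLoss_lipschitz hL hf _ _)
        (fun _ _ => hu _) _ _).trans ?_
      calc (d : ℝ) / c.δ * (L * _) ≤ d / c.δ * (L * (2 * c.D)) := by gcongr
        _ = 2 * d * L / c.T := by rw [hD]; field_simp
    refine (norm_sub_le _ _).trans ((add_le_add (key S') (key S)).trans_eq ?_)
    ring

theorem Neighboring.dataLoss_eq {S S' : Fin M → Z} (h : Neighboring S S') :
    ∃ n₀, ∀ n, n ≠ n₀ → dataLoss f S n = dataLoss f S' n := by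
  obtain ⟨q, hq⟩ := h
  refine ⟨q, fun n hn => ?_⟩
  unfold dataLoss
  funext x
  split_ifs with hnM
  · rw [hq ⟨n, hnM⟩ fun h => hn (by rw [← h])]
  · rfl

theorem Params.exists_round (hT : 0 < c.T) (hB₂ : c.B₂ = 1) {i : ℕ} (hi : i < c.epochSize) :
    ∃ m < c.T, c.dataBefore m ≤ i ∧ i < c.dataBefore (m + 1) := by
  rw [Params.epochSize, hB₂, one_mul] at hi
  by_cases h : i < c.B₁
  · exact ⟨0, hT, Nat.zero_le _, by simpa [Params.dataBefore] using h⟩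
  · refine ⟨i - c.B₁ + 1, by omega, ?_, ?_⟩ <;> simp only [Params.dataBefore, hB₂] <;> omega

variable [MeasurableSpace Z]

theorem measurable_incrementChange (hf : Measurable fun p : Vec d × Z => f p.1 p.2)
    (S S' : Fin M → Z) (k m : ℕ) : Measurable (incrementChange c f x₁ S S' k m) := by
  have hS' : Measurable fun ω : Tape d c.K => (S', ω) := measurable_prodMk_left
  have hw : ∀ n, Measurable fun ω : Tape d c.K =>
      (epochState c f S' ω k (epochStart c f x₁ S' ω k) n).w := fun n => by
    have h := (measurable_epochState (M := M) (c := c) hf k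
      (measurable_epochStart (x₁ := x₁) hf k) n).2.2.1
    exact h.comp hS'
  have hv : ∀ (S : Fin M → Z) n, Measurable fun p : Tape d c.K × Vec d => dataLoss f S n p.2 :=
    fun S n => (measurable_dataLoss hf n).comp (measurable_const.prodMk measurable_snd)
  have hu : ∀ i j, Measurable fun ω : Tape d c.K => ω.2.2.1 (k * c.epochSize + i, j) :=
    fun i j => by fun_prop
  have hi : ∀ S : Fin M → Z, Measurable fun ω : Tape d c.K =>
      gradIncrement c (fun i => dataLoss f S (k * c.epochSize + i))
        (fun i j => ω.2.2.1 (k * c.epochSize + i, j)) m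
        (epochState c f S' ω k (epochStart c f x₁ S' ω k) m).w
        (epochState c f S' ω k (epochStart c f x₁ S' ω k) (m - 1)).w := fun S => by
    have hvS : ∀ i, Measurable fun p : Tape d c.K × Vec d =>
        dataLoss f S (k * c.epochSize + i) p.2 := fun i => hv S _
    exact measurable_gradIncrement hvS hu m (hw m) (hw (m - 1))
  unfold incrementChange
  exact (hi S').sub (hi S)

theorem measurable_output_right (hm : Measurable fun p : Vec d × Z => f p.1 p.2)
    (S : Fin M → Z) : Measurable fun ω : Tape d c.K => output c f x₁ S ω := by
  have h := measurable_output (M := M) (c := c) (x₁ := x₁) hm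
  have hS : Measurable fun ω : Tape d c.K => (S, ω) := measurable_prodMk_left
  have h2 := h.comp hS
  simp only [Function.comp_def] at h2
  exact h2

variable [NeZero d] [NeZero c.K]

/-- After the noise shift the run on `S` returns the output of the run on `S'`, and only the
Gaussian weights remain. This is the form that `renyiDiv_le_of_density` asks for. -/
theorem lintegral_outputLaw {σ : ℝ} (hσ : 0 < σ) (hcσ : ∀ t, c.σ t = σ)
    (hm : Measurable fun p : Vec d × Z => f p.1 p.2) {S S' : Fin M → Z} {k m : ℕ} (hmT : m < c.T)
    (hS : ∀ n, n < k * c.epochSize + c.dataBefore m ∨ k * c.epochSize + c.dataBefore (m + 1) ≤ n →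
      dataLoss f S n = dataLoss f S' n) {φ : Vec d → ENNReal} (hφ : Measurable φ) :
    ∫⁻ x, φ x ∂(outputLaw c f x₁ S) = ∫⁻ ω, φ (output c f x₁ S' ω) *
      ∏ b ∈ shiftedNodes c k m,
        ENNReal.ofReal (shiftDensity σ (incrementChange c f x₁ S S' k m ω) (ω.2.1 b))
      ∂(tapeLaw d c) := by
  have ho := measurable_output_right (c := c) (x₁ := x₁) hm S
  have hφo : Measurable fun ω : Tape d c.K => φ (output c f x₁ S ω) := hφ.comp ho
  rw [outputLaw, lintegral_map hφ ho,
    lintegral_tapeLaw_shift hσ hcσ (measurable_incrementChange hm S S' k m) (shiftedNodes c k m)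
      (fun b hb ω x => incrementChange_updateNoise hb ω x) hφo]
  refine lintegral_congr fun ω => ?_
  rw [output_coupled hmT hS]

theorem lintegral_density_rpow_le {L σ α : ℝ} (hL : 0 ≤ L) (hδ : 0 < c.δ)
    (hB₁ : c.B₁ = c.T + 1) (hB₂ : c.B₂ = 1) (hD : c.D = c.δ / c.T) (hT : 0 < c.T) (hσ : 0 < σ)
    (hcσ : ∀ t, c.σ t = σ) (hm : Measurable fun p : Vec d × Z => f p.1 p.2)
    (hf : ∀ (z : Z) (x y : Vec d), |f x z - f y z| ≤ L * ‖x - y‖) (hα : 1 < α)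
    {S S' : Fin M → Z} {k m i₀ : ℕ}
    (hS : ∀ n, n ≠ k * c.epochSize + i₀ → dataLoss f S n = dataLoss f S' n) :
    ∫⁻ ω, (∏ b ∈ shiftedNodes c k m, ENNReal.ofReal
        (shiftDensity σ (incrementChange c f x₁ S S' k m ω) (ω.2.1 b))) ^ α ∂(tapeLaw d c) ≤
      ENNReal.ofReal (Real.exp ((α - 1) * (α * ((Nat.log 2 c.T + 1 : ℕ) *
            (4 * d * L / c.T) ^ 2 / (2 * σ ^ 2))))) := by
  have h1 : ∀ ω : Tape d c.K, (∏ b ∈ shiftedNodes c k m, ENNReal.ofReal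
      (shiftDensity σ (incrementChange c f x₁ S S' k m ω) (ω.2.1 b))) ^ α =
      (∏ b ∈ shiftedNodes c k m, ENNReal.ofReal
      (shiftDensity σ (incrementChange c f x₁ S S' k m ω) (ω.2.1 b) ^ α)) * 1 := by
    intro ω
    rw [mul_one, ← ENNReal.prod_rpow_of_nonneg (by linarith)]
    refine Finset.prod_congr rfl fun b _ => ?_
    rw [ENNReal.ofReal_rpow_of_pos (shiftDensity_pos _ _ _)]
  simp_rw [h1]
  rw [lintegral_prod_shiftDensity_rpow hσ hcσ α (measurable_incrementChange hm S S' k m)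
    (shiftedNodes c k m) (fun b hb ω x => incrementChange_updateNoise hb ω x) (G := fun _ => 1)
    measurable_const fun _ _ _ _ => rfl]
  have hcard : ((shiftedNodes c k m).card : ℝ) ≤ (Nat.log 2 c.T + 1 : ℕ) := by
    exact_mod_cast Finset.card_image_le.trans (card_nodeEndsThrough_le m c.T)
  calc _ ≤ ∫⁻ _, ENNReal.ofReal (Real.exp ((α - 1) * (α * ((Nat.log 2 c.T + 1 : ℕ) *
          (4 * d * L / c.T) ^ 2 / (2 * σ ^ 2))))) ∂(tapeLaw d c) := by
        refine lintegral_mono_ae ?_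
        filter_upwards [tapeLaw_ae_interp, tapeLaw_ae_dir] with ω hs hu
        have hb := norm_incrementChange_le (x₁ := x₁) hL hδ hB₁ hB₂ hD hT hf (m := m) hS hs hu
        rw [mul_one, ← ENNReal.ofReal_pow (Real.exp_pos _).le, ← Real.exp_nat_mul]
        refine ENNReal.ofReal_le_ofReal (Real.exp_le_exp.2 ?_)
        have hα1 : 0 ≤ α - 1 := by linarith
        have hα0 : 0 ≤ α := by linarith
        calc ((shiftedNodes c k m).card : ℝ) *
              (α * (α - 1) * ‖incrementChange c f x₁ S S' k m ω‖ ^ 2 / (2 * σ ^ 2))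
            ≤ (Nat.log 2 c.T + 1 : ℕ) *
              (α * (α - 1) * (4 * d * L / c.T) ^ 2 / (2 * σ ^ 2)) := by gcongr
          _ = _ := by ring
    _ = _ := by rw [lintegral_const, measure_univ, mul_one]

theorem renyiDiv_outputLaw_le {L σ α : ℝ} (hL : 0 ≤ L) (hδ : 0 < c.δ)
    (hB₁ : c.B₁ = c.T + 1) (hB₂ : c.B₂ = 1) (hD : c.D = c.δ / c.T) (hT : 0 < c.T) (hσ : 0 < σ)
    (hcσ : ∀ t, c.σ t = σ) (hm : Measurable fun p : Vec d × Z => f p.1 p.2)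
    (hf : ∀ (z : Z) (x y : Vec d), |f x z - f y z| ≤ L * ‖x - y‖) (hα : 1 < α)
    {S S' : Fin M → Z} (hS : Neighboring S S') :
    renyiDiv α (outputLaw c f x₁ S) (outputLaw c f x₁ S') ≤
      ((α * ((Nat.log 2 c.T + 1 : ℕ) * (4 * d * L / c.T) ^ 2 / (2 * σ ^ 2)) : ℝ) : EReal) := by
  obtain ⟨n₀, hn₀⟩ := Neighboring.dataLoss_eq (f := f) hS
  have hes : 0 < c.epochSize := by rw [Params.epochSize, hB₁]; omega
  -- The differing point lies in epoch `n₀ / epochSize`. A leftover point gives an index beyond the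
  -- last epoch, which the coupling permits.
  obtain ⟨m, hmT, hm1, hm2⟩ := Params.exists_round hT hB₂ (Nat.mod_lt n₀ hes)
  have hdiv : n₀ = n₀ / c.epochSize * c.epochSize + n₀ % c.epochSize := by
    rw [mul_comm]; exact (Nat.div_add_mod _ _).symm
  generalize n₀ / c.epochSize = k at hdiv
  generalize n₀ % c.epochSize = i₀ at hdiv hm1 hm2
  rw [hdiv] at hn₀
  have : IsFiniteMeasure (outputLaw c f x₁ S) := by unfold outputLaw; infer_instance
  have : IsFiniteMeasure (outputLaw c f x₁ S') := by unfold outputLaw; infer_instance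
  exact renyiDiv_le_of_density (Q := tapeLaw d c) (Φ := output c f x₁ S') hα
    (measurable_output_right hm S')
    (Finset.measurable_prod _ fun b _ => (measurable_shiftDensity_comp σ b
      (measurable_incrementChange hm S S' k m)).ennreal_ofReal) rfl
    (fun φ hφ => lintegral_outputLaw hσ hcσ hm hmT (fun n hn => hn₀ n (by omega)) hφ)
    (lintegral_density_rpow_le hL hδ hB₁ hB₂ hD hT hσ hcσ hm hf hα hn₀)

end Privacy

open Filter Topology

/-! ### The divergence theorem on the ball -/

section Sphere

variable {d : ℕ}

/-- The uniform probability distribution on the unit ball. -/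
def ballUniform (d : ℕ) : Measure (Vec d) :=
  ((volume : Measure (Vec d)) (Metric.ball 0 1))⁻¹ • (volume : Measure (Vec d)).restrict
    (Metric.ball 0 1)

instance isProbabilityMeasure_ballUniform (d : ℕ) : IsProbabilityMeasure (ballUniform d) := by
  constructor
  rw [ballUniform, Measure.smul_apply, Measure.restrict_apply_univ, smul_eq_mul]
  exact ENNReal.inv_mul_cancel (Metric.measure_ball_pos volume _ one_pos).ne' measure_ball_lt_top.ne

theorem ballUniform_ae_norm_lt : ∀ᵐ v ∂(ballUniform d), ‖v‖ < 1 := by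
  refine Measure.ae_smul_measure ?_ _
  filter_upwards [ae_restrict_mem measurableSet_ball] with v hv
  simpa using hv

theorem volume_real_ball_pos (d : ℕ) : 0 < (volume : Measure (Vec d)).real (Metric.ball 0 1) :=
  ENNReal.toReal_pos (Metric.measure_ball_pos volume _ one_pos).ne' measure_ball_lt_top.ne

/-- A cutoff function of the unit ball. -/
def radialCutoff (n : ℕ) (v : Vec d) : ℝ := max 0 (min 1 (n * (1 - ‖v‖)))

theorem lipschitzWith_radialCutoff (n : ℕ) : LipschitzWith n (radialCutoff (d := d) n) := by
  have h : LipschitzWith n fun v : Vec d => (n : ℝ) * (1 - ‖v‖) := by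
    refine LipschitzWith.of_dist_le_mul fun x y => ?_
    rw [Real.dist_eq, ← mul_sub, abs_mul, dist_eq_norm]
    simp only [Nat.abs_cast, NNReal.coe_natCast]
    gcongr
    rw [sub_sub_sub_cancel_left, abs_sub_comm]
    exact abs_norm_sub_norm_le x y
  exact (h.const_min 1).const_max 0

theorem radialCutoff_of_one_le {n : ℕ} {v : Vec d} (hv : 1 ≤ ‖v‖) : radialCutoff n v = 0 := by
  unfold radialCutoff
  refine max_eq_left ((min_le_right _ _).trans ?_)
  exact mul_nonpos_of_nonneg_of_nonpos (by positivity) (by linarith)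

theorem hasCompactSupport_radialCutoff (n : ℕ) : HasCompactSupport (radialCutoff (d := d) n) := by
  refine HasCompactSupport.of_support_subset_isCompact
    (isCompact_closedBall (0 : Vec d) 1) fun v hv => ?_
  by_contra hv'
  rw [mem_closedBall_zero_iff, not_le] at hv'
  exact hv (radialCutoff_of_one_le hv'.le)

theorem hasDerivAt_norm_line {x : Vec d} (hx : x ≠ 0) (e : Vec d) :
    HasDerivAt (fun t : ℝ => ‖x + t • e‖) (inner ℝ (‖x‖⁻¹ • x) e) 0 := by
  have h1 : HasDerivAt (fun t : ℝ => x + t • e) e 0 := by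
    simpa using ((hasDerivAt_id (0 : ℝ)).smul_const e).const_add x
  have h2 := h1.norm_sq.sqrt (by simpa using hx)
  simp only [Real.sqrt_sq (norm_nonneg _)] at h2
  convert h2 using 1
  rw [real_inner_smul_left]
  simp
  field_simp

/-- The derivative of the radial profile of `radialCutoff`, up to the sign. -/
def cutoffSlope (n : ℕ) (t : ℝ) : ℝ := Set.indicator (Set.Ioo (1 - (n : ℝ)⁻¹) 1) (fun _ => (n : ℝ)) t

/-- Off the two spheres the cutoff is locally `1`, `n(1 - ‖x‖)` or `0`. The direction `-e` is the
one that integration by parts produces. -/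
theorem lineDeriv_radialCutoff {n : ℕ} (hn : 1 ≤ n) {x : Vec d} (h1 : ‖x‖ ≠ 1)
    (h2 : ‖x‖ ≠ 1 - (n : ℝ)⁻¹) (e : Vec d) :
    lineDeriv ℝ (radialCutoff n) x (-e) = cutoffSlope n ‖x‖ * inner ℝ (‖x‖⁻¹ • x) e := by
  have hn' : (0 : ℝ) < n := by exact_mod_cast hn
  have hc : Tendsto (fun t : ℝ => ‖x + t • (-e)‖) (𝓝 0) (𝓝 ‖x‖) := by
    have : Continuous fun t : ℝ => ‖x + t • (-e)‖ := by fun_prop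
    simpa using this.tendsto 0
  refine HasDerivAt.deriv ?_
  rcases lt_or_gt_of_ne h1 with hlt | hgt
  · rcases lt_or_gt_of_ne h2 with hlt' | hgt'
    · have hs : cutoffSlope n ‖x‖ = 0 := Set.indicator_of_notMem (fun h => by linarith [h.1]) _
      rw [hs, zero_mul]
      refine (hasDerivAt_const (0 : ℝ) (1 : ℝ)).congr_of_eventuallyEq ?_
      filter_upwards [hc.eventually (eventually_lt_nhds hlt')] with t ht
      unfold radialCutoff
      have : 1 ≤ (n : ℝ) * (1 - ‖x + t • (-e)‖) := by
        rw [← inv_mul_le_iff₀ hn']; linarith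
      rw [min_eq_left this, max_eq_right zero_le_one]
    · have hs : cutoffSlope n ‖x‖ = n := Set.indicator_of_mem (show ‖x‖ ∈ Set.Ioo _ _ from ⟨hgt', hlt⟩) _
      have hx : x ≠ 0 := by
        rintro rfl
        rw [norm_zero] at hgt'
        have : (n : ℝ)⁻¹ ≤ 1 := inv_le_one_of_one_le₀ (by exact_mod_cast hn)
        linarith
      have hd : HasDerivAt (fun t : ℝ => (n : ℝ) * (1 - ‖x + t • (-e)‖))
          (n * (0 - inner ℝ (‖x‖⁻¹ • x) (-e))) 0 :=
        ((hasDerivAt_const _ _).sub (hasDerivAt_norm_line hx (-e))).const_mul _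
      rw [hs, show (n : ℝ) * inner ℝ (‖x‖⁻¹ • x) e = n * (0 - inner ℝ (‖x‖⁻¹ • x) (-e)) by
        rw [inner_neg_right]; ring]
      refine hd.congr_of_eventuallyEq ?_
      filter_upwards [hc.eventually (eventually_lt_nhds hlt),
        hc.eventually (eventually_gt_nhds hgt')] with t ht ht'
      unfold radialCutoff
      have h3 : (n : ℝ) * (1 - ‖x + t • (-e)‖) ≤ 1 := by
        rw [← le_inv_mul_iff₀ hn']; linarith
      have h4 : 0 ≤ (n : ℝ) * (1 - ‖x + t • (-e)‖) := mul_nonneg hn'.le (by linarith)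
      rw [min_eq_right h3, max_eq_right h4]
  · have hs : cutoffSlope n ‖x‖ = 0 := Set.indicator_of_notMem (fun h => by linarith [h.2]) _
    rw [hs, zero_mul]
    refine (hasDerivAt_const (0 : ℝ) (0 : ℝ)).congr_of_eventuallyEq ?_
    filter_upwards [hc.eventually (eventually_gt_nhds hgt)] with t ht
    exact radialCutoff_of_one_le ht.le

variable [NeZero d]

theorem integral_sphereUniform {E : Type*} [NormedAddCommGroup E] [NormedSpace ℝ E] (ψ : Vec d → E) :
    ∫ u, ψ u ∂(sphereUniform d) = ((volume : Measure (Vec d)).toSphere.real Set.univ)⁻¹ •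
      ∫ u, ψ u ∂(volume : Measure (Vec d)).toSphere := by
  rw [sphereUniform, (MeasurableEmbedding.subtype_coe
    (Metric.isClosed_sphere.measurableSet)).integral_map, integral_smul_measure, ENNReal.toReal_inv]
  rfl

/-- Polar coordinates separate the two factors. Comparing with the case `ψ = 1` eliminates the
radial integral, so it never has to be evaluated. -/
theorem integral_radial_mul (a : ℝ → ℝ) (ψ : Vec d → ℝ) :
    ∫ x : Vec d, a ‖x‖ * ψ (‖x‖⁻¹ • x) =
      (∫ x : Vec d, a ‖x‖) * ∫ u, ψ u ∂(sphereUniform d) := by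
  have key : ∀ ψ : Vec d → ℝ, ∫ x : Vec d, a ‖x‖ * ψ (‖x‖⁻¹ • x) =
      (∫ u, ψ u ∂(volume : Measure (Vec d)).toSphere) *
        ∫ r : Set.Ioi (0 : ℝ), a r ∂(Measure.volumeIoiPow (Module.finrank ℝ (Vec d) - 1)) := by
    intro ψ
    calc ∫ x : Vec d, a ‖x‖ * ψ (‖x‖⁻¹ • x)
        = ∫ x : ({(0)}ᶜ : Set (Vec d)), a ‖x.1‖ * ψ (‖x.1‖⁻¹ • x.1)
            ∂((volume : Measure (Vec d)).comap (↑)) := by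
          rw [integral_subtype_comap (measurableSet_singleton _).compl
            fun x : Vec d => a ‖x‖ * ψ (‖x‖⁻¹ • x), restrict_compl_singleton]
      _ = ∫ p, ψ p.1 * a p.2 ∂(volume : Measure (Vec d)).toSphere.prod
            (.volumeIoiPow (Module.finrank ℝ (Vec d) - 1)) := by
          have := (volume : Measure (Vec d)).measurePreserving_homeomorphUnitSphereProd.integral_comp
            (Homeomorph.measurableEmbedding _)
            (fun p : Metric.sphere (0 : Vec d) 1 × Set.Ioi (0 : ℝ) => ψ p.1 * a p.2)
          rw [← this]
          refine integral_congr_ae (Eventually.of_forall fun x => ?_)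
          simp [mul_comm]
      _ = _ := integral_prod_mul (fun u : Metric.sphere (0 : Vec d) 1 => ψ u)
            fun r : Set.Ioi (0 : ℝ) => a r
  have h1 := key fun _ => 1
  simp only [mul_one, integral_const, smul_eq_mul] at h1
  have h0 : (volume : Measure (Vec d)).toSphere.real Set.univ ≠ 0 := by
    rw [Measure.toSphere_real_apply_univ, finrank_euclideanSpace, Fintype.card_fin]
    exact mul_ne_zero (by exact_mod_cast NeZero.ne d) (volume_real_ball_pos d).ne'
  rw [key ψ, h1, integral_sphereUniform, smul_eq_mul]
  field_simp

theorem integral_cutoffSlope {n : ℕ} (hn : 1 ≤ n) :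
    ∫ x : Vec d, cutoffSlope n ‖x‖ =
      (volume : Measure (Vec d)).real (Metric.ball 0 1) * (n * (1 - (1 - (n : ℝ)⁻¹) ^ d)) := by
  have hn' : (n : ℝ)⁻¹ ≤ 1 := inv_le_one_of_one_le₀ (by exact_mod_cast hn)
  have h0 : (0 : ℝ) < (n : ℝ)⁻¹ := by
    have : (0 : ℝ) < n := by exact_mod_cast hn
    positivity
  have h1 : (fun x : Vec d => cutoffSlope n ‖x‖) =
      Set.indicator (Metric.ball (0 : Vec d) 1 \ Metric.closedBall 0 (1 - (n : ℝ)⁻¹))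
        fun _ => (n : ℝ) := by
    funext x
    rw [cutoffSlope, ← Set.indicator_comp_right (fun x : Vec d => ‖x‖)]
    congr 1
    ext x
    simp [and_comm]
  rw [h1, integral_indicator (measurableSet_ball.diff measurableSet_closedBall), setIntegral_const,
    smul_eq_mul, measureReal_sdiff (Metric.closedBall_subset_ball (by linarith))
      measurableSet_closedBall, measureReal_def (s := Metric.closedBall _ _),
    Measure.addHaar_closedBall _ _ (by linarith), ENNReal.toReal_mul,
    ENNReal.toReal_ofReal (pow_nonneg (by linarith) _), finrank_euclideanSpace, Fintype.card_fin,
    ← measureReal_def]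
  ring

/-- The expression is a difference quotient of `t ^ d` at `1`. -/
theorem tendsto_mul_one_sub_pow (d : ℕ) :
    Tendsto (fun n : ℕ => (n : ℝ) * (1 - (1 - (n : ℝ)⁻¹) ^ d)) atTop (𝓝 d) := by
  have h1 : HasDerivAt (fun t : ℝ => t ^ d) (d : ℝ) 1 := by simpa using hasDerivAt_pow d (1 : ℝ)
  have h2 : Tendsto (fun n : ℕ => 1 - (n : ℝ)⁻¹) atTop (𝓝[≠] 1) := by
    refine tendsto_nhdsWithin_iff.2 ⟨?_, ?_⟩
    · simpa using (tendsto_inv_atTop_nhds_zero_nat (𝕜 := ℝ)).const_sub 1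
    · filter_upwards [eventually_gt_atTop 0] with n hn
      have : (n : ℝ) ≠ 0 := by exact_mod_cast hn.ne'
      simpa using this
  refine (h1.tendsto_slope.comp h2).congr' ?_
  filter_upwards [eventually_gt_atTop 0] with n hn
  have : (n : ℝ) ≠ 0 := by exact_mod_cast hn.ne'
  simp only [Function.comp_apply, slope_def_field, one_pow]
  field_simp
  ring

theorem measurable_cutoffSlope (n : ℕ) : Measurable (cutoffSlope n) :=
  measurable_const.indicator measurableSet_Ioo

theorem cutoffSlope_nonneg (n : ℕ) (t : ℝ) : 0 ≤ cutoffSlope n t :=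
  Set.indicator_nonneg (fun _ _ => by positivity) t

theorem integrable_cutoffSlope_mul {n : ℕ} {k : Vec d → ℝ} (hk : Measurable k) {C : ℝ}
    (hC : ∀ x, ‖x‖ < 1 → |k x| ≤ C) : Integrable fun x : Vec d => cutoffSlope n ‖x‖ * k x := by
  have h1 : Integrable (Set.indicator (Metric.ball (0 : Vec d) 1) fun _ => (n : ℝ) * C) := by
    rw [integrable_indicator_iff measurableSet_ball]
    exact integrableOn_const measure_ball_lt_top.ne
  refine h1.mono' (((measurable_cutoffSlope n).comp measurable_norm).mul hk).aestronglyMeasurable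
    (Eventually.of_forall fun x => ?_)
  by_cases hx : ‖x‖ < 1
  · rw [Set.indicator_of_mem (by simpa using hx), norm_mul, Real.norm_eq_abs, Real.norm_eq_abs]
    refine mul_le_mul ?_ (hC x hx) (abs_nonneg _) (by positivity)
    rw [abs_of_nonneg (cutoffSlope_nonneg _ _)]
    exact Set.indicator_le_self' (fun _ _ => by positivity) _
  · rw [Set.indicator_of_notMem (by simpa using hx), cutoffSlope,
      Set.indicator_of_notMem fun h => hx h.2]
    simp

variable {G : Vec d → ℝ} {L : NNReal}

theorem tendsto_integral_fderiv_mul_cutoff (hL : LipschitzWith L G) (e : Vec d) :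
    Tendsto (fun n : ℕ => ∫ x, fderiv ℝ G x e * radialCutoff n x) atTop
      (𝓝 (∫ x in Metric.ball (0 : Vec d) 1, fderiv ℝ G x e)) := by
  rw [← integral_indicator measurableSet_ball]
  have hfm : Measurable fun x : Vec d => fderiv ℝ G x e := measurable_fderiv_apply_const ℝ G e
  refine tendsto_integral_of_dominated_convergence
    (Set.indicator (Metric.closedBall (0 : Vec d) 1) fun _ => L * ‖e‖) (fun n => ?_) ?_ (fun n => ?_)
    ?_
  · exact (hfm.mul (lipschitzWith_radialCutoff n).continuous.measurable).aestronglyMeasurable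
  · rw [integrable_indicator_iff measurableSet_closedBall]
    exact integrableOn_const (isCompact_closedBall _ _).measure_lt_top.ne
  · refine Eventually.of_forall fun x => ?_
    by_cases hx : ‖x‖ ≤ 1
    · rw [Set.indicator_of_mem (by simpa using hx), norm_mul]
      have h1 : ‖fderiv ℝ G x e‖ ≤ L * ‖e‖ :=
        ((fderiv ℝ G x).le_opNorm e).trans (by gcongr; exact norm_fderiv_le_of_lipschitz ℝ hL)
      have h2 : ‖radialCutoff n x‖ ≤ 1 := by
        unfold radialCutoff
        rw [Real.norm_of_nonneg (le_max_left _ _)]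
        exact max_le zero_le_one (min_le_left _ _)
      calc _ ≤ L * ‖e‖ * 1 := mul_le_mul h1 h2 (norm_nonneg _) (by positivity)
        _ = _ := mul_one _
    · rw [radialCutoff_of_one_le (le_of_not_ge hx), mul_zero, norm_zero]
      exact Set.indicator_nonneg (fun _ _ => by positivity) _
  · refine Eventually.of_forall fun x => ?_
    by_cases hx : ‖x‖ < 1
    · rw [Set.indicator_of_mem (by simpa using hx)]
      refine tendsto_const_nhds.congr' ?_
      obtain ⟨N, hN⟩ := exists_nat_gt (1 - ‖x‖)⁻¹
      filter_upwards [eventually_ge_atTop N] with n hn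
      have h1 : 1 ≤ (n : ℝ) * (1 - ‖x‖) := by
        rw [← inv_le_iff_one_le_mul₀ (by linarith)]
        exact hN.le.trans (by exact_mod_cast hn)
      rw [radialCutoff, min_eq_left h1, max_eq_right zero_le_one, mul_one]
    · rw [Set.indicator_of_notMem (by simpa using hx)]
      simp only [radialCutoff_of_one_le (le_of_not_gt hx), mul_zero]
      exact tendsto_const_nhds

theorem integral_fderiv_mul_cutoff (hd : Differentiable ℝ G) (hL : LipschitzWith L G) {n : ℕ}
    (hn : 1 ≤ n) (e : Vec d) :
    ∫ x, fderiv ℝ G x e * radialCutoff n x =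
      ∫ x : Vec d, cutoffSlope n ‖x‖ * (inner ℝ (‖x‖⁻¹ • x) e * G x) := by
  have h := LipschitzWith.integral_lineDeriv_mul_eq (μ := (volume : Measure (Vec d))) (f := G) hL
    (lipschitzWith_radialCutoff (d := d) n) (hasCompactSupport_radialCutoff n) e
  have hline : ∀ x, lineDeriv ℝ G x e = fderiv ℝ G x e := fun x => (hd x).lineDeriv_eq_fderiv
  simp only [hline] at h
  rw [h]
  refine integral_congr_ae ?_
  have hs : ∀ r : ℝ, ∀ᵐ x : Vec d, ‖x‖ ≠ r := fun r => by
    have := Measure.addHaar_sphere (volume : Measure (Vec d)) 0 r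
    filter_upwards [measure_eq_zero_iff_ae_notMem.1 this] with x hx
    simpa using hx
  filter_upwards [hs 1, hs (1 - (n : ℝ)⁻¹)] with x h1 h2
  rw [lineDeriv_radialCutoff hn h1 h2, mul_assoc]

/-- The slope of the cutoff lives on a shell of width `1 / n`. Replacing `G x` there by its value at
the radial projection of `x` to the sphere costs at most `L / n`, after which the integral
separates. -/
theorem abs_integral_fderiv_mul_cutoff_sub_le (hd : Differentiable ℝ G) (hL : LipschitzWith L G)
    {n : ℕ} (hn : 1 ≤ n) (e : Vec d) :
    |(∫ x, fderiv ℝ G x e * radialCutoff n x) - (∫ x : Vec d, cutoffSlope n ‖x‖) *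
      ∫ u, inner ℝ u e * G u ∂(sphereUniform d)| ≤
      (∫ x : Vec d, cutoffSlope n ‖x‖) * (‖e‖ * L * (n : ℝ)⁻¹) := by
  have hn' : (0 : ℝ) < n := by exact_mod_cast hn
  have hGm : Measurable G := hd.continuous.measurable
  have hunit : ∀ x : Vec d, ‖‖x‖⁻¹ • x‖ ≤ 1 := fun x => by
    rw [norm_smul, norm_inv, norm_norm]
    exact inv_mul_le_one
  have hinner : ∀ x : Vec d, |inner ℝ (‖x‖⁻¹ • x) e| ≤ ‖e‖ := fun x =>
    (abs_real_inner_le_norm _ _).trans (mul_le_of_le_one_left (norm_nonneg _) (hunit x))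
  have hG : ∀ x : Vec d, ‖x‖ ≤ 1 → |G x| ≤ |G 0| + L := fun x hx => by
    have h1 := hL.dist_le_mul x 0
    rw [Real.dist_eq, dist_zero_right] at h1
    have h2 : (L : ℝ) * ‖x‖ ≤ L := mul_le_of_le_one_right L.2 hx
    have h3 := abs_sub_abs_le_abs_sub (G x) (G 0)
    linarith
  have hb : ∀ x y : Vec d, ‖y‖ ≤ 1 → |inner ℝ (‖x‖⁻¹ • x) e * G y| ≤ ‖e‖ * (|G 0| + L) :=
    fun x y hy => by
      rw [abs_mul]
      exact mul_le_mul (hinner x) (hG y hy) (abs_nonneg _) (norm_nonneg _)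
  have i1 : Integrable fun x : Vec d => cutoffSlope n ‖x‖ * (inner ℝ (‖x‖⁻¹ • x) e * G x) :=
    integrable_cutoffSlope_mul (by fun_prop) fun x hx => hb x x hx.le
  have i2 : Integrable fun x : Vec d =>
      cutoffSlope n ‖x‖ * (inner ℝ (‖x‖⁻¹ • x) e * G (‖x‖⁻¹ • x)) :=
    integrable_cutoffSlope_mul (by fun_prop) fun x _ => hb x _ (hunit x)
  have i3 : Integrable fun x : Vec d => cutoffSlope n ‖x‖ * (‖e‖ * L * (n : ℝ)⁻¹) :=
    integrable_cutoffSlope_mul measurable_const fun x _ => le_rfl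
  rw [integral_fderiv_mul_cutoff hd hL hn,
    ← integral_radial_mul (cutoffSlope n) (fun u => inner ℝ u e * G u), ← integral_sub i1 i2,
    ← integral_mul_const, ← Real.norm_eq_abs]
  refine norm_integral_le_of_norm_le i3 (Eventually.of_forall fun x => ?_)
  rw [← mul_sub, ← mul_sub, norm_mul, Real.norm_of_nonneg (cutoffSlope_nonneg _ _)]
  by_cases hx : ‖x‖ ∈ Set.Ioo (1 - (n : ℝ)⁻¹) 1
  · refine mul_le_mul_of_nonneg_left ?_ (cutoffSlope_nonneg _ _)
    rw [norm_mul, mul_assoc]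
    refine mul_le_mul (hinner x) ?_ (norm_nonneg _) (norm_nonneg _)
    have h1 := hL.dist_le_mul x (‖x‖⁻¹ • x)
    rw [Real.dist_eq] at h1
    refine h1.trans (mul_le_mul_of_nonneg_left ?_ L.2)
    have hx0 : 0 < ‖x‖ := by
      have : (n : ℝ)⁻¹ ≤ 1 := inv_le_one_of_one_le₀ (by exact_mod_cast hn)
      linarith [hx.1]
    have h2 : x - ‖x‖⁻¹ • x = (1 - ‖x‖⁻¹) • x := by rw [sub_smul, one_smul]
    rw [dist_eq_norm, h2, norm_smul, Real.norm_eq_abs, ← abs_of_pos hx0, ← abs_mul, abs_of_pos hx0,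
      sub_mul, one_mul, inv_mul_cancel₀ hx0.ne', abs_le]
    constructor <;> linarith [hx.1, hx.2]
  · rw [cutoffSlope, Set.indicator_of_notMem hx, zero_mul, zero_mul]

/-- Integration by parts against sharpening radial cutoffs: the volume side tends to the integral
over the ball, the shell side to the ball volume times `d` times the spherical mean. The cutoffs are
needed because `G` is only Lipschitz and differentiable. -/
theorem integral_inner_mul_sphereUniform (hd : Differentiable ℝ G) (hL : LipschitzWith L G)
    (e : Vec d) :
    d * ∫ u, inner ℝ u e * G u ∂(sphereUniform d) = ∫ v, fderiv ℝ G v e ∂(ballUniform d) := by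
  set J := ∫ u, inner ℝ u e * G u ∂(sphereUniform d)
  set V := (volume : Measure (Vec d)).real (Metric.ball 0 1) with hV
  have hVpos : 0 < V := volume_real_ball_pos d
  have hslope : Tendsto (fun n : ℕ => ∫ x : Vec d, cutoffSlope n ‖x‖) atTop (𝓝 (V * d)) := by
    refine ((tendsto_mul_one_sub_pow d).const_mul V).congr' ?_
    filter_upwards [eventually_ge_atTop 1] with n hn
    rw [integral_cutoffSlope hn]
  have h1 := (tendsto_integral_fderiv_mul_cutoff hL e).sub (hslope.mul_const J)
  have h2 : Tendsto (fun n : ℕ => (∫ x : Vec d, cutoffSlope n ‖x‖) * (‖e‖ * L * (n : ℝ)⁻¹)) atTop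
      (𝓝 (V * d * (‖e‖ * L * 0))) :=
    hslope.mul ((tendsto_inv_atTop_nhds_zero_nat (𝕜 := ℝ)).const_mul _)
  rw [mul_zero, mul_zero] at h2
  have h3 := squeeze_zero_norm' (f := fun n : ℕ => (∫ x, fderiv ℝ G x e * radialCutoff n x) -
    (∫ x : Vec d, cutoffSlope n ‖x‖) * J) (by
      filter_upwards [eventually_ge_atTop 1] with n hn
      exact abs_integral_fderiv_mul_cutoff_sub_le hd hL hn e) h2
  have h4 := tendsto_nhds_unique h1 h3
  rw [ballUniform, integral_smul_measure, ENNReal.toReal_inv, ← measureReal_def, ← hV, smul_eq_mul]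
  field_simp
  linarith

theorem integral_smul_sphereUniform (hd : Differentiable ℝ G) (hL : LipschitzWith L G) :
    (d : ℝ) • ∫ u, G u • u ∂(sphereUniform d) = ∫ v, gradient G v ∂(ballUniform d) := by
  have hb : ∀ᵐ u ∂(sphereUniform d), ‖G u • u‖ ≤ |G 0| + L := by
    filter_upwards [sphereUniform_norm_eq] with u hu
    have h1 := hL.dist_le_mul u 0
    rw [Real.dist_eq, dist_zero_right, hu, mul_one] at h1
    rw [norm_smul, hu, mul_one, Real.norm_eq_abs]
    have h3 := abs_sub_abs_le_abs_sub (G u) (G 0)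
    linarith
  have hm : Measurable G := hd.continuous.measurable
  have i1 : Integrable (fun u => G u • u) (sphereUniform d) :=
    Integrable.of_bound (hm.smul measurable_id).aestronglyMeasurable _ hb
  have hgrad : gradient G = fun v => (InnerProductSpace.toDual ℝ (Vec d)).symm (fderiv ℝ G v) := rfl
  have i2 : Integrable (gradient G) (ballUniform d) := by
    refine Integrable.of_bound (C := L) ?_ (Eventually.of_forall fun v => ?_)
    · rw [hgrad]
      exact ((InnerProductSpace.toDual ℝ (Vec d)).symm.continuous.measurable.comp
        (measurable_fderiv ℝ G)).aestronglyMeasurable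
    · rw [hgrad, LinearIsometryEquiv.norm_map]
      exact norm_fderiv_le_of_lipschitz ℝ hL
  refine ext_inner_right ℝ fun e => ?_
  rw [real_inner_smul_left, real_inner_comm, ← integral_inner i1, real_inner_comm,
    ← integral_inner i2]
  have e1 : ∀ u, inner ℝ e (G u • u) = inner ℝ u e * G u := fun u => by
    rw [real_inner_smul_right, real_inner_comm, mul_comm]
  have e2 : ∀ v, inner ℝ e (gradient G v) = fderiv ℝ G v e := fun v => inner_gradient_right (𝕜 := ℝ)
  simp_rw [e1, e2]
  exact integral_inner_mul_sphereUniform hd hL e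

/-- The second moment of a coordinate of a uniform direction. -/
theorem integral_inner_sq_sphereUniform (e : Vec d) :
    ∫ u, (inner ℝ u e) ^ 2 ∂(sphereUniform d) = ‖e‖ ^ 2 / d := by
  have hd0 : (d : ℝ) ≠ 0 := by exact_mod_cast NeZero.ne d
  -- For a linear functional the derivative is constant, so the divergence theorem computes the
  -- second moment.
  have h := integral_inner_mul_sphereUniform (G := fun u : Vec d => innerSL ℝ e u)
    (innerSL ℝ e).differentiable (innerSL ℝ e).lipschitz e
  have h1 : ∀ v, fderiv ℝ (fun u : Vec d => innerSL ℝ e u) v e = ‖e‖ ^ 2 := fun v => by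
    rw [ContinuousLinearMap.fderiv, innerSL_apply_apply, real_inner_self_eq_norm_sq]
  rw [funext h1, integral_const, probReal_univ, one_smul] at h
  simp only [innerSL_apply_apply] at h
  rw [eq_div_iff hd0, mul_comm, ← h]
  congr 2
  funext u
  rw [sq, real_inner_comm u e]

/-- The mean of a bounded multiple of a uniform direction. -/
theorem norm_sq_integral_smul_sphereUniform_le {φ : Vec d → ℝ} (hφ : Measurable φ) {B : ℝ}
    (hB : ∀ᵐ u ∂(sphereUniform d), |φ u| ≤ B) :
    ‖∫ u, φ u • u ∂(sphereUniform d)‖ ^ 2 ≤ B ^ 2 / d := by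
  have hd0 : (0 : ℝ) < d := by exact_mod_cast NeZero.pos d
  set m := ∫ u, φ u • u ∂(sphereUniform d) with hm
  have hbd : ∀ᵐ u ∂(sphereUniform d), ‖φ u • u‖ ≤ B := by
    filter_upwards [hB, sphereUniform_norm_eq] with u h1 h2
    rwa [norm_smul, h2, mul_one]
  have i1 : Integrable (fun u => φ u • u) (sphereUniform d) :=
    Integrable.of_bound (hφ.smul measurable_id).aestronglyMeasurable _ hbd
  have i2 : Integrable (fun u => (inner ℝ u m) ^ 2) (sphereUniform d) := by
    refine Integrable.of_bound (C := ‖m‖ ^ 2) (by fun_prop) ?_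
    filter_upwards [sphereUniform_norm_eq] with u h2
    rw [norm_pow]
    refine pow_le_pow_left₀ (norm_nonneg _) ?_ 2
    simpa [h2] using norm_inner_le_norm (𝕜 := ℝ) u m
  -- The mean is paired with itself, and Young's inequality is weighted so that the second moment
  -- `‖m‖²/d` gives back exactly half of `‖m‖²`. This gains `1 / d` over the trivial bound.
  have h1 : ‖m‖ ^ 2 ≤ ∫ u, (B ^ 2 / (2 * d) + d / 2 * (inner ℝ u m) ^ 2) ∂(sphereUniform d) := by
    rw [← real_inner_self_eq_norm_sq]
    nth_rw 2 [hm]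
    rw [← integral_inner i1]
    refine integral_mono_ae (i1.const_inner m) ((integrable_const _).add (i2.const_mul _)) ?_
    filter_upwards [hB] with u hu
    have hsq : φ u ^ 2 ≤ B ^ 2 := sq_le_sq' (abs_le.1 hu).1 (abs_le.1 hu).2
    rw [real_inner_smul_right, real_inner_comm]
    have h3 : 0 ≤ (φ u - d * inner ℝ u m) ^ 2 / (2 * d) := by positivity
    have h4 : (φ u - d * inner ℝ u m) ^ 2 / (2 * d) =
        φ u ^ 2 / (2 * d) + d / 2 * (inner ℝ u m) ^ 2 - φ u * inner ℝ u m := by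
      field_simp
      ring
    have h5 : φ u ^ 2 / (2 * d) ≤ B ^ 2 / (2 * d) := by gcongr
    linarith
  rw [integral_add (integrable_const _) (i2.const_mul _), integral_const_mul,
    integral_inner_sq_sphereUniform, integral_const, probReal_univ, one_smul] at h1
  have h2 : (d : ℝ) / 2 * (‖m‖ ^ 2 / d) = ‖m‖ ^ 2 / 2 := by field_simp
  have h3 : B ^ 2 / (2 * d) = B ^ 2 / d / 2 := by rw [div_div, mul_comm]
  rw [h2, h3] at h1
  linarith

end Sphere

/-! ### Differentiation under the integral sign -/

section Param

variable {d : ℕ} {Y : Type*} [MeasurableSpace Y] {ν : Measure Y} [IsProbabilityMeasure ν]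
  {g : Vec d → Y → ℝ} {L : NNReal}

theorem toDual_gradient (h : Vec d → ℝ) (x : Vec d) :
    InnerProductSpace.toDual ℝ (Vec d) (gradient h x) = fderiv ℝ h x :=
  LinearIsometryEquiv.apply_symm_apply _ _

theorem measurable_gradient (h : Vec d → ℝ) : Measurable (gradient h) :=
  (InnerProductSpace.toDual ℝ (Vec d)).symm.continuous.measurable.comp (measurable_fderiv ℝ h)

theorem norm_gradient_le {h : Vec d → ℝ} (hL : LipschitzWith L h) (x : Vec d) :
    ‖gradient h x‖ ≤ L := by
  rw [gradient, LinearIsometryEquiv.norm_map]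
  exact norm_fderiv_le_of_lipschitz ℝ hL

theorem integrable_gradient {h : Vec d → ℝ} (hL : LipschitzWith L h) {φ : Y → Vec d}
    (hφ : Measurable φ) : Integrable (fun y => gradient h (φ y)) ν :=
  Integrable.of_bound ((measurable_gradient h).comp hφ).aestronglyMeasurable L
    (Eventually.of_forall fun _ => norm_gradient_le hL _)

/-- Each directional component is a pointwise limit of difference quotients along `1 / (n + 1)`, and
these are measurable in `y`. -/
theorem measurable_gradient_param (hm : ∀ x, Measurable (g x))
    (hd : ∀ y, Differentiable ℝ fun x => g x y) (x : Vec d) :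
    Measurable fun y => gradient (fun x => g x y) x := by
  have h1 : ∀ e : Vec d, Measurable fun y => inner ℝ e (gradient (fun x => g x y) x) := by
    intro e
    refine measurable_of_tendsto_metrizable
      (f := fun n : ℕ => fun y => ((n : ℝ) + 1) * (g (x + (1 / ((n : ℝ) + 1)) • e) y - g x y))
      (fun n => ((hm _).sub (hm _)).const_mul _) (tendsto_pi_nhds.2 fun y => ?_)
    have h2 : HasDerivAt (fun t : ℝ => g (x + t • e) y) (fderiv ℝ (fun x => g x y) x e) 0 :=
      ((hd y) x).hasFDerivAt.hasLineDerivAt e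
    have h3 : Tendsto (fun n : ℕ => 1 / ((n : ℝ) + 1)) atTop (𝓝[≠] 0) := by
      refine tendsto_nhdsWithin_iff.2 ⟨tendsto_one_div_add_atTop_nhds_zero_nat, ?_⟩
      exact Eventually.of_forall fun n => by simp; positivity
    rw [inner_gradient_right (𝕜 := ℝ)]
    refine ((hasDerivAt_iff_tendsto_slope.1 h2).comp h3).congr fun n => ?_
    simp [slope_def_field]
    field_simp
  have h2 : Measurable fun y => WithLp.toLp 2 fun i : Fin d =>
      inner ℝ (EuclideanSpace.single i (1 : ℝ)) (gradient (fun x => g x y) x) :=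
    (WithLp.measurable_toLp 2 _).comp (measurable_pi_iff.2 fun i => h1 _)
  convert h2 using 2 with y
  ext i
  change _ = inner ℝ (EuclideanSpace.single i 1) (gradient (fun x => g x y) x)
  rw [EuclideanSpace.inner_single_left]
  simp

theorem hasGradientAt_integral (hm : ∀ x, Measurable (g x)) (hi : ∀ x, Integrable (g x) ν)
    (hd : ∀ y, Differentiable ℝ fun x => g x y) (hL : ∀ y, LipschitzWith L fun x => g x y)
    (x : Vec d) :
    HasGradientAt (fun x => ∫ y, g x y ∂ν) (∫ y, gradient (fun x => g x y) x ∂ν) x := by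
  have hgi : Integrable (fun y => gradient (fun x => g x y) x) ν :=
    Integrable.of_bound (measurable_gradient_param hm hd x).aestronglyMeasurable L
      (Eventually.of_forall fun y => norm_gradient_le (hL y) _)
  have h := hasFDerivAt_integral_of_dominated_loc_of_lip (μ := ν) (𝕜 := ℝ) (F := g)
    (F' := fun y => fderiv ℝ (fun x => g x y) x) (x₀ := x) (bound := fun _ => (L : ℝ)) (s := Set.univ)
    Filter.univ_mem (Eventually.of_forall fun x => (hm x).aestronglyMeasurable) (hi x) (by
      have h1 := (InnerProductSpace.toDual ℝ (Vec d)).continuous.measurable.comp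
        (measurable_gradient_param hm hd x)
      simp only [Function.comp_def, toDual_gradient] at h1
      exact h1.aestronglyMeasurable) (Eventually.of_forall fun y => by
      have h2 : Real.nnabs (L : ℝ) = L := by simp
      rw [h2]
      exact (hL y).lipschitzOnWith) (integrable_const _)
    (Eventually.of_forall fun y => (hd y x).hasFDerivAt)
  have h2 := h.2
  rw [hasGradientAt_iff_hasFDerivAt]
  refine h2.congr_fderiv ?_
  have h3 := ((InnerProductSpace.toDual ℝ (Vec d)).toLinearIsometry.toContinuousLinearMap).integral_comp_comm hgi
  simp only [LinearIsometry.coe_toContinuousLinearMap, LinearIsometryEquiv.coe_toLinearIsometry,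
    toDual_gradient] at h3
  exact h3

theorem lipschitzWith_integral (hi : ∀ x, Integrable (g x) ν)
    (hL : ∀ y, LipschitzWith L fun x => g x y) : LipschitzWith L fun x => ∫ y, g x y ∂ν := by
  refine LipschitzWith.of_dist_le_mul fun x x' => ?_
  rw [Real.dist_eq, ← integral_sub (hi x) (hi x')]
  have h := norm_integral_le_of_norm_le_const (μ := ν) (f := fun y => g x y - g x' y)
    (C := L * dist x x') (Eventually.of_forall fun y => by
      simpa [Real.dist_eq] using (hL y).dist_le_mul x x')
  simpa using h

end Param

/-! ### Uniform smoothing -/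

section Smoothing

variable {d : ℕ} {F : Vec d → ℝ} {L : NNReal}

/-- The average of `F` over the ball of radius `r` around `x`. -/
def ballSmooth (r : ℝ) (F : Vec d → ℝ) (x : Vec d) : ℝ := ∫ v, F (x + r • v) ∂(ballUniform d)

theorem abs_add_smul_sub_le (hL : LipschitzWith L F) {r : ℝ} (hr : 0 ≤ r) (x : Vec d) {v : Vec d}
    (hv : ‖v‖ ≤ 1) : |F (x + r • v) - F x| ≤ L * r := by
  have h := hL.dist_le_mul (x + r • v) x
  rw [Real.dist_eq, dist_eq_norm, add_sub_cancel_left, norm_smul, Real.norm_of_nonneg hr] at h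
  refine h.trans ?_
  gcongr
  exact mul_le_of_le_one_right hr hv

theorem integrable_ballUniform (hL : LipschitzWith L F) {r : ℝ} (hr : 0 ≤ r) (x : Vec d) :
    Integrable (fun v => F (x + r • v)) (ballUniform d) := by
  have hc : Continuous F := hL.continuous
  refine Integrable.of_bound (C := |F x| + L * r) (by fun_prop) ?_
  filter_upwards [ballUniform_ae_norm_lt] with v hv
  have h1 := abs_add_smul_sub_le hL hr x hv.le
  have h2 := abs_sub_abs_le_abs_sub (F (x + r • v)) (F x)
  rw [Real.norm_eq_abs]
  linarith

theorem lipschitzWith_shift (hL : LipschitzWith L F) (v : Vec d) :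
    LipschitzWith L fun x => F (x + v) := by
  refine LipschitzWith.of_dist_le_mul fun x y => ?_
  simpa using hL.dist_le_mul (x + v) (y + v)

theorem gradient_shift (v x : Vec d) : gradient (fun x => F (x + v)) x = gradient F (x + v) := by
  rw [gradient, gradient, fderiv_comp_add_right]

theorem hasGradientAt_ballSmooth (hd : Differentiable ℝ F) (hL : LipschitzWith L F) {r : ℝ}
    (hr : 0 ≤ r) (x : Vec d) :
    HasGradientAt (ballSmooth r F) (∫ v, gradient F (x + r • v) ∂(ballUniform d)) x := by
  have h := hasGradientAt_integral (g := fun x v => F (x + r • v)) (ν := ballUniform d) (L := L)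
    (fun x => by have := hL.continuous.measurable; fun_prop)
    (fun x => integrable_ballUniform hL hr x) (fun v => by fun_prop)
    (fun v => lipschitzWith_shift hL _) x
  simp only [gradient_shift] at h
  exact h

theorem gradient_ballSmooth (hd : Differentiable ℝ F) (hL : LipschitzWith L F) {r : ℝ}
    (hr : 0 ≤ r) (x : Vec d) :
    gradient (ballSmooth r F) x = ∫ v, gradient F (x + r • v) ∂(ballUniform d) :=
  (hasGradientAt_ballSmooth hd hL hr x).gradient

theorem lipschitzWith_ballSmooth (hL : LipschitzWith L F) {r : ℝ} (hr : 0 ≤ r) :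
    LipschitzWith L (ballSmooth r F) :=
  lipschitzWith_integral (g := fun x v => F (x + r • v)) (fun x => integrable_ballUniform hL hr x)
    (fun _ => lipschitzWith_shift hL _)

theorem ballSmooth_le (hL : LipschitzWith L F) {r : ℝ} (hr : 0 ≤ r) (x : Vec d) :
    ballSmooth r F x ≤ F x + L * r := by
  have h : ∫ v, F (x + r • v) ∂(ballUniform d) ≤ ∫ _, (F x + L * r) ∂(ballUniform d) := by
    refine integral_mono_ae (integrable_ballUniform hL hr x) (integrable_const _) ?_
    filter_upwards [ballUniform_ae_norm_lt] with v hv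
    have h1 := abs_add_smul_sub_le hL hr x hv.le
    linarith [le_abs_self (F (x + r • v) - F x)]
  simpa [ballSmooth] using h

theorem iInf_le_ballSmooth (hL : LipschitzWith L F) (hF : BddBelow (Set.range F)) {r : ℝ}
    (hr : 0 ≤ r) (x : Vec d) : ⨅ y, F y ≤ ballSmooth r F x := by
  have h : ∫ _, (⨅ y, F y) ∂(ballUniform d) ≤ ∫ v, F (x + r • v) ∂(ballUniform d) :=
    integral_mono (integrable_const _) (integrable_ballUniform hL hr x) fun v => ciInf_le hF _
  simpa [ballSmooth] using h

theorem measurePreserving_neg_ballUniform (d : ℕ) :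
    MeasurePreserving (fun v : Vec d => -v) (ballUniform d) (ballUniform d) := by
  refine MeasurePreserving.smul_measure ?_ _
  have h := (Measure.measurePreserving_neg (volume : Measure (Vec d))).restrict_preimage
    (s := Metric.ball 0 1) measurableSet_ball
  have h2 : Neg.neg ⁻¹' (Metric.ball (0 : Vec d) 1) = Metric.ball 0 1 := by ext; simp
  rwa [h2] at h

theorem lipschitzWith_comp_smul (hL : LipschitzWith L F) (x : Vec d) (r : ℝ) :
    LipschitzWith (L * ‖r‖₊) fun u => F (x + r • u) := by
  refine LipschitzWith.of_dist_le_mul fun u v => (hL.dist_le_mul _ _).trans ?_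
  rw [dist_add_left, dist_smul₀, NNReal.coe_mul, coe_nnnorm, mul_assoc]

theorem gradient_comp_smul (hd : Differentiable ℝ F) (x : Vec d) (r : ℝ) (u : Vec d) :
    gradient (fun u => F (x + r • u)) u = r • gradient F (x + r • u) := by
  have h1 : HasFDerivAt (fun u : Vec d => x + r • u) (r • ContinuousLinearMap.id ℝ (Vec d)) u :=
    ((hasFDerivAt_id u).const_smul r).const_add x
  have h2 := (hd (x + r • u)).hasFDerivAt.comp u h1
  have h3 : fderiv ℝ (fun u => F (x + r • u)) u = r • fderiv ℝ F (x + r • u) := by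
    refine h2.fderiv.trans ?_
    ext e
    simp
  rw [gradient, h3, map_smulₛₗ]
  rfl

variable [NeZero d]

/-- Stokes' theorem on a ball of radius `r`. -/
theorem integral_smul_sphereUniform_add (hd : Differentiable ℝ F) (hL : LipschitzWith L F)
    {r : ℝ} (hr : 0 ≤ r) (x : Vec d) :
    (d : ℝ) • ∫ u, F (x + r • u) • u ∂(sphereUniform d) = r • gradient (ballSmooth r F) x := by
  rw [integral_smul_sphereUniform (G := fun u => F (x + r • u)) (by fun_prop)
    (lipschitzWith_comp_smul hL x r), gradient_ballSmooth hd hL hr]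
  simp_rw [gradient_comp_smul hd]
  rw [integral_smul]

/-- This is Stokes' theorem with radius `-r`, combined with the symmetry of the uniform law on the
ball. -/
theorem integral_smul_sphereUniform_sub (hd : Differentiable ℝ F) (hL : LipschitzWith L F)
    {r : ℝ} (hr : 0 ≤ r) (x : Vec d) :
    (d : ℝ) • ∫ u, F (x - r • u) • u ∂(sphereUniform d) = -(r • gradient (ballSmooth r F) x) := by
  have h := integral_smul_sphereUniform (G := fun u => F (x + (-r) • u)) (by fun_prop)
    (lipschitzWith_comp_smul hL x (-r))
  simp_rw [gradient_comp_smul hd] at h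
  rw [integral_smul] at h
  simp only [neg_smul, ← sub_eq_add_neg] at h
  rw [h, gradient_ballSmooth hd hL hr, ← (measurePreserving_neg_ballUniform d).integral_comp
    (MeasurableEquiv.neg (Vec d)).measurableEmbedding]
  simp [sub_eq_add_neg]

end Smoothing

/-! ### The Goldstein norm -/

section Goldstein

variable {d : ℕ} {F : Vec d → ℝ} {L : NNReal} {δ : ℝ}

theorem goldsteinNorm_nonneg (F : Vec d → ℝ) (δ : ℝ) (x : Vec d) : 0 ≤ goldsteinNorm F δ x :=
  Real.sInf_nonneg (by rintro _ ⟨g, -, rfl⟩; exact norm_nonneg g)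

theorem goldsteinNorm_le_of_mem {x g : Vec d} (hg : g ∈ goldsteinSubdiff F δ x) :
    goldsteinNorm F δ x ≤ ‖g‖ :=
  csInf_le ⟨0, by rintro _ ⟨g, -, rfl⟩; exact norm_nonneg g⟩ ⟨g, hg, rfl⟩

theorem goldsteinNorm_le_of_mem_closure {x g : Vec d} (hg : g ∈ closure (goldsteinSubdiff F δ x)) :
    goldsteinNorm F δ x ≤ ‖g‖ :=
  closure_minimal (t := {g | goldsteinNorm F δ x ≤ ‖g‖}) (fun _ h => goldsteinNorm_le_of_mem h)
    (isClosed_le continuous_const continuous_norm) hg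

theorem gradient_mem_goldsteinSubdiff {x y : Vec d} (hy : y ∈ Metric.ball x δ) :
    gradient F y ∈ goldsteinSubdiff F δ x :=
  subset_convexHull ℝ _ ⟨y, hy, rfl⟩

theorem goldsteinNorm_le (hL : LipschitzWith L F) (hδ : 0 < δ) (x : Vec d) :
    goldsteinNorm F δ x ≤ L :=
  (goldsteinNorm_le_of_mem (gradient_mem_goldsteinSubdiff (Metric.mem_ball_self hδ))).trans
    (norm_gradient_le hL x)

/-- A convex combination involves finitely many points of an open ball, and these stay in the ball
when its center moves slightly. So a nearly optimal element at `x` remains available nearby;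
measurability of the Goldstein norm follows without any continuity of the gradient. -/
theorem upperSemicontinuous_goldsteinNorm (hδ : 0 < δ) :
    UpperSemicontinuous (goldsteinNorm F δ) := by
  intro x c hc
  have hne : ((fun g => ‖g‖) '' goldsteinSubdiff F δ x).Nonempty :=
    ⟨_, _, gradient_mem_goldsteinSubdiff (Metric.mem_ball_self hδ), rfl⟩
  obtain ⟨_, ⟨g, hg, rfl⟩, hgc⟩ := exists_lt_of_csInf_lt hne hc
  rw [goldsteinSubdiff, convexHull_eq_union_convexHull_finite_subsets] at hg
  simp only [Set.mem_iUnion] at hg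
  obtain ⟨t, ht, hg⟩ := hg
  have hy : ∀ g ∈ t, ∃ y ∈ Metric.ball x δ, gradient F y = g := fun g hg => ht hg
  choose! y hyb hyg using hy
  have hev : ∀ᶠ x' in 𝓝 x, ∀ g ∈ t, y g ∈ Metric.ball x' δ := by
    refine (Finset.eventually_all t).2 fun g hg => ?_
    filter_upwards [Metric.isOpen_ball.mem_nhds (Metric.mem_ball_comm.1 (hyb g hg))] with x' hx'
    exact Metric.mem_ball_comm.1 hx'
  filter_upwards [hev] with x' hx'
  refine (goldsteinNorm_le_of_mem ?_).trans_lt hgc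
  refine convexHull_mono (fun g hg => ?_) hg
  exact ⟨y g, hx' g hg, hyg g hg⟩

theorem measurable_goldsteinNorm (hδ : 0 < δ) : Measurable (goldsteinNorm F δ) :=
  (upperSemicontinuous_goldsteinNorm hδ).measurable

/-- An average of gradients of the smoothed function at nearby points bounds the Goldstein norm. -/
theorem goldsteinNorm_le_norm_average (hd : Differentiable ℝ F) (hL : LipschitzWith L F) {r : ℝ}
    (hr : 0 < r) (hrδ : 2 * r ≤ δ) {T : ℕ} (hT : 0 < T) (w : ℕ → Vec d) (x : Vec d)
    (hw : ∀ n < T, ‖w n - x‖ ≤ r) :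
    goldsteinNorm F δ x ≤ ‖(T : ℝ)⁻¹ • ∑ n ∈ Finset.range T, gradient (ballSmooth r F) (w n)‖ := by
  have hT' : (T : ℝ) ≠ 0 := by exact_mod_cast hT.ne'
  -- An integral of gradients is only known to lie in the closed convex hull; passing to the closure
  -- does not lower the infimum of the norms.
  have hconv : Convex ℝ (closure (goldsteinSubdiff F δ x)) := (convex_convexHull ℝ _).closure
  refine goldsteinNorm_le_of_mem_closure ?_
  rw [Finset.smul_sum]
  refine hconv.sum_mem (fun _ _ => by positivity) (by simp [hT']) fun n hn => ?_
  rw [gradient_ballSmooth hd hL hr.le]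
  refine hconv.integral_mem isClosed_closure ?_ (integrable_gradient hL (by fun_prop))
  filter_upwards [ballUniform_ae_norm_lt] with v hv
  refine subset_closure (gradient_mem_goldsteinSubdiff ?_)
  rw [mem_ball_iff_norm]
  have h1 : ‖r • v‖ < r := by
    rw [norm_smul, Real.norm_of_nonneg hr.le]
    exact mul_lt_of_lt_one_right hr hv
  calc ‖w n + r • v - x‖ = ‖(w n - x) + r • v‖ := by congr 1; abel
    _ ≤ ‖w n - x‖ + ‖r • v‖ := norm_add_le _ _
    _ < r + r := add_lt_add_of_le_of_lt (hw n (Finset.mem_range.1 hn)) h1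
    _ ≤ δ := by linarith

end Goldstein

/-! ### The error of the estimate at one data point -/

theorem integral_norm_sq_le_of_bound {Ω E : Type*} [MeasurableSpace Ω] [NormedAddCommGroup E]
    {μ : Measure Ω} [IsProbabilityMeasure μ] {X : Ω → E} {C : ℝ} (h : ∀ᵐ ω ∂μ, ‖X ω‖ ≤ C) :
    ∫ ω, ‖X ω‖ ^ 2 ∂μ ≤ C ^ 2 := by
  refine (integral_mono_of_nonneg (Eventually.of_forall fun ω => by positivity)
    (integrable_const (C ^ 2)) ?_).trans (by simp)
  filter_upwards [h] with ω hω
  exact pow_le_pow_left₀ (norm_nonneg _) hω 2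

section Point

variable {d M : ℕ} {Z : Type*} [MeasurableSpace Z] {P : Measure Z} [IsProbabilityMeasure P]
  {c : Params} [NeZero d] [NeZero c.K]

/-- The joint law of the dataset and the random draws. -/
abbrev runLaw (d M : ℕ) (P : Measure Z) (c : Params) : Measure ((Fin M → Z) × Tape d c.K) :=
  (Measure.pi fun _ : Fin M => P).prod (tapeLaw d c)

/-- Replace the data point number `n`. -/
def updateData (n : Fin M) (q : (Fin M → Z) × Tape d c.K) (z : Z) : (Fin M → Z) × Tape d c.K :=
  (Function.update q.1 n z, q.2)

theorem resample_updateData (n : Fin M) : Resample (runLaw d M P c) (updateData n) P :=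
  Resample.fst (resample_update_pi (fun _ : Fin M => P) n)

theorem resample_runLaw {Y : Type*} [MeasurableSpace Y] {ν : Measure Y} [SFinite ν]
    {m : Tape d c.K → Y → Tape d c.K} (h : Resample (tapeLaw d c) m ν) :
    Resample (runLaw d M P c) (fun q y => (q.1, m q.2 y)) ν :=
  Resample.snd h

theorem ae_runLaw {p : Tape d c.K → Prop} (h : ∀ᵐ ω ∂(tapeLaw d c), p ω) :
    ∀ᵐ q ∂(runLaw d M P c), p q.2 :=
  measurePreserving_snd.quasiMeasurePreserving.ae h

variable {Y : Type*} [MeasurableSpace Y] {φ : Y → Vec d → Z → ℝ} {b : Y → ℝ}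

/-- The mean over the direction of the estimate at a data point. -/
def dirMean (φ : Y → Vec d → Z → ℝ) (y : Y) (z : Z) : Vec d := ∫ u, φ y u z • u ∂(sphereUniform d)

/-- The mean over the direction and the data point. -/
def dataMean (P : Measure Z) (φ : Y → Vec d → Z → ℝ) (y : Y) : Vec d := ∫ z, dirMean φ y z ∂P

/-- The estimate at one data point, with the average over `d` directions. -/
def pointEst (φ : Y → Vec d → Z → ℝ) (y : Y) (u : Fin d → Vec d) (z : Z) : Vec d :=
  (d : ℝ)⁻¹ • ∑ j, φ y (u j) z • u j

theorem measurable_dirMean (hφ : Measurable fun p : (Y × Z) × Vec d => φ p.1.1 p.2 p.1.2) :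
    Measurable fun p : Y × Z => dirMean φ p.1 p.2 := by
  have h : StronglyMeasurable fun p : (Y × Z) × Vec d => φ p.1.1 p.2 p.1.2 • p.2 :=
    (hφ.smul measurable_snd).stronglyMeasurable
  exact h.integral_prod_right.measurable

theorem measurable_dataMean (hφ : Measurable fun p : (Y × Z) × Vec d => φ p.1.1 p.2 p.1.2) :
    Measurable (dataMean P φ) :=
  (measurable_dirMean hφ).stronglyMeasurable.integral_prod_right.measurable

/-- The error at a data point splits into the fluctuation of the data point, after averaging over
directions, and one fluctuation per direction. Each piece is centered under the redraw of its own
variable. -/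
theorem add_pointEst_sub (a : Vec d) (y : Y) (u : Fin d → Vec d) (z : Z) :
    a + (pointEst φ y u z - dataMean P φ y) = (a + (dirMean φ y z - dataMean P φ y)) +
      ∑ j, (d : ℝ)⁻¹ • (φ y (u j) z • u j - dirMean φ y z) := by
  have hd0 : (d : ℝ) ≠ 0 := by exact_mod_cast NeZero.ne d
  rw [← Finset.smul_sum, Finset.sum_sub_distrib, Finset.sum_const, Finset.card_univ,
    Fintype.card_fin, smul_sub, ← Nat.cast_smul_eq_nsmul ℝ, smul_smul, inv_mul_cancel₀ hd0, one_smul,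
    pointEst]
  abel

section Bounds

variable (hφ : Measurable fun p : (Y × Z) × Vec d => φ p.1.1 p.2 p.1.2)
  (hb : ∀ y u z, ‖u‖ = 1 → |φ y u z| ≤ b y)

include hφ hb

/-- Averaging over directions first gains `√d`. Redrawing the data point then has variance of order
`B²/d` instead of `B²`, which matches the variance left by `d` independent directions. -/
theorem norm_dirMean_le (y : Y) (z : Z) : ‖dirMean φ y z‖ ≤ b y / √d := by
  have hd0 : (0 : ℝ) < d := by exact_mod_cast NeZero.pos d
  have hae : ∀ᵐ u ∂(sphereUniform d), |φ y u z| ≤ b y := by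
    filter_upwards [sphereUniform_norm_eq] with u hu using hb y u z hu
  have hb0 : 0 ≤ b y := by
    obtain ⟨u, hu⟩ := hae.exists
    exact (abs_nonneg _).trans hu
  have hm : Measurable fun u => φ y u z := by
    have h := hφ.comp (measurable_prodMk_left (x := (y, z)))
    exact h
  have h := norm_sq_integral_smul_sphereUniform_le hm hae
  refine abs_le_of_sq_le_sq' ?_ (by positivity) |>.2
  rwa [div_pow, Real.sq_sqrt hd0.le]

theorem norm_dataMean_le (y : Y) : ‖dataMean P φ y‖ ≤ b y / √d := by
  have h := norm_integral_le_of_norm_le_const (μ := P) (f := fun z => dirMean φ y z)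
    (Eventually.of_forall fun z => norm_dirMean_le hφ hb y z)
  simpa [dataMean] using h

theorem integrable_dirMean (y : Y) : Integrable (dirMean φ y) P :=
  Integrable.of_bound ((measurable_dirMean hφ).comp measurable_prodMk_left).aestronglyMeasurable _
    (Eventually.of_forall fun z => norm_dirMean_le hφ hb y z)

theorem integrable_smul_dir (y : Y) (z : Z) :
    Integrable (fun u => φ y u z • u) (sphereUniform d) := by
  have hm : Measurable fun u => φ y u z := by
    have h := hφ.comp (measurable_prodMk_left (x := (y, z)))
    exact h
  refine Integrable.of_bound (C := b y) (hm.smul measurable_id).aestronglyMeasurable ?_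
  filter_upwards [sphereUniform_norm_eq] with u hu
  rw [norm_smul, hu, mul_one]
  exact hb y u z hu

variable {p : (Fin M → Z) × Tape d c.K → Y} (hp : Measurable p) {B : ℝ}
  (hB : ∀ᵐ q ∂(runLaw d M P c), b (p q) ≤ B) {n : Fin M}
  (hpZ : ∀ q z, p (updateData n q z) = p q)
  (hpU : ∀ (q : (Fin M → Z) × Tape d c.K) j u, p (q.1, updateDir (n, j) q.2 u) = p q)
  {A : (Fin M → Z) × Tape d c.K → Vec d} (hA : MemLp A 2 (runLaw d M P c))
  (hAZ : ∀ q z, A (updateData n q z) = A q)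
  (hAU : ∀ (q : (Fin M → Z) × Tape d c.K) j u, A (q.1, updateDir (n, j) q.2 u) = A q)

include hp hB

theorem memLp_dirMean_sub : MemLp (fun q => dirMean φ (p q) (q.1 n) - dataMean P φ (p q)) 2
    (runLaw d M P c) := by
  have h0 : Measurable fun q : (Fin M → Z) × Tape d c.K => (p q, q.1 n) :=
    hp.prodMk ((measurable_pi_apply n).comp measurable_fst)
  have h1 := (measurable_dirMean hφ).comp h0
  have h2 := (measurable_dataMean (P := P) hφ).comp hp
  refine MemLp.of_bound (h1.sub h2).aestronglyMeasurable (B / √d + B / √d) ?_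
  filter_upwards [hB] with q hq
  refine (norm_sub_le _ _).trans (add_le_add ?_ ?_)
  · exact (norm_dirMean_le hφ hb _ _).trans (by gcongr)
  · exact (norm_dataMean_le hφ hb _).trans (by gcongr)

omit hB hb in
theorem measurable_dirTerm (j : Fin d) :
    Measurable fun q : (Fin M → Z) × Tape d c.K => (d : ℝ)⁻¹ •
      (φ (p q) (q.2.2.2.1 (n, j)) (q.1 n) • q.2.2.2.1 (n, j) - dirMean φ (p q) (q.1 n)) := by
  have h0 : Measurable fun q : (Fin M → Z) × Tape d c.K => (p q, q.1 n) :=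
    hp.prodMk ((measurable_pi_apply n).comp measurable_fst)
  have h1 := (measurable_dirMean hφ).comp h0
  have hu : Measurable fun q : (Fin M → Z) × Tape d c.K => q.2.2.2.1 ((n : ℕ), j) := by fun_prop
  have h3 := hφ.comp (h0.prodMk hu)
  exact ((h3.smul hu).sub h1).const_smul ((d : ℝ)⁻¹)

omit hp hB in
theorem norm_dirTerm_le (y : Y) (hy : b y ≤ B) {u : Vec d} (hu : ‖u‖ = 1) (z : Z) :
    ‖(d : ℝ)⁻¹ • (φ y u z • u - dirMean φ y z)‖ ≤ 2 * B / d := by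
  have hd1 : (1 : ℝ) ≤ √d := by
    rw [Real.one_le_sqrt]; exact_mod_cast NeZero.one_le
  have h1 := (hb y u z hu).trans hy
  have hB0 : 0 ≤ B := (abs_nonneg _).trans h1
  rw [norm_smul, Real.norm_of_nonneg (by positivity), div_eq_inv_mul, two_mul]
  gcongr
  refine (norm_sub_le _ _).trans (add_le_add ?_ ?_)
  · rwa [norm_smul, hu, mul_one]
  · refine (norm_dirMean_le hφ hb y z).trans ?_
    rw [div_le_iff₀ (by positivity)]
    exact hy.trans (le_mul_of_one_le_right hB0 hd1)

theorem memLp_dirTerm (j : Fin d) :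
    MemLp (fun q : (Fin M → Z) × Tape d c.K => (d : ℝ)⁻¹ •
      (φ (p q) (q.2.2.2.1 (n, j)) (q.1 n) • q.2.2.2.1 (n, j) - dirMean φ (p q) (q.1 n))) 2
    (runLaw d M P c) := by
  refine MemLp.of_bound (measurable_dirTerm hφ hp j).aestronglyMeasurable (2 * B / d) ?_
  filter_upwards [hB, ae_runLaw tapeLaw_ae_dir] with q hq hq2
  exact norm_dirTerm_le hφ hb _ hq (hq2 _) _

include hA hpZ hAZ in
theorem integral_norm_add_dirMean_sub_sq_le :
    ∫ q, ‖A q + (dirMean φ (p q) (q.1 n) - dataMean P φ (p q))‖ ^ 2 ∂(runLaw d M P c) ≤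
      ∫ q, ‖A q‖ ^ 2 ∂(runLaw d M P c) + 4 * B ^ 2 / d := by
  have hd0 : (0 : ℝ) < d := by exact_mod_cast NeZero.pos d
  have hz : ∀ (q : (Fin M → Z) × Tape d c.K) z, (updateData n q z).1 n = z := fun q z => by simp [updateData]
  refine (resample_updateData n).integral_norm_add_sq_le hA
    (memLp_dirMean_sub hφ hb hp hB) hAZ (fun q => ?_) ?_
  · simp only [hpZ, hz]
    rw [integral_sub (integrable_dirMean hφ hb _) (integrable_const _), integral_const,
      probReal_univ, one_smul]
    exact sub_self _
  · filter_upwards [hB] with q hq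
    simp only [hpZ, hz]
    have h := integral_norm_sq_le_of_bound (μ := P)
      (X := fun z => dirMean φ (p q) z - dataMean P φ (p q)) (C := B / √d + B / √d)
      (Eventually.of_forall fun z => (norm_sub_le _ _).trans (add_le_add
        ((norm_dirMean_le hφ hb _ _).trans (by gcongr))
        ((norm_dataMean_le hφ hb _).trans (by gcongr))))
    refine h.trans_eq ?_
    rw [← two_mul, mul_pow, div_pow, Real.sq_sqrt hd0.le]
    ring

include hA hpU hAU in
-- The directions are redrawn one at a time and contribute orthogonally, so all `d` of them cost `d
-- (2B/d)² = 4B²/d`.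
theorem integral_norm_add_sum_dirTerm_sq_le (s : Finset (Fin d)) :
    ∫ q, ‖A q + ∑ j ∈ s, (d : ℝ)⁻¹ • (φ (p q) (q.2.2.2.1 (n, j)) (q.1 n) • q.2.2.2.1 (n, j) -
        dirMean φ (p q) (q.1 n))‖ ^ 2 ∂(runLaw d M P c) ≤
      ∫ q, ‖A q‖ ^ 2 ∂(runLaw d M P c) + s.card * (2 * B / d) ^ 2 := by
  induction s using Finset.induction_on with
  | empty => simp
  | insert i s hi ih =>
    have hAs : MemLp (fun q => A q + ∑ j ∈ s, (d : ℝ)⁻¹ •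
        (φ (p q) (q.2.2.2.1 (n, j)) (q.1 n) • q.2.2.2.1 (n, j) - dirMean φ (p q) (q.1 n))) 2
        (runLaw d M P c) := hA.add (memLp_finsetSum s fun j _ => memLp_dirTerm hφ hb hp hB j)
    have h := (resample_runLaw (P := P) (M := M)
      (resample_updateDir ((n : ℕ), i))).integral_norm_add_sq_le
      (c := (2 * B / d) ^ 2) hAs
      (memLp_dirTerm hφ hb hp hB (n := n) i) (fun q u => ?_) (fun q => ?_) ?_
    · rw [Finset.card_insert_of_notMem hi, Nat.cast_succ, add_mul, one_mul, ← add_assoc]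
      refine le_trans (le_of_eq ?_) (h.trans (by linarith))
      congr 1
      funext q
      rw [Finset.sum_insert hi, add_assoc, add_comm (Finset.sum _ _)]
    · simp only [hpU, hAU]
      congr 1
      refine Finset.sum_congr rfl fun j hj => ?_
      have hne : ((n : ℕ), j) ≠ ((n : ℕ), i) := fun h => hi (by rwa [← (Prod.mk.inj h).2])
      simp only [updateDir, Function.update_of_ne hne]
    · simp only [updateDir, Function.update_self]
      have hpU' : ∀ u, p (q.1, q.2.1, q.2.2.1, Function.update q.2.2.2.1 ((n : ℕ), i) u, q.2.2.2.2)
        = p q := fun u => hpU q i u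
      simp only [hpU']
      rw [integral_smul, integral_sub (integrable_smul_dir hφ hb _ _) (integrable_const _),
        integral_const, probReal_univ, one_smul]
      simp [dirMean]
    · filter_upwards [hB] with q hq
      have hpU' : ∀ u, p (q.1, q.2.1, q.2.2.1, Function.update q.2.2.2.1 ((n : ℕ), i) u, q.2.2.2.2)
        = p q := fun u => hpU q i u
      simp only [updateDir, Function.update_self, hpU']
      refine integral_norm_sq_le_of_bound ?_
      filter_upwards [sphereUniform_norm_eq] with u hu
      exact norm_dirTerm_le hφ hb _ hq hu _

include hA in
theorem memLp_add_pointEst_sub :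
    MemLp (fun q : (Fin M → Z) × Tape d c.K => A q +
      (pointEst φ (p q) (fun j => q.2.2.2.1 (n, j)) (q.1 n) - dataMean P φ (p q))) 2
      (runLaw d M P c) := by
  simp only [add_pointEst_sub]
  exact (hA.add (memLp_dirMean_sub hφ hb hp hB)).add
    (memLp_finsetSum _ fun j _ => memLp_dirTerm hφ hb hp hB j)

include hA hpZ hAZ hpU hAU in
/-- The contribution of one data point to the mean square error. -/
theorem integral_norm_add_pointEst_sub_sq_le :
    ∫ q, ‖A q + (pointEst φ (p q) (fun j => q.2.2.2.1 (n, j)) (q.1 n) - dataMean P φ (p q))‖ ^ 2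
        ∂(runLaw d M P c) ≤ ∫ q, ‖A q‖ ^ 2 ∂(runLaw d M P c) + 8 * B ^ 2 / d := by
  have hd0 : (0 : ℝ) < d := by exact_mod_cast NeZero.pos d
  simp only [add_pointEst_sub]
  have h1 := integral_norm_add_dirMean_sub_sq_le hφ hb hp hB hpZ hA hAZ
  have h2 := integral_norm_add_sum_dirTerm_sq_le hφ hb hp hB hpU
    (A := fun q => A q + (dirMean φ (p q) (q.1 n) - dataMean P φ (p q)))
    (hA.add (memLp_dirMean_sub hφ hb hp hB)) (fun q j u => by simp only [hAU, hpU]) Finset.univ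
  refine h2.trans ((add_le_add_left h1 _).trans_eq ?_)
  rw [Finset.card_univ, Fintype.card_fin]
  field_simp
  ring

end Bounds

end Point

/-! ### The error of the estimates of the algorithm -/

section MeanLoss

variable {d : ℕ} {Z : Type*} [MeasurableSpace Z] {P : Measure Z} [IsProbabilityMeasure P]
  {f : Vec d → Z → ℝ} {L : NNReal} [NeZero d]

/-- The population loss. -/
def meanLoss (P : Measure Z) (f : Vec d → Z → ℝ) (x : Vec d) : ℝ := ∫ z, f x z ∂P

/-- The summand of a data point in `gradEst`. -/
def gradPoint (f : Vec d → Z → ℝ) (δ : ℝ) (b : ℕ) (y : Vec d × Vec d) (u : Vec d) (z : Z) : ℝ :=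
  (b : ℝ)⁻¹ * ((d : ℝ) / (2 * δ) * (f (y.1 + δ • u) z - f (y.1 - δ • u) z))

/-- The summand of a data point in `diffEst`. -/
def diffPoint (f : Vec d → Z → ℝ) (δ : ℝ) (y : Vec d × Vec d) (u : Vec d) (z : Z) : ℝ :=
  (d : ℝ) / δ * (f (y.1 + δ • u) z - f (y.2 + δ • u) z)

variable (hm : Measurable fun p : Vec d × Z => f p.1 p.2) (hi : ∀ x, Integrable (f x) P)
  (hd : ∀ z, Differentiable ℝ fun x => f x z) (hL : ∀ z, LipschitzWith L fun x => f x z)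

include hm in
theorem measurable_gradPoint (δ : ℝ) (b : ℕ) :
    Measurable fun p : ((Vec d × Vec d) × Z) × Vec d => gradPoint f δ b p.1.1 p.2 p.1.2 := by
  unfold gradPoint
  have h1 : Measurable fun p : ((Vec d × Vec d) × Z) × Vec d => f (p.1.1.1 + δ • p.2) p.1.2 :=
    hm.comp (by fun_prop : Measurable fun p : ((Vec d × Vec d) × Z) × Vec d =>
      (p.1.1.1 + δ • p.2, p.1.2))
  have h2 : Measurable fun p : ((Vec d × Vec d) × Z) × Vec d => f (p.1.1.1 - δ • p.2) p.1.2 :=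
    hm.comp (by fun_prop : Measurable fun p : ((Vec d × Vec d) × Z) × Vec d =>
      (p.1.1.1 - δ • p.2, p.1.2))
  exact ((h1.sub h2).const_mul _).const_mul _

include hm in
theorem measurable_diffPoint (δ : ℝ) :
    Measurable fun p : ((Vec d × Vec d) × Z) × Vec d => diffPoint f δ p.1.1 p.2 p.1.2 := by
  unfold diffPoint
  have h1 : Measurable fun p : ((Vec d × Vec d) × Z) × Vec d => f (p.1.1.1 + δ • p.2) p.1.2 :=
    hm.comp (by fun_prop : Measurable fun p : ((Vec d × Vec d) × Z) × Vec d =>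
      (p.1.1.1 + δ • p.2, p.1.2))
  have h2 : Measurable fun p : ((Vec d × Vec d) × Z) × Vec d => f (p.1.1.2 + δ • p.2) p.1.2 :=
    hm.comp (by fun_prop : Measurable fun p : ((Vec d × Vec d) × Z) × Vec d =>
      (p.1.1.2 + δ • p.2, p.1.2))
  exact (h1.sub h2).const_mul _

include hL in
theorem abs_sub_le_of_lipschitz (z : Z) (x y : Vec d) : |f x z - f y z| ≤ L * ‖x - y‖ := by
  have h := (hL z).dist_le_mul x y
  rwa [Real.dist_eq, dist_eq_norm] at h

include hL in
theorem abs_gradPoint_le {δ : ℝ} (hδ : 0 < δ) (b : ℕ) (y : Vec d × Vec d) {u : Vec d}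
    (hu : ‖u‖ = 1) (z : Z) : |gradPoint f δ b y u z| ≤ (b : ℝ)⁻¹ * (d * L) := by
  rw [gradPoint, abs_mul, abs_of_nonneg (by positivity)]
  exact mul_le_mul_of_nonneg_left
    (abs_gradTerm_le hδ (v := fun x => f x z) (abs_sub_le_of_lipschitz hL z) hu y.1) (by positivity)

include hL in
theorem abs_diffPoint_le {δ : ℝ} (hδ : 0 < δ) (y : Vec d × Vec d) (u : Vec d) (z : Z) :
    |diffPoint f δ y u z| ≤ d / δ * (L * ‖y.1 - y.2‖) :=
  abs_diffTerm_le hδ (v := fun x => f x z) (abs_sub_le_of_lipschitz hL z) u y.1 y.2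

include hi hL in
theorem lipschitzWith_meanLoss : LipschitzWith L (meanLoss P f) := lipschitzWith_integral hi hL

include hm hi hd hL in
theorem differentiable_meanLoss : Differentiable ℝ (meanLoss P f) := fun x =>
  (hasGradientAt_integral (g := f) (ν := P) (fun _ => hm.comp measurable_prodMk_left) hi hd hL
    x).differentiableAt

theorem integrable_smul_sphereUniform {F : Vec d → ℝ} (hF : LipschitzWith L F) (x : Vec d) (a : ℝ) :
    Integrable (fun u => F (x + a • u) • u) (sphereUniform d) := by
  have hc := hF.continuous
  refine Integrable.of_bound (C := |F x| + L * |a|)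
    (by fun_prop : Continuous fun u : Vec d => F (x + a • u) • u).aestronglyMeasurable ?_
  filter_upwards [sphereUniform_norm_eq] with u hu
  have h := hF.dist_le_mul (x + a • u) x
  rw [Real.dist_eq, dist_eq_norm, add_sub_cancel_left, norm_smul, hu, mul_one] at h
  rw [norm_smul, hu, mul_one, Real.norm_eq_abs]
  have h2 := abs_sub_abs_le_abs_sub (F (x + a • u)) (F x)
  rw [Real.norm_eq_abs] at h
  linarith

include hm hi hL in
-- Fubini is applied to the whole difference: it is bounded uniformly by the Lipschitz property,
-- while the separate terms are only known to be integrable in `z`.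
theorem integral_integral_sub_smul (x x' : Vec d) (a a' : ℝ) :
    ∫ z, ∫ u, (f (x + a • u) z - f (x' + a' • u) z) • u ∂(sphereUniform d) ∂P =
      ∫ u, meanLoss P f (x + a • u) • u ∂(sphereUniform d) -
        ∫ u, meanLoss P f (x' + a' • u) • u ∂(sphereUniform d) := by
  have hLm := lipschitzWith_meanLoss hi hL
  rw [integral_integral_swap, ← integral_sub (integrable_smul_sphereUniform hLm _ _)
    (integrable_smul_sphereUniform hLm _ _)]
  · refine integral_congr_ae (Eventually.of_forall fun u => ?_)
    simp only
    rw [integral_smul_const, integral_sub (hi _) (hi _), sub_smul]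
    rfl
  · have h1 : Measurable fun p : Z × Vec d => f (x + a • p.2) p.1 :=
      hm.comp (by fun_prop : Measurable fun p : Z × Vec d => (x + a • p.2, p.1))
    have h2 : Measurable fun p : Z × Vec d => f (x' + a' • p.2) p.1 :=
      hm.comp (by fun_prop : Measurable fun p : Z × Vec d => (x' + a' • p.2, p.1))
    refine Integrable.of_bound (C := L * (‖x - x'‖ + |a - a'|))
      ((h1.sub h2).smul measurable_snd).aestronglyMeasurable ?_
    have hs : ∀ᵐ p ∂(P.prod (sphereUniform d)), ‖p.2‖ = 1 :=
      measurePreserving_snd.quasiMeasurePreserving.ae sphereUniform_norm_eq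
    filter_upwards [hs] with p hp
    simp only [Function.uncurry_def]
    rw [norm_smul, hp, mul_one]
    refine (abs_sub_le_of_lipschitz hL _ _ _).trans (mul_le_mul_of_nonneg_left ?_ L.2)
    have h3 : x + a • p.2 - (x' + a' • p.2) = (x - x') + (a - a') • p.2 := by
      rw [sub_smul]; abel
    rw [h3]
    refine (norm_add_le _ _).trans ?_
    rw [norm_smul, hp, mul_one, Real.norm_eq_abs]

include hm hi hd hL in
theorem dataMean_diffPoint {δ : ℝ} (hδ : 0 < δ) (y : Vec d × Vec d) :
    dataMean P (diffPoint f δ) y = gradient (ballSmooth δ (meanLoss P f)) y.1 -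
      gradient (ballSmooth δ (meanLoss P f)) y.2 := by
  have hLm := lipschitzWith_meanLoss hi hL
  have hdm := differentiable_meanLoss hm hi hd hL
  have h := integral_integral_sub_smul hm hi hL y.1 y.2 δ δ
  unfold dataMean dirMean diffPoint
  simp only [mul_smul, integral_smul]
  rw [h, div_eq_inv_mul, mul_smul, smul_sub, integral_smul_sphereUniform_add hdm hLm hδ.le,
    integral_smul_sphereUniform_add hdm hLm hδ.le, ← smul_sub, smul_smul, inv_mul_cancel₀ hδ.ne',
    one_smul]

include hm hi hd hL in
theorem dataMean_gradPoint {δ : ℝ} (hδ : 0 < δ) (b : ℕ) (y : Vec d × Vec d) :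
    dataMean P (gradPoint f δ b) y =
      (b : ℝ)⁻¹ • gradient (ballSmooth δ (meanLoss P f)) y.1 := by
  have hLm := lipschitzWith_meanLoss hi hL
  have hdm := differentiable_meanLoss hm hi hd hL
  -- The antipodal evaluation is treated as radius `-δ`; the two evaluations contribute equally,
  -- which explains the factor `1 / (2 * δ)` of the estimator.
  have h := integral_integral_sub_smul hm hi hL y.1 y.1 δ (-δ)
  simp only [neg_smul, ← sub_eq_add_neg] at h
  unfold dataMean dirMean gradPoint
  simp only [mul_smul, integral_smul]
  rw [h, div_eq_inv_mul, mul_smul, smul_sub, integral_smul_sphereUniform_add hdm hLm hδ.le,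
    integral_smul_sphereUniform_sub hdm hLm hδ.le, sub_neg_eq_add, ← two_smul ℝ, smul_smul,
    smul_smul, smul_smul]
  congr 1
  field_simp

end MeanLoss

/-! ### Which draws the states of the run depend on. -/

section Error

variable {d M : ℕ} {Z : Type*} {c : Params} {f : Vec d → Z → ℝ} {x₁ : Vec d}

/-- The state of round `n + 1` of epoch `k` of the run. -/
def runState (c : Params) (f : Vec d → Z → ℝ) (x₁ : Vec d) (k n : ℕ)
    (q : (Fin M → Z) × Tape d c.K) : RoundState d :=
  epochState c f q.1 q.2 k (epochStart c f x₁ q.1 q.2 k) n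

theorem dataLoss_update (S : Fin M → Z) {N : Fin M} (z : Z) {n : ℕ} (h : n ≠ N) :
    dataLoss f (Function.update S N z) n = dataLoss f S n := by
  unfold dataLoss
  funext x
  split_ifs with hn
  · rw [Function.update_of_ne]
    intro h2
    exact h (by rw [← h2])
  · rfl

theorem epochStart_updateData {k : ℕ} {N : Fin M} (hN : k * c.epochSize ≤ N)
    (q : (Fin M → Z) × Tape d c.K) (z : Z) :
    epochStart c f x₁ (updateData N q z).1 (updateData N q z).2 k = epochStart c f x₁ q.1 q.2 k :=
  epochStart_congr k (fun n hn => dataLoss_update _ _ (by omega)) (fun _ _ _ => rfl)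
    (fun _ _ _ => rfl) (fun _ _ _ => rfl)

theorem epochStart_updateDir {k N : ℕ} (hN : k * c.epochSize ≤ N)
    (q : (Fin M → Z) × Tape d c.K) (j : Fin d) (u : Vec d) :
    epochStart c f x₁ q.1 (updateDir (N, j) q.2 u) k = epochStart c f x₁ q.1 q.2 k :=
  epochStart_congr k (fun _ _ => rfl)
    (fun n hn j' => Function.update_of_ne (fun h => by have := (Prod.mk.inj h).1; omega) _ _)
    (fun _ _ _ => rfl) (fun _ _ _ => rfl)

theorem epochStart_updateInterp {k t : ℕ} (q : (Fin M → Z) × Tape d c.K) (x : ℝ) :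
    epochStart c f x₁ q.1 (updateInterp (k, t) q.2 x) k = epochStart c f x₁ q.1 q.2 k :=
  epochStart_congr k (fun _ _ => rfl) (fun _ _ _ => rfl)
    (fun k' hk' t' => Function.update_of_ne (fun h => by have := (Prod.mk.inj h).1; omega) _ _)
    (fun _ _ _ => rfl)

theorem runState_updateData {k n : ℕ} {N : Fin M}
    (hN : k * c.epochSize + c.dataBefore (n + 1) ≤ N) (q : (Fin M → Z) × Tape d c.K) (z : Z) :
    runState c f x₁ k n (updateData N q z) = runState c f x₁ k n q := by
  rw [runState, epochStart_updateData (by omega), runState, epochState, epochState]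
  exact roundState_congr _ n (fun i hi => dataLoss_update _ _ (by omega)) (fun _ _ => rfl)
    (fun _ _ => rfl) (fun _ _ => rfl)

theorem runState_updateDir {k n N : ℕ}
    (hN : k * c.epochSize + c.dataBefore (n + 1) ≤ N) (q : (Fin M → Z) × Tape d c.K)
    (j : Fin d) (u : Vec d) :
    runState c f x₁ k n (q.1, updateDir (N, j) q.2 u) = runState c f x₁ k n q := by
  unfold runState
  dsimp only
  rw [epochStart_updateDir (by omega), epochState, epochState]
  exact roundState_congr _ n (fun _ _ => rfl) (fun i hi => funext fun j' =>
    Function.update_of_ne (fun h => by have := (Prod.mk.inj h).1; omega) _ _)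
    (fun _ _ => rfl) (fun _ _ => rfl)

theorem runState_w_updateData {k n : ℕ} {N : Fin M}
    (hN : k * c.epochSize + c.dataBefore n ≤ N) (q : (Fin M → Z) × Tape d c.K) (z : Z) :
    (runState c f x₁ k n (updateData N q z)).w = (runState c f x₁ k n q).w := by
  rw [runState, epochStart_updateData (by omega), runState, epochState, epochState]
  exact roundState_w_congr _ n (fun i hi => dataLoss_update _ _ (by omega)) (fun _ _ => rfl)
    (fun _ _ => rfl) (fun _ _ => rfl)

theorem runState_w_updateDir {k n N : ℕ}
    (hN : k * c.epochSize + c.dataBefore n ≤ N) (q : (Fin M → Z) × Tape d c.K)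
    (j : Fin d) (u : Vec d) :
    (runState c f x₁ k n (q.1, updateDir (N, j) q.2 u)).w = (runState c f x₁ k n q).w := by
  unfold runState
  dsimp only
  rw [epochStart_updateDir (by omega), epochState, epochState]
  exact roundState_w_congr _ n (fun _ _ => rfl) (fun i hi => funext fun j' =>
    Function.update_of_ne (fun h => by have := (Prod.mk.inj h).1; omega) _ _)
    (fun _ _ => rfl) (fun _ _ => rfl)

/-- The segment of a round is fixed before its interpolation draw is made, so that draw can be
averaged out along a fixed segment. -/
theorem runState_x_Δ_updateInterp {k n : ℕ} (q : (Fin M → Z) × Tape d c.K) (x : ℝ) :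
    (runState c f x₁ k n (q.1, updateInterp (k, n + 1) q.2 x)).x = (runState c f x₁ k n q).x ∧
    (runState c f x₁ k n (q.1, updateInterp (k, n + 1) q.2 x)).Δ = (runState c f x₁ k n q).Δ := by
  unfold runState
  dsimp only
  rw [epochStart_updateInterp, epochState, epochState]
  exact roundState_x_Δ_congr _ n (fun _ _ => rfl) (fun _ _ => rfl)
    (fun t ht => Function.update_of_ne (fun h => by have := (Prod.mk.inj h).2; omega) _ _)
    (fun _ _ => rfl)

end Error

section ErrorBound

variable {d M : ℕ} {Z : Type*} [MeasurableSpace Z] {P : Measure Z} [IsProbabilityMeasure P]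
  {c : Params} {f : Vec d → Z → ℝ} {x₁ : Vec d} {L : NNReal} [NeZero d] [NeZero c.K]

theorem measurable_runState (hm : Measurable fun p : Vec d × Z => f p.1 p.2) (k n : ℕ) :
    Measurable (fun q : (Fin M → Z) × Tape d c.K => (runState c f x₁ k n q).x) ∧
    Measurable (fun q : (Fin M → Z) × Tape d c.K => (runState c f x₁ k n q).Δ) ∧
    Measurable (fun q : (Fin M → Z) × Tape d c.K => (runState c f x₁ k n q).w) ∧
    Measurable (fun q : (Fin M → Z) × Tape d c.K => (runState c f x₁ k n q).g) ∧
    Measurable (fun q : (Fin M → Z) × Tape d c.K => (runState c f x₁ k n q).gPriv) :=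
  measurable_epochState hm k (measurable_epochStart hm k) n

/-- The smoothed population loss. -/
def smoothLoss (P : Measure Z) (f : Vec d → Z → ℝ) (δ : ℝ) : Vec d → ℝ :=
  ballSmooth δ (meanLoss P f)

/-- The error of the nonprivate estimate of round `n + 1` of epoch `k`. -/
def estError (P : Measure Z) (c : Params) (f : Vec d → Z → ℝ) (x₁ : Vec d) (k n : ℕ)
    (q : (Fin M → Z) × Tape d c.K) : Vec d :=
  (runState c f x₁ k n q).g - gradient (smoothLoss P f c.δ) (runState c f x₁ k n q).w

variable (hm : Measurable fun p : Vec d × Z => f p.1 p.2) (hi : ∀ x, Integrable (f x) P)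
  (hd : ∀ z, Differentiable ℝ fun x => f x z) (hL : ∀ z, LipschitzWith L fun x => f x z)
  (hδ : 0 < c.δ) (hB₁ : c.B₁ = c.T + 1) (hB₂ : c.B₂ = 1) (hD : c.D = c.δ / c.T) (hT : 0 < c.T)
  {k : ℕ} (hk : (k + 1) * c.epochSize ≤ M)

/-- The error of the part of the first estimate that comes from one data point. -/
def firstTerm (P : Measure Z) (c : Params) (f : Vec d → Z → ℝ) (x₁ : Vec d) (k i : ℕ)
    (q : (Fin M → Z) × Tape d c.K) : Vec d :=
  (c.B₁ : ℝ)⁻¹ • ((d : ℝ)⁻¹ • ∑ j, ((d : ℝ) / (2 * c.δ) *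
    (dataLoss f q.1 (k * c.epochSize + i)
        ((runState c f x₁ k 0 q).w + c.δ • q.2.2.2.1 (k * c.epochSize + i, j)) -
      dataLoss f q.1 (k * c.epochSize + i)
        ((runState c f x₁ k 0 q).w - c.δ • q.2.2.2.1 (k * c.epochSize + i, j)))) •
          q.2.2.2.1 (k * c.epochSize + i, j) -
    gradient (smoothLoss P f c.δ) (runState c f x₁ k 0 q).w)

theorem estError_zero (hB : 0 < c.B₁) (q : (Fin M → Z) × Tape d c.K) :
    estError P c f x₁ k 0 q = ∑ i ∈ Finset.range c.B₁, firstTerm P c f x₁ k i q := by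
  have hB' : (c.B₁ : ℝ) ≠ 0 := by exact_mod_cast hB.ne'
  unfold firstTerm
  rw [← Finset.smul_sum, Finset.sum_sub_distrib, Finset.sum_const, Finset.card_range, smul_sub,
    ← Nat.cast_smul_eq_nsmul ℝ, smul_smul, inv_mul_cancel₀ hB', one_smul]
  rfl

include hm hi hd hL hδ in
theorem firstTerm_eq {i : ℕ} (h : k * c.epochSize + i < M) (q : (Fin M → Z) × Tape d c.K) :
    firstTerm P c f x₁ k i q =
      pointEst (gradPoint f c.δ c.B₁) ((runState c f x₁ k 0 q).w, (runState c f x₁ k 0 q).w)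
        (fun j => q.2.2.2.1 (k * c.epochSize + i, j)) (q.1 ⟨_, h⟩) -
      dataMean P (gradPoint f c.δ c.B₁)
        ((runState c f x₁ k 0 q).w, (runState c f x₁ k 0 q).w) := by
  rw [dataMean_gradPoint hm hi hd hL hδ, firstTerm, smul_sub]
  congr 1
  unfold pointEst gradPoint dataLoss
  simp only [dif_pos h, mul_smul, ← Finset.smul_sum]
  rw [smul_comm]

theorem firstTerm_congr {q q' : (Fin M → Z) × Tape d c.K} {i : ℕ}
    (hw : (runState c f x₁ k 0 q).w = (runState c f x₁ k 0 q').w)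
    (hS : dataLoss f q.1 (k * c.epochSize + i) = dataLoss f q'.1 (k * c.epochSize + i))
    (hu : ∀ j, q.2.2.2.1 (k * c.epochSize + i, j) = q'.2.2.2.1 (k * c.epochSize + i, j)) :
    firstTerm P c f x₁ k i q = firstTerm P c f x₁ k i q' := by
  unfold firstTerm
  simp only [hw, hS, hu]

include hm hi hd hL hδ hk in
-- The points of the first batch are revealed one by one at a query point that depends on none of
-- them, so each adds the variance of a single point with `B = dL / B₁`.
theorem sum_firstTerm_bound (m : ℕ) (hmB : m ≤ c.B₁) :
    MemLp (fun q : (Fin M → Z) × Tape d c.K => ∑ i ∈ Finset.range m, firstTerm P c f x₁ k i q) 2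
      (runLaw d M P c) ∧
    ∫ q : (Fin M → Z) × Tape d c.K, ‖∑ i ∈ Finset.range m, firstTerm P c f x₁ k i q‖ ^ 2
      ∂(runLaw d M P c) ≤ m * (8 * ((c.B₁ : ℝ)⁻¹ * (d * L)) ^ 2 / d) := by
  induction m with
  | zero => simp
  | succ m ih =>
    obtain ⟨h1, h2⟩ := ih (by omega)
    have hN : k * c.epochSize + m < M := by
      have : m < c.epochSize := by unfold Params.epochSize; omega
      rw [Nat.add_mul, one_mul] at hk
      omega
    set N : Fin M := ⟨_, hN⟩ with hNdef
    have hw := (measurable_runState (M := M) (c := c) (x₁ := x₁) hm k 0).2.2.1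
    have hp := hw.prodMk hw
    have hφ := measurable_gradPoint hm c.δ c.B₁
    have hb : ∀ (y : Vec d × Vec d) u z, ‖u‖ = 1 → |gradPoint f c.δ c.B₁ y u z| ≤
      (fun _ => (c.B₁ : ℝ)⁻¹ * (d * L)) y := fun y u z hu => abs_gradPoint_le hL hδ _ y hu z
    have hB : ∀ᵐ q ∂(runLaw d M P c), (fun _ : Vec d × Vec d => (c.B₁ : ℝ)⁻¹ * ((d : ℝ) * L))
        ((runState c f x₁ k 0 q).w, (runState c f x₁ k 0 q).w) ≤ (c.B₁ : ℝ)⁻¹ * (d * L) :=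
      Eventually.of_forall fun _ => le_rfl
    have hbefore : k * c.epochSize + c.dataBefore 0 ≤ N := by simp [Params.dataBefore, hNdef]
    have hwZ : ∀ (q : (Fin M → Z) × Tape d c.K) z, (runState c f x₁ k 0 (updateData N q z)).w =
      (runState c f x₁ k 0 q).w := fun q z => runState_w_updateData hbefore q z
    have hwU : ∀ (q : (Fin M → Z) × Tape d c.K) j u,
        (runState c f x₁ k 0 (q.1, updateDir ((N : ℕ), j) q.2 u)).w = (runState c f x₁ k 0 q).w :=
      fun q j u => runState_w_updateDir hbefore q j u
    simp only [Finset.sum_range_succ, firstTerm_eq hm hi hd hL hδ hN]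
    refine ⟨memLp_add_pointEst_sub hφ hb hp hB h1 (n := N), ?_⟩
    have h3 := integral_norm_add_pointEst_sub_sq_le hφ hb hp hB (n := N)
      (fun q z => by simp only [hwZ]) (fun q j u => by simp only [hwU]) h1
      (fun q z => Finset.sum_congr rfl fun i hi => firstTerm_congr (hwZ q z)
        (dataLoss_update _ _ (by simp at hi; simp [hNdef]; omega)) fun _ => rfl)
      (fun q j u => Finset.sum_congr rfl fun i hi => firstTerm_congr (hwU q j u) rfl
        fun j' => Function.update_of_ne (fun h => by
          have := (Prod.mk.inj h).1; simp at hi; simp [hNdef] at this; omega) _ _)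
    refine h3.trans ?_
    push_cast
    linarith

include hm hi hd hL hδ hB₁ hB₂ hD hT hk in
-- The error is a martingale: by `dataMean_diffPoint` the fresh difference estimate has mean equal
-- to the change of the smoothed gradient. The first batch contributes `8dL²/B₁`. A later round has
-- `B = 2dL/T`, by the stability of the query points, and so adds `8B²/d = 32dL²/T²`.
theorem estError_bound (n : ℕ) (hn : n < c.T) :
    MemLp (estError P c f x₁ k n : (Fin M → Z) × Tape d c.K → Vec d) 2 (runLaw d M P c) ∧
    ∫ q : (Fin M → Z) × Tape d c.K, ‖estError P c f x₁ k n q‖ ^ 2 ∂(runLaw d M P c) ≤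
      8 * d * L ^ 2 / c.T + n * (32 * d * L ^ 2 / c.T ^ 2) := by
  have hT' : (0 : ℝ) < c.T := by exact_mod_cast hT
  have hd0 : (0 : ℝ) < d := by exact_mod_cast NeZero.pos d
  induction n with
  | zero =>
    have h := sum_firstTerm_bound (x₁ := x₁) hm hi hd hL hδ hk c.B₁ le_rfl
    have hB0 : 0 < c.B₁ := by omega
    simp only [← estError_zero hB0] at h
    refine ⟨h.1, h.2.trans ?_⟩
    have hB' : (0 : ℝ) < c.B₁ := by exact_mod_cast hB0
    have hBT : (c.T : ℝ) ≤ c.B₁ := by rw [hB₁]; push_cast; linarith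
    have e : (c.B₁ : ℝ) * (8 * ((c.B₁ : ℝ)⁻¹ * (d * L)) ^ 2 / d) = 8 * d * L ^ 2 / c.B₁ := by
      field_simp
    rw [e]
    simp only [Nat.cast_zero, zero_mul, add_zero]
    gcongr
  | succ n ih =>
    obtain ⟨h1, h2⟩ := ih (by omega)
    have hN : k * c.epochSize + (c.B₁ + n) < M := by
      have : c.B₁ + n < c.epochSize := by unfold Params.epochSize; rw [hB₂]; omega
      rw [Nat.add_mul, one_mul] at hk
      omega
    set N : Fin M := ⟨_, hN⟩ with hNdef
    have hw := (measurable_runState (M := M) (c := c) (x₁ := x₁) hm k n).2.2.1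
    have hw' := (measurable_runState (M := M) (c := c) (x₁ := x₁) hm k (n + 1)).2.2.1
    have hp := hw'.prodMk hw
    have hφ := measurable_diffPoint hm c.δ
    have hb : ∀ (y : Vec d × Vec d) u z, ‖u‖ = 1 → |diffPoint f c.δ y u z| ≤
      (fun y : Vec d × Vec d => (d : ℝ) / c.δ * (L * ‖y.1 - y.2‖)) y :=
      fun y u z _ => abs_diffPoint_le hL hδ y u z
    have hD0 : 0 ≤ c.D := by rw [hD]; positivity
    have hB : ∀ᵐ q ∂(runLaw d M P c),
        (fun y : Vec d × Vec d => (d : ℝ) / c.δ * (L * ‖y.1 - y.2‖))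
          ((runState c f x₁ k (n + 1) q).w, (runState c f x₁ k n q).w) ≤ 2 * d * L / c.T := by
      filter_upwards [ae_runLaw tapeLaw_ae_interp] with q hq
      have h := norm_roundState_w_sub_le (c := c) hD0
        (fun i => dataLoss f q.1 (k * c.epochSize + i))
        (fun i j => q.2.2.2.1 (k * c.epochSize + i, j)) (s := fun t => q.2.1 (k, t))
        (fun t => hq _) (fun t => q.2.2.1 (k, t)) (epochStart c f x₁ q.1 q.2 k) n
      calc (d : ℝ) / c.δ * (L * ‖(runState c f x₁ k (n + 1) q).w - (runState c f x₁ k n q).w‖)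
          ≤ (d : ℝ) / c.δ * (L * (2 * c.D)) := by
            have := NNReal.coe_nonneg L
            exact mul_le_mul_of_nonneg_left (mul_le_mul_of_nonneg_left h this) (by positivity)
        _ = _ := by rw [hD]; field_simp
    have hdb : c.dataBefore (n + 1) = c.B₁ + n := by simp [Params.dataBefore, hB₂]
    have hbefore : k * c.epochSize + c.dataBefore (n + 1) ≤ N := by rw [hdb]
    have hbefore' : k * c.epochSize + c.dataBefore n ≤ N := by
      refine le_trans ?_ hbefore
      cases n with
      | zero => simp [Params.dataBefore]
      | succ n => simp [Params.dataBefore, hB₂]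
    have hwZ : ∀ (q : (Fin M → Z) × Tape d c.K) z, (runState c f x₁ k (n + 1) (updateData N q z)).w =
      (runState c f x₁ k (n + 1) q).w := fun q z => runState_w_updateData hbefore q z
    have hwU : ∀ (q : (Fin M → Z) × Tape d c.K) j u,
        (runState c f x₁ k (n + 1) (q.1, updateDir ((N : ℕ), j) q.2 u)).w =
          (runState c f x₁ k (n + 1) q).w :=
      fun q j u => runState_w_updateDir hbefore q j u
    have hsZ : ∀ (q : (Fin M → Z) × Tape d c.K) z, runState c f x₁ k n (updateData N q z) =
      runState c f x₁ k n q := fun q z => runState_updateData hbefore q z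
    have hsU : ∀ (q : (Fin M → Z) × Tape d c.K) j u,
        runState c f x₁ k n (q.1, updateDir ((N : ℕ), j) q.2 u) = runState c f x₁ k n q :=
      fun q j u => runState_updateDir hbefore q j u
    have hstep : ∀ q : (Fin M → Z) × Tape d c.K, estError P c f x₁ k (n + 1) q =
        estError P c f x₁ k n q + (pointEst (diffPoint f c.δ)
          ((runState c f x₁ k (n + 1) q).w, (runState c f x₁ k n q).w)
          (fun j => q.2.2.2.1 ((N : ℕ), j)) (q.1 N) - dataMean P (diffPoint f c.δ)
            ((runState c f x₁ k (n + 1) q).w, (runState c f x₁ k n q).w)) := by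
      intro q
      have hg : (runState c f x₁ k (n + 1) q).g = (runState c f x₁ k n q).g +
          pointEst (diffPoint f c.δ)
            ((runState c f x₁ k (n + 1) q).w, (runState c f x₁ k n q).w)
            (fun j => q.2.2.2.1 ((N : ℕ), j)) (q.1 N) := by
        have : (runState c f x₁ k (n + 1) q).g = (runState c f x₁ k n q).g +
          diffEst c.δ c.B₂
            (fun i => dataLoss f q.1 (k * c.epochSize + (c.B₁ + c.B₂ * n + i)))
            (fun i j => q.2.2.2.1 (k * c.epochSize + (c.B₁ + c.B₂ * n + i), j))
            (runState c f x₁ k (n + 1) q).w (runState c f x₁ k n q).w := rfl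
        rw [this]
        congr 1
        unfold diffEst pointEst diffPoint dataLoss
        simp only [hB₂, Nat.cast_one, inv_one, one_smul, Finset.range_one, Finset.sum_singleton,
          one_mul, add_zero, dif_pos hN]
        rfl
      rw [estError, estError, dataMean_diffPoint hm hi hd hL hδ, hg]
      simp only [smoothLoss]
      abel
    have hfun : (estError P c f x₁ k (n + 1) : (Fin M → Z) × Tape d c.K → Vec d) = _ := funext hstep
    simp only [hstep]
    rw [hfun]
    refine ⟨memLp_add_pointEst_sub hφ hb hp hB h1 (n := N), ?_⟩
    have h3 := integral_norm_add_pointEst_sub_sq_le hφ hb hp hB (n := N)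
      (fun q z => by simp only [hwZ, hsZ]) (fun q j u => by simp only [hwU, hsU]) h1
      (fun q z => by simp only [estError, hsZ]) (fun q j u => by simp only [estError, hsU])
    refine h3.trans ?_
    have e : 8 * (2 * (d : ℝ) * L / c.T) ^ 2 / d = 32 * d * L ^ 2 / c.T ^ 2 := by
      field_simp; ring
    rw [e]
    push_cast
    linarith

include hm hi hd hL hδ hB₁ hB₂ hD hT hk in
theorem integral_norm_estError_sq_le (n : ℕ) (hn : n < c.T) :
    ∫ q : (Fin M → Z) × Tape d c.K, ‖estError P c f x₁ k n q‖ ^ 2 ∂(runLaw d M P c) ≤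
      40 * d * L ^ 2 / c.T := by
  have hT' : (0 : ℝ) < c.T := by exact_mod_cast hT
  have hn' : (n : ℝ) ≤ c.T := by exact_mod_cast hn.le
  refine (estError_bound hm hi hd hL hδ hB₁ hB₂ hD hT hk n hn).2.trans ?_
  have h : (n : ℝ) * (32 * d * L ^ 2 / c.T ^ 2) ≤ c.T * (32 * d * L ^ 2 / c.T ^ 2) := by gcongr
  refine (add_le_add_right h _).trans_eq ?_
  field_simp
  ring

end ErrorBound

/-! ### The tree noise -/

section Noise

variable {d M : ℕ} {Z : Type*} [MeasurableSpace Z] {P : Measure Z} [IsProbabilityMeasure P]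
  {c : Params} [NeZero d] [NeZero c.K]

theorem memLp_noise (p : ℕ × ℕ) :
    MemLp (fun q : (Fin M → Z) × Tape d c.K => q.2.2.1 p) 2 (runLaw d M P c) := by
  have h : MeasurePreserving (fun q : (Fin M → Z) × Tape d c.K => q.2.2.1 p) (runLaw d M P c)
      (isoGaussian d (c.σ p.2)) :=
    (measurePreserving_eval_infinitePi (fun p : ℕ × ℕ => isoGaussian d (c.σ p.2)) p).comp
      (measurePreserving_fst.comp (measurePreserving_snd.comp measurePreserving_snd))
  exact (memLp_isoGaussian d (c.σ p.2)).comp_measurePreserving h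

theorem sum_noise_bound {σ : ℝ} (hσ : ∀ t, c.σ t = σ) (k : ℕ) (J : Finset ℕ) :
    ∫ q : (Fin M → Z) × Tape d c.K, ‖∑ b ∈ J, q.2.2.1 (k, b)‖ ^ 2 ∂(runLaw d M P c) ≤
      J.card * (d * σ ^ 2) := by
  induction J using Finset.induction_on with
  | empty => simp
  | insert i s hi ih =>
    have h := (resample_runLaw (P := P) (M := M)
      (resample_updateNoise (d := d) (c := c) (k, i))).integral_norm_add_sq_le
      (A := fun q => ∑ b ∈ s, q.2.2.1 (k, b)) (X := fun q => q.2.2.1 (k, i)) (c := d * σ ^ 2)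
      (memLp_finsetSum s fun b _ => memLp_noise (k, b)) (memLp_noise (k, i)) (fun q x => ?_)
      (fun q => ?_) (Eventually.of_forall fun q => ?_)
    · rw [Finset.card_insert_of_notMem hi, Nat.cast_succ, add_mul, one_mul]
      refine le_trans (le_of_eq ?_) (h.trans (by linarith))
      congr 1
      funext q
      rw [Finset.sum_insert hi, add_comm]
    · refine Finset.sum_congr rfl fun b hb => Function.update_of_ne (fun h => hi ?_) _ _
      rw [← (Prod.mk.inj h).2]
      exact hb
    · simp only [updateNoise, Function.update_self]
      exact integral_isoGaussian d _
    · simp only [updateNoise, Function.update_self]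
      rw [integral_norm_sq_isoGaussian, hσ]

theorem memLp_treeNoise (k t : ℕ) :
    MemLp (fun q : (Fin M → Z) × Tape d c.K => treeNoise (fun t => q.2.2.1 (k, t)) t) 2
      (runLaw d M P c) := by
  simp only [treeNoise_eq]
  exact memLp_finsetSum _ fun b _ => memLp_noise (k, b)

theorem integral_norm_treeNoise_sq_le {σ : ℝ} (hσ : ∀ t, c.σ t = σ) (k : ℕ) {t : ℕ} (ht : t ≤ c.T) :
    ∫ q : (Fin M → Z) × Tape d c.K, ‖treeNoise (fun t => q.2.2.1 (k, t)) t‖ ^ 2 ∂(runLaw d M P c) ≤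
      (Nat.log 2 c.T + 1 : ℕ) * (d * σ ^ 2) := by
  simp only [treeNoise_eq]
  refine (sum_noise_bound hσ k _).trans ?_
  gcongr
  exact (card_nodeEnds_le t).trans (Nat.add_le_add_right (Nat.log_mono_right ht) 1)

end Noise

/-! ### Projected online subgradient descent -/

section Regret

variable {d : ℕ}

theorem norm_projBall_sub_sq_le {D : ℝ} (hD : 0 ≤ D) (x : Vec d) {u : Vec d} (hu : ‖u‖ ≤ D) :
    ‖projBall D x - u‖ ^ 2 ≤ ‖x - u‖ ^ 2 := by
  unfold projBall
  split_ifs with h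
  · exact le_rfl
  · have hx : 0 < ‖x‖ := lt_of_le_of_lt hD (not_le.mp h)
    set a := D / ‖x‖ with ha
    have h1 : a ≤ 1 := (div_le_one hx).2 (not_le.mp h).le
    have hax : a * ‖x‖ = D := div_mul_cancel₀ D hx.ne'
    have h2 : inner ℝ x u ≤ ‖x‖ * D := (real_inner_le_norm x u).trans (by gcongr)
    have h3 : ‖x - u‖ ^ 2 - ‖a • x - u‖ ^ 2 =
        (1 - a) * (‖x‖ * ‖x‖ + a * ‖x‖ * ‖x‖ - 2 * inner ℝ x u) := by
      rw [norm_sub_sq_real, norm_sub_sq_real, norm_smul, real_inner_smul_left, mul_pow,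
        Real.norm_eq_abs, sq_abs]
      ring
    have h4 : 0 ≤ (1 - a) * (‖x‖ * ‖x‖ + a * ‖x‖ * ‖x‖ - 2 * inner ℝ x u) := by
      refine mul_nonneg (by linarith) ?_
      rw [hax]
      nlinarith [not_le.mp h]
    linarith

/-- The regret of projected online subgradient descent against a fixed `u`. -/
theorem sum_inner_sub_le {D η : ℝ} (hD : 0 ≤ D) (hη : 0 < η) {Δ g : ℕ → Vec d} (h0 : Δ 0 = 0)
    (hs : ∀ n, Δ (n + 1) = projBall D (Δ n - η • g n)) {u : Vec d} (hu : ‖u‖ ≤ D) (T : ℕ) :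
    ∑ n ∈ Finset.range T, inner ℝ (g n) (Δ n - u) ≤
      D ^ 2 / (2 * η) + η / 2 * ∑ n ∈ Finset.range T, ‖g n‖ ^ 2 := by
  -- The squared distance to the comparator is kept on the left as the potential of the induction
  -- and dropped at the end.
  have key : ∀ T, ∑ n ∈ Finset.range T, inner ℝ (g n) (Δ n - u) + ‖Δ T - u‖ ^ 2 / (2 * η) ≤
      D ^ 2 / (2 * η) + η / 2 * ∑ n ∈ Finset.range T, ‖g n‖ ^ 2 := by
    intro T
    induction T with
    | zero =>
      simp only [Finset.range_zero, Finset.sum_empty, h0, zero_sub, norm_neg, zero_add, mul_zero,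
        add_zero]
      gcongr
    | succ T ih =>
      rw [Finset.sum_range_succ, Finset.sum_range_succ, hs]
      have h1 := norm_projBall_sub_sq_le hD (Δ T - η • g T) hu
      have h2 : Δ T - η • g T - u = (Δ T - u) - η • g T := by abel
      rw [h2, norm_sub_sq_real (Δ T - u), real_inner_smul_right, norm_smul, mul_pow,
        Real.norm_eq_abs, sq_abs, real_inner_comm (g T) (Δ T - u)] at h1
      have h3 : ‖projBall D (Δ T - η • g T) - u‖ ^ 2 / (2 * η) ≤
          ‖Δ T - u‖ ^ 2 / (2 * η) - inner ℝ (g T) (Δ T - u) + η / 2 * ‖g T‖ ^ 2 := by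
        rw [div_le_iff₀ (by positivity)]
        refine h1.trans (le_of_eq ?_)
        field_simp
      linarith
  have := key T
  have h2 : 0 ≤ ‖Δ T - u‖ ^ 2 / (2 * η) := by positivity
  linarith

/-- The norm of a sum of vectors in terms of the regret of the increments. -/
theorem mul_norm_sum_le {D η : ℝ} (hD : 0 ≤ D) (hη : 0 < η) {Δ g v : ℕ → Vec d} (h0 : Δ 0 = 0)
    (hs : ∀ n, Δ (n + 1) = projBall D (Δ n - η • g n)) (T : ℕ) :
    D * ‖∑ n ∈ Finset.range T, v n‖ ≤ D ^ 2 / (2 * η) + η / 2 * ∑ n ∈ Finset.range T, ‖g n‖ ^ 2 +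
      2 * D * ∑ n ∈ Finset.range T, ‖g n - v n‖ - ∑ n ∈ Finset.range T, inner ℝ (v n) (Δ n) := by
  set S := ∑ n ∈ Finset.range T, v n with hS
  -- The comparator has norm `D` and points against `S`. If `S = 0`, the convention for the inverse
  -- gives `u = 0`, and the identity `hSu` still holds.
  set u : Vec d := -((D * ‖S‖⁻¹) • S) with hu
  have hun : ‖u‖ ≤ D := by
    rw [hu, norm_neg, norm_smul, Real.norm_of_nonneg (by positivity), mul_assoc]
    exact mul_le_of_le_one_right hD inv_mul_le_one
  have hSu : inner ℝ S u = -(D * ‖S‖) := by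
    rw [hu, inner_neg_right, real_inner_smul_right, real_inner_self_eq_norm_sq]
    rcases eq_or_ne ‖S‖ 0 with h | h
    · rw [h]; simp
    · field_simp
  have hΔ : ∀ n, ‖Δ n‖ ≤ D := by
    intro n
    cases n with
    | zero => rw [h0]; simpa using hD
    | succ n => rw [hs]; exact (projBall_spec hD _).1
  have h1 := sum_inner_sub_le hD hη h0 hs hun T
  -- The private estimate may be correlated with the increment, so its error is paid for by norm; `Δ
  -- n` and `u` both lie in the ball, which gives the factor `2 * D`.
  have h2 : ∀ n, inner ℝ (v n) (Δ n - u) ≤ inner ℝ (g n) (Δ n - u) + 2 * D * ‖g n - v n‖ := by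
    intro n
    have h3 : inner ℝ (v n) (Δ n - u) = inner ℝ (g n) (Δ n - u) - inner ℝ (g n - v n) (Δ n - u) := by
      rw [inner_sub_left]; ring
    have h4 : |inner ℝ (g n - v n) (Δ n - u)| ≤ ‖g n - v n‖ * (2 * D) :=
      (abs_real_inner_le_norm _ _).trans (by
        gcongr
        refine (norm_sub_le _ _).trans ?_
        linarith [hΔ n])
    have := neg_abs_le (inner ℝ (g n - v n) (Δ n - u))
    linarith
  have h5 := Finset.sum_le_sum fun n (_ : n ∈ Finset.range T) => h2 n
  rw [Finset.sum_add_distrib, ← Finset.mul_sum] at h5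
  have h6 : ∑ n ∈ Finset.range T, inner ℝ (v n) (Δ n - u) =
      ∑ n ∈ Finset.range T, inner ℝ (v n) (Δ n) - inner ℝ S u := by
    rw [hS, sum_inner, ← Finset.sum_sub_distrib]
    simp only [inner_sub_right]
  rw [h6, hSu] at h5
  linarith

end Regret

/-! ### Convergence -/

/-- The variance of `‖X‖` is nonnegative. -/
theorem integral_norm_le_of_sq {Ω E : Type*} [MeasurableSpace Ω] [NormedAddCommGroup E]
    {μ : Measure Ω} [IsProbabilityMeasure μ] {X : Ω → E} (hX : MemLp X 2 μ) {a : ℝ} (ha : 0 ≤ a)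
    (h : ∫ ω, ‖X ω‖ ^ 2 ∂μ ≤ a ^ 2) : ∫ ω, ‖X ω‖ ∂μ ≤ a := by
  have i2 : Integrable (fun ω => ‖X ω‖ ^ 2) μ := hX.integrable_norm_pow (by norm_num)
  have i1 : Integrable (fun ω => ‖X ω‖) μ := (hX.integrable (by norm_num)).norm
  have h0 : 0 ≤ ∫ ω, ‖X ω‖ ∂μ := integral_nonneg fun _ => norm_nonneg _
  have h1 : 0 ≤ ∫ ω, (‖X ω‖ - ∫ ω, ‖X ω‖ ∂μ) ^ 2 ∂μ := integral_nonneg fun _ => sq_nonneg _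
  set m := ∫ ω, ‖X ω‖ ∂μ with hm
  have h2 : ∫ ω, (‖X ω‖ - m) ^ 2 ∂μ = ∫ ω, ‖X ω‖ ^ 2 ∂μ - m ^ 2 := by
    have e : (fun ω => (‖X ω‖ - m) ^ 2) = fun ω => ‖X ω‖ ^ 2 + (m ^ 2 - 2 * m * ‖X ω‖) := by
      funext ω; ring
    have i3 : Integrable (fun ω => m ^ 2 - 2 * m * ‖X ω‖) μ :=
      (integrable_const _).sub (i1.const_mul _)
    rw [e, integral_add i2 i3, integral_sub (integrable_const _) (i1.const_mul _), integral_const_mul, integral_const,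
      probReal_univ, one_smul, ← hm]
    ring
  exact le_of_sq_le_sq (by linarith) ha

/-! ### Distances between the query points of an epoch. -/

section Path

variable {d : ℕ} {c : Params} {v : ℕ → Vec d → ℝ} {u : ℕ → Fin d → Vec d} {s : ℕ → ℝ}
  {ξ : ℕ → Vec d} {x : Vec d}

theorem norm_roundState_x_sub_le (hD : 0 ≤ c.D) (n j : ℕ) :
    ‖(roundState c v u s ξ x (n + j)).x - (roundState c v u s ξ x n).x‖ ≤ j * c.D := by
  induction j with
  | zero => simp
  | succ j ih =>
    have hx : (roundState c v u s ξ x (n + (j + 1))).x =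
      (roundState c v u s ξ x (n + j)).x + (roundState c v u s ξ x (n + j)).Δ := rfl
    rw [hx, add_sub_right_comm]
    refine (norm_add_le _ _).trans ((add_le_add ih (norm_roundState_Δ_le hD v u s ξ x _)).trans_eq ?_)
    push_cast
    ring

/-- For `n < m` the displacement consists of at most `m - n + 1 ≤ T` increments, the first and the
last being partial. -/
theorem norm_roundState_w_sub_w_le (hD : 0 ≤ c.D) (hs : ∀ t, s t ∈ Set.Icc (0 : ℝ) 1) {n m : ℕ}
    (hnm : n ≤ m) (hm : m < c.T) :
    ‖(roundState c v u s ξ x m).w - (roundState c v u s ξ x n).w‖ ≤ c.T * c.D := by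
  rcases hnm.eq_or_lt with rfl | hlt
  · simpa using mul_nonneg (Nat.cast_nonneg _) hD
  obtain ⟨j, rfl⟩ : ∃ j, m = n + 1 + j := ⟨m - (n + 1), by omega⟩
  have h1 := norm_roundState_x_sub_le (v := v) (u := u) (s := s) (ξ := ξ) (x := x) hD (n + 1) j
  have h2 := norm_roundState_Δ_le hD v u s ξ x n
  have h3 := norm_roundState_Δ_le hD v u s ξ x (n + 1 + j)
  have hx : (roundState c v u s ξ x (n + 1)).x =
      (roundState c v u s ξ x n).x + (roundState c v u s ξ x n).Δ := rfl
  have he : (roundState c v u s ξ x (n + 1 + j)).w - (roundState c v u s ξ x n).w =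
      (1 - s (n + 1)) • (roundState c v u s ξ x n).Δ
        + ((roundState c v u s ξ x (n + 1 + j)).x - (roundState c v u s ξ x (n + 1)).x)
        + s (n + 1 + j + 1) • (roundState c v u s ξ x (n + 1 + j)).Δ := by
    rw [roundState_w, roundState_w, hx, sub_smul, one_smul]
    abel
  rw [he]
  refine (norm_add₃_le).trans ?_
  rw [norm_smul, norm_smul, Real.norm_of_nonneg (by linarith [(hs (n + 1)).2]),
    Real.norm_of_nonneg (hs (n + 1 + j + 1)).1]
  have h4 := mul_le_mul (by linarith [(hs (n + 1)).1] : 1 - s (n + 1) ≤ 1) h2 (norm_nonneg _)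
    zero_le_one
  have h5 := mul_le_mul (hs (n + 1 + j + 1)).2 h3 (norm_nonneg _) zero_le_one
  have h6 : ((j : ℝ) + 2) * c.D ≤ c.T * c.D := by
    refine mul_le_mul_of_nonneg_right ?_ hD
    exact_mod_cast (by omega : j + 2 ≤ c.T)
  linarith

theorem norm_roundState_w_sub_average_le (hD : 0 ≤ c.D) (hs : ∀ t, s t ∈ Set.Icc (0 : ℝ) 1) {n : ℕ}
    (hn : n < c.T) :
    ‖(roundState c v u s ξ x n).w -
      (c.T : ℝ)⁻¹ • ∑ m ∈ Finset.range c.T, (roundState c v u s ξ x m).w‖ ≤ c.T * c.D := by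
  have hT' : (c.T : ℝ) ≠ 0 := by
    have : c.T ≠ 0 := by omega
    exact_mod_cast this
  have he : (roundState c v u s ξ x n).w -
      (c.T : ℝ)⁻¹ • ∑ m ∈ Finset.range c.T, (roundState c v u s ξ x m).w =
      (c.T : ℝ)⁻¹ • ∑ m ∈ Finset.range c.T,
        ((roundState c v u s ξ x n).w - (roundState c v u s ξ x m).w) := by
    rw [Finset.sum_sub_distrib, Finset.sum_const, Finset.card_range, smul_sub,
      ← Nat.cast_smul_eq_nsmul ℝ, smul_smul, inv_mul_cancel₀ hT', one_smul]
  rw [he, norm_smul, norm_inv, Real.norm_natCast, inv_mul_le_iff₀ (by positivity)]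
  refine (norm_sum_le _ _).trans ((Finset.sum_le_sum (g := fun _ => c.T * c.D) fun m hm => ?_).trans
    (by simp))
  rcases le_total n m with h | h
  · rw [norm_sub_rev]
    exact norm_roundState_w_sub_w_le hD hs h (Finset.mem_range.1 hm)
  · exact norm_roundState_w_sub_w_le hD hs h hn

end Path

/-! ### From inner products with the increments to decrements of the smoothed loss. -/

section Convergence

variable {d M : ℕ} {Z : Type*} [MeasurableSpace Z] {P : Measure Z} [IsProbabilityMeasure P]
  {c : Params} {f : Vec d → Z → ℝ} {x₁ : Vec d} {L : NNReal} [NeZero d] [NeZero c.K]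
  (hm : Measurable fun p : Vec d × Z => f p.1 p.2) (hi : ∀ x, Integrable (f x) P)
  (hd : ∀ z, Differentiable ℝ fun x => f x z) (hL : ∀ z, LipschitzWith L fun x => f x z)
  (hδ : 0 < c.δ)

include hm hi hd hL hδ

theorem hasGradientAt_smoothLoss (x : Vec d) :
    HasGradientAt (smoothLoss P f c.δ) (gradient (smoothLoss P f c.δ) x) x :=
  (hasGradientAt_ballSmooth (differentiable_meanLoss hm hi hd hL) (lipschitzWith_meanLoss hi hL)
    hδ.le x).differentiableAt.hasGradientAt

omit hm hd in
theorem lipschitzWith_smoothLoss : LipschitzWith L (smoothLoss P f c.δ) :=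
  lipschitzWith_ballSmooth (lipschitzWith_meanLoss hi hL) hδ.le

theorem integral_inner_gradient_line (x Δ : Vec d) :
    ∫ s, inner ℝ (gradient (smoothLoss P f c.δ) (x + s • Δ)) Δ ∂unitUniform =
      smoothLoss P f c.δ (x + Δ) - smoothLoss P f c.δ x := by
  have hder : ∀ s : ℝ, HasDerivAt (fun s : ℝ => smoothLoss P f c.δ (x + s • Δ))
      (inner ℝ (gradient (smoothLoss P f c.δ) (x + s • Δ)) Δ) s := by
    intro s
    have h1 : HasDerivAt (fun t : ℝ => x + t • Δ) Δ s := by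
      simpa using ((hasDerivAt_id s).smul_const Δ).const_add x
    rw [inner_gradient_left (𝕜 := ℝ)]
    exact (hasGradientAt_smoothLoss hm hi hd hL hδ
      (x + s • Δ)).differentiableAt.hasFDerivAt.comp_hasDerivAt s h1
  -- The fundamental theorem of calculus needs no continuity of the gradient here: it is measurable
  -- and bounded by `L`.
  have hint : IntervalIntegrable
      (fun s : ℝ => inner ℝ (gradient (smoothLoss P f c.δ) (x + s • Δ)) Δ) volume 0 1 := by
    refine (intervalIntegrable_const (c := (L : ℝ) * ‖Δ‖)).mono_fun ?_ ?_
    · have h1 : Measurable fun s : ℝ => gradient (smoothLoss P f c.δ) (x + s • Δ) :=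
        (measurable_gradient _).comp (by fun_prop)
      exact (h1.inner measurable_const).aestronglyMeasurable
    · refine Eventually.of_forall fun s => ?_
      refine (norm_inner_le_norm _ _).trans ?_
      exact (mul_le_mul_of_nonneg_right (norm_gradient_le (lipschitzWith_smoothLoss hi hL hδ) _)
        (norm_nonneg _)).trans (le_abs_self _)
  have h := intervalIntegral.integral_eq_sub_of_hasDerivAt (fun s _ => hder s) hint
  rw [intervalIntegral.integral_of_le zero_le_one] at h
  rw [unitUniform, integral_Icc_eq_integral_Ioc, h]
  simp

variable (hD0 : 0 ≤ c.D)

omit hm hi hd hL hδ in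
include hD0 in
theorem norm_runState_Δ_le (k n : ℕ) (q : (Fin M → Z) × Tape d c.K) :
    ‖(runState c f x₁ k n q).Δ‖ ≤ c.D := norm_roundState_Δ_le hD0 _ _ _ _ _ _

include hD0 in
theorem integrable_inner_Δ (k n : ℕ) :
    Integrable (fun q : (Fin M → Z) × Tape d c.K =>
      inner ℝ (gradient (smoothLoss P f c.δ) (runState c f x₁ k n q).w) (runState c f x₁ k n q).Δ)
      (runLaw d M P c) := by
  obtain ⟨-, h2, h3, -⟩ := measurable_runState (M := M) (c := c) (x₁ := x₁) hm k n
  have h4 := (measurable_gradient (smoothLoss P f c.δ)).comp h3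
  refine Integrable.of_bound (h4.inner h2).aestronglyMeasurable (L * c.D)
    (Eventually.of_forall fun q => (norm_inner_le_norm _ _).trans ?_)
  gcongr
  · exact norm_gradient_le (lipschitzWith_smoothLoss hi hL hδ) _
  · exact norm_runState_Δ_le hD0 k n q

include hD0 in
theorem integrable_smoothLoss_sub (k n : ℕ) :
    Integrable (fun q : (Fin M → Z) × Tape d c.K =>
      smoothLoss P f c.δ ((runState c f x₁ k n q).x + (runState c f x₁ k n q).Δ) -
        smoothLoss P f c.δ (runState c f x₁ k n q).x) (runLaw d M P c) := by
  obtain ⟨h1, h2, -⟩ := measurable_runState (M := M) (c := c) (x₁ := x₁) hm k n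
  have hc := (lipschitzWith_smoothLoss (c := c) hi hL hδ).continuous.measurable
  refine Integrable.of_bound ((hc.comp (h1.add h2)).sub (hc.comp h1)).aestronglyMeasurable (L * c.D)
    (Eventually.of_forall fun q => ?_)
  have h := (lipschitzWith_smoothLoss (c := c) hi hL hδ).dist_le_mul
    ((runState c f x₁ k n q).x + (runState c f x₁ k n q).Δ) (runState c f x₁ k n q).x
  rw [dist_eq_norm, dist_eq_norm, add_sub_cancel_left] at h
  refine h.trans ?_
  gcongr
  exact norm_runState_Δ_le hD0 k n q

include hD0 in
-- Averaging over the uniform interpolation draw turns the inner product at `w` into the line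
-- integral from `x` to `x + Δ`. The identity is exact, which is why no smoothness beyond
-- differentiability is needed.
theorem integral_inner_Δ (k n : ℕ) :
    ∫ q : (Fin M → Z) × Tape d c.K,
      inner ℝ (gradient (smoothLoss P f c.δ) (runState c f x₁ k n q).w) (runState c f x₁ k n q).Δ
      ∂(runLaw d M P c) =
    ∫ q : (Fin M → Z) × Tape d c.K,
      (smoothLoss P f c.δ ((runState c f x₁ k n q).x + (runState c f x₁ k n q).Δ) -
        smoothLoss P f c.δ (runState c f x₁ k n q).x) ∂(runLaw d M P c) := by
  rw [(resample_runLaw (P := P) (M := M) (resample_updateInterp (d := d) (c := c)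
    (k, n + 1))).integral (integrable_inner_Δ hm hi hd hL hδ hD0 k n)]
  refine integral_congr_ae (Eventually.of_forall fun q => ?_)
  simp only
  rw [← integral_inner_gradient_line hm hi hd hL hδ]
  refine integral_congr_ae (Eventually.of_forall fun s => ?_)
  have h := runState_x_Δ_updateInterp (c := c) (f := f) (x₁ := x₁) (k := k) (n := n) q s
  have hw : (runState c f x₁ k n (q.1, updateInterp (k, n + 1) q.2 s)).w =
      (runState c f x₁ k n q).x + s • (runState c f x₁ k n q).Δ := by
    rw [← h.1, ← h.2]
    have h2 : (updateInterp (k, n + 1) q.2 s).1 (k, n + 1) = s := Function.update_self _ _ _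
    nth_rw 3 [← h2]
    exact roundState_w _ _ _ _ _ _
  simp only
  rw [hw, h.2]

omit hm hi hd hL hδ in
-- The sum telescopes within an epoch and again across epochs, since each epoch starts where the
-- previous one ended.
theorem sum_smoothLoss_sub (h : Vec d → ℝ) (hT : 0 < c.T) (K : ℕ) (q : (Fin M → Z) × Tape d c.K) :
    ∑ k ∈ Finset.range K, ∑ n ∈ Finset.range c.T,
      (h ((runState c f x₁ k n q).x + (runState c f x₁ k n q).Δ) - h (runState c f x₁ k n q).x) =
      h (epochStart c f x₁ q.1 q.2 K) - h x₁ := by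
  have h1 : ∀ k T, ∑ n ∈ Finset.range (T + 1),
      (h ((runState c f x₁ k n q).x + (runState c f x₁ k n q).Δ) - h (runState c f x₁ k n q).x) =
      h ((runState c f x₁ k T q).x + (runState c f x₁ k T q).Δ) -
        h (epochStart c f x₁ q.1 q.2 k) := by
    intro k T
    induction T with
    | zero => simp [runState, epochState, roundState]
    | succ T ih =>
      rw [Finset.sum_range_succ, ih]
      have hx : (runState c f x₁ k (T + 1) q).x =
        (runState c f x₁ k T q).x + (runState c f x₁ k T q).Δ := rfl
      rw [← hx]
      ring
  obtain ⟨T, hT'⟩ : ∃ T, c.T = T + 1 := ⟨c.T - 1, by omega⟩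
  have h2 : ∀ k, ∑ n ∈ Finset.range c.T,
      (h ((runState c f x₁ k n q).x + (runState c f x₁ k n q).Δ) - h (runState c f x₁ k n q).x) =
      h (epochStart c f x₁ q.1 q.2 (k + 1)) - h (epochStart c f x₁ q.1 q.2 k) := by
    intro k
    rw [hT', h1]
    congr 2
    simp only [epochStart, hT', Nat.add_sub_cancel]
    rfl
  simp only [h2]
  exact Finset.sum_range_sub (fun k => h (epochStart c f x₁ q.1 q.2 k)) K

end Convergence

/-! ### Expected norm of the sum of smoothed gradients over one epoch. -/

section MainBound

variable {d M : ℕ} {Z : Type*} [MeasurableSpace Z] {P : Measure Z} [IsProbabilityMeasure P]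
  {c : Params} {f : Vec d → Z → ℝ} {x₁ : Vec d} {L : NNReal} [NeZero d] [NeZero c.K]
  (hm : Measurable fun p : Vec d × Z => f p.1 p.2) (hi : ∀ x, Integrable (f x) P)
  (hd : ∀ z, Differentiable ℝ fun x => f x z) (hL : ∀ z, LipschitzWith L fun x => f x z)
  (hδ : 0 < c.δ) (hB₁ : c.B₁ = c.T + 1) (hB₂ : c.B₂ = 1) (hD : c.D = c.δ / c.T) (hT : 0 < c.T)
  {k : ℕ}

omit [NeZero d] [NeZero c.K] in
theorem gPriv_sub_gradient (n : ℕ) (q : (Fin M → Z) × Tape d c.K) :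
    (runState c f x₁ k n q).gPriv - gradient (smoothLoss P f c.δ) (runState c f x₁ k n q).w =
      estError P c f x₁ k n q + treeNoise (fun t => q.2.2.1 (k, t)) (n + 1) := by
  have h : (runState c f x₁ k n q).gPriv = (runState c f x₁ k n q).g +
    treeNoise (fun t => q.2.2.1 (k, t)) (n + 1) := roundState_gPriv _ _ _ _ _ _
  rw [h, estError]
  abel

include hm hi hL hδ in
theorem memLp_gradient_w (n : ℕ) :
    MemLp (fun q : (Fin M → Z) × Tape d c.K =>
      gradient (smoothLoss P f c.δ) (runState c f x₁ k n q).w) 2 (runLaw d M P c) := by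
  have h3 := (measurable_runState (M := M) (c := c) (x₁ := x₁) hm k n).2.2.1
  refine MemLp.of_bound ((measurable_gradient (smoothLoss P f c.δ)).comp h3).aestronglyMeasurable L
    (Eventually.of_forall fun q => norm_gradient_le (lipschitzWith_smoothLoss hi hL hδ) _)

variable (hk : (k + 1) * c.epochSize ≤ M) {σ a b : ℝ} (hσ : ∀ t, c.σ t = σ) (ha : 0 ≤ a) (hb : 0 ≤ b)
  (hae : 40 * d * L ^ 2 / c.T ≤ a ^ 2) (hbe : (Nat.log 2 c.T + 1 : ℕ) * (d * σ ^ 2) ≤ b ^ 2)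

include hm hi hd hL hδ hB₁ hB₂ hD hT hk

theorem memLp_gPriv_sub {n : ℕ} (hn : n < c.T) :
    MemLp (fun q : (Fin M → Z) × Tape d c.K =>
      (runState c f x₁ k n q).gPriv - gradient (smoothLoss P f c.δ) (runState c f x₁ k n q).w) 2
      (runLaw d M P c) := by
  simp only [gPriv_sub_gradient]
  exact (estError_bound hm hi hd hL hδ hB₁ hB₂ hD hT hk n hn).1.add (memLp_treeNoise k (n + 1))

theorem memLp_gPriv {n : ℕ} (hn : n < c.T) :
    MemLp (fun q : (Fin M → Z) × Tape d c.K => (runState c f x₁ k n q).gPriv) 2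
      (runLaw d M P c) := by
  have h := (memLp_gPriv_sub (x₁ := x₁) hm hi hd hL hδ hB₁ hB₂ hD hT hk hn).add
    (memLp_gradient_w (x₁ := x₁) (k := k) hm hi hL hδ n)
  refine h.congr_norm ?_ (Eventually.of_forall fun q => by simp)
  exact (measurable_runState (M := M) (c := c) (x₁ := x₁) hm k n).2.2.2.2.aestronglyMeasurable

include hσ hae hbe

include ha hb in
theorem integral_norm_gPriv_sub_le {n : ℕ} (hn : n < c.T) :
    ∫ q : (Fin M → Z) × Tape d c.K,
      ‖(runState c f x₁ k n q).gPriv - gradient (smoothLoss P f c.δ) (runState c f x₁ k n q).w‖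
      ∂(runLaw d M P c) ≤ a + b := by
  have hE := (estError_bound (x₁ := x₁) hm hi hd hL hδ hB₁ hB₂ hD hT hk n hn).1
  have hN := memLp_treeNoise (d := d) (M := M) (P := P) (c := c) k (n + 1)
  have h1 := integral_norm_le_of_sq hE ha
    ((integral_norm_estError_sq_le hm hi hd hL hδ hB₁ hB₂ hD hT hk n hn).trans hae)
  have h2 := integral_norm_le_of_sq hN hb ((integral_norm_treeNoise_sq_le hσ k hn).trans hbe)
  have i1 := (hE.integrable one_le_two).norm
  have i2 := (hN.integrable one_le_two).norm
  simp only [gPriv_sub_gradient]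
  calc _ ≤ ∫ q : (Fin M → Z) × Tape d c.K, (‖estError P c f x₁ k n q‖ +
        ‖treeNoise (fun t => q.2.2.1 (k, t)) (n + 1)‖) ∂(runLaw d M P c) :=
        integral_mono_of_nonneg (Eventually.of_forall fun _ => norm_nonneg _) (i1.add i2)
          (Eventually.of_forall fun _ => norm_add_le _ _)
    _ ≤ a + b := by rw [integral_add i1 i2]; exact add_le_add h1 h2

theorem integral_norm_gPriv_sq_le {n : ℕ} (hn : n < c.T) :
    ∫ q : (Fin M → Z) × Tape d c.K, ‖(runState c f x₁ k n q).gPriv‖ ^ 2 ∂(runLaw d M P c) ≤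
      3 * (a ^ 2 + L ^ 2 + b ^ 2) := by
  have hE := (estError_bound (x₁ := x₁) hm hi hd hL hδ hB₁ hB₂ hD hT hk n hn).1
  have hN := memLp_treeNoise (d := d) (M := M) (P := P) (c := c) k (n + 1)
  have h1 := (integral_norm_estError_sq_le (x₁ := x₁) hm hi hd hL hδ hB₁ hB₂ hD hT hk n hn).trans hae
  have h2 := (integral_norm_treeNoise_sq_le (d := d) (M := M) (P := P) hσ k
    (t := n + 1) hn).trans hbe
  have i1 : Integrable (fun q => ‖estError P c f x₁ k n q‖ ^ 2) (runLaw d M P c) :=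
    hE.integrable_norm_pow (by norm_num)
  have i2 : Integrable (fun q : (Fin M → Z) × Tape d c.K =>
      ‖treeNoise (fun t => q.2.2.1 (k, t)) (n + 1)‖ ^ 2) (runLaw d M P c) :=
    hN.integrable_norm_pow (by norm_num)
  have i3 : Integrable (fun q : (Fin M → Z) × Tape d c.K => 3 * (‖estError P c f x₁ k n q‖ ^ 2 +
      (L : ℝ) ^ 2 + ‖treeNoise (fun t => q.2.2.1 (k, t)) (n + 1)‖ ^ 2)) (runLaw d M P c) :=
    ((i1.add (integrable_const _)).add i2).const_mul _
  refine (integral_mono_of_nonneg (Eventually.of_forall fun _ => by positivity) i3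
    (Eventually.of_forall fun q => ?_)).trans ?_
  · have h : (runState c f x₁ k n q).gPriv = estError P c f x₁ k n q +
        treeNoise (fun t => q.2.2.1 (k, t)) (n + 1) +
          gradient (smoothLoss P f c.δ) (runState c f x₁ k n q).w := by
      rw [← gPriv_sub_gradient, sub_add_cancel]
    have hg := norm_gradient_le (lipschitzWith_smoothLoss (c := c) (P := P) hi hL hδ)
      (runState c f x₁ k n q).w
    have h3 : ‖(runState c f x₁ k n q).gPriv‖ ≤ ‖estError P c f x₁ k n q‖ +
        ‖treeNoise (fun t => q.2.2.1 (k, t)) (n + 1)‖ + L := by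
      rw [h]
      exact norm_add₃_le.trans (by gcongr)
    have h4 := pow_le_pow_left₀ (norm_nonneg _) h3 2
    simp only
    nlinarith [sq_nonneg (‖estError P c f x₁ k n q‖ -
        ‖treeNoise (fun t => q.2.2.1 (k, t)) (n + 1)‖),
      sq_nonneg (‖estError P c f x₁ k n q‖ - L),
      sq_nonneg (‖treeNoise (fun t => q.2.2.1 (k, t)) (n + 1)‖ - L)]
  · have i4 : Integrable (fun q : (Fin M → Z) × Tape d c.K => ‖estError P c f x₁ k n q‖ ^ 2 +
      (L : ℝ) ^ 2) (runLaw d M P c) := i1.add (integrable_const _)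
    rw [integral_const_mul, integral_add i4 i2, integral_add i1 (integrable_const _),
      integral_const, probReal_univ, one_smul]
    gcongr

variable {G : ℝ} (hG : 0 < G) (hGe : 3 * (a ^ 2 + L ^ 2 + b ^ 2) ≤ G ^ 2)
  (hη : c.η = c.D / (G * √c.T))

include ha hb hG hGe hη in
/-- The bound on the sum of the gradients in one epoch. -/
theorem epoch_bound :
    c.D * ∫ q : (Fin M → Z) × Tape d c.K, ‖∑ n ∈ Finset.range c.T,
      gradient (smoothLoss P f c.δ) (runState c f x₁ k n q).w‖ ∂(runLaw d M P c) ≤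
    c.D * (G * √c.T + 2 * c.T * (a + b)) - ∫ q : (Fin M → Z) × Tape d c.K,
      ∑ n ∈ Finset.range c.T,
        (smoothLoss P f c.δ ((runState c f x₁ k n q).x + (runState c f x₁ k n q).Δ) -
          smoothLoss P f c.δ (runState c f x₁ k n q).x) ∂(runLaw d M P c) := by
  have hT' : (0 : ℝ) < c.T := by exact_mod_cast hT
  have hD0 : 0 < c.D := by rw [hD]; positivity
  have hη0 : 0 < c.η := by rw [hη]; positivity
  have hpath : ∀ q : (Fin M → Z) × Tape d c.K, _ := fun q =>
    mul_norm_sum_le (Δ := fun n => (runState c f x₁ k n q).Δ)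
      (g := fun n => (runState c f x₁ k n q).gPriv)
      (v := fun n => gradient (smoothLoss P f c.δ) (runState c f x₁ k n q).w) hD0.le hη0 rfl
      (fun _ => rfl) c.T
  have j1 : Integrable (fun q : (Fin M → Z) × Tape d c.K => ∑ n ∈ Finset.range c.T,
      ‖(runState c f x₁ k n q).gPriv‖ ^ 2) (runLaw d M P c) :=
    integrable_finsetSum _ fun n hn => (memLp_gPriv hm hi hd hL hδ hB₁ hB₂ hD hT hk
      (Finset.mem_range.1 hn)).integrable_norm_pow (by norm_num)
  have j2 : Integrable (fun q : (Fin M → Z) × Tape d c.K => ∑ n ∈ Finset.range c.T,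
      ‖(runState c f x₁ k n q).gPriv - gradient (smoothLoss P f c.δ) (runState c f x₁ k n q).w‖)
      (runLaw d M P c) :=
    integrable_finsetSum _ fun n hn => ((memLp_gPriv_sub hm hi hd hL hδ hB₁ hB₂ hD hT hk
      (Finset.mem_range.1 hn)).integrable one_le_two).norm
  have j3 : Integrable (fun q : (Fin M → Z) × Tape d c.K => ∑ n ∈ Finset.range c.T,
      inner ℝ (gradient (smoothLoss P f c.δ) (runState c f x₁ k n q).w)
        (runState c f x₁ k n q).Δ) (runLaw d M P c) :=
    integrable_finsetSum _ fun n _ => integrable_inner_Δ hm hi hd hL hδ hD0.le k n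
  have e1 : ∫ q : (Fin M → Z) × Tape d c.K, ∑ n ∈ Finset.range c.T,
      ‖(runState c f x₁ k n q).gPriv‖ ^ 2 ∂(runLaw d M P c) ≤ c.T * G ^ 2 := by
    rw [integral_finsetSum _ fun n hn => (memLp_gPriv hm hi hd hL hδ hB₁ hB₂ hD hT hk
      (Finset.mem_range.1 hn)).integrable_norm_pow (by norm_num)]
    refine (Finset.sum_le_sum (g := fun _ => G ^ 2) fun n hn => ?_).trans (by simp)
    exact (integral_norm_gPriv_sq_le hm hi hd hL hδ hB₁ hB₂ hD hT hk hσ hae hbe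
      (Finset.mem_range.1 hn)).trans hGe
  have e2 : ∫ q : (Fin M → Z) × Tape d c.K, ∑ n ∈ Finset.range c.T,
      ‖(runState c f x₁ k n q).gPriv - gradient (smoothLoss P f c.δ) (runState c f x₁ k n q).w‖
        ∂(runLaw d M P c) ≤ c.T * (a + b) := by
    rw [integral_finsetSum _ fun n hn => ((memLp_gPriv_sub hm hi hd hL hδ hB₁ hB₂ hD hT hk
      (Finset.mem_range.1 hn)).integrable one_le_two).norm]
    refine (Finset.sum_le_sum (g := fun _ => a + b) fun n hn => ?_).trans_eq
      (by rw [Finset.sum_const, Finset.card_range, nsmul_eq_mul])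
    exact integral_norm_gPriv_sub_le hm hi hd hL hδ hB₁ hB₂ hD hT hk hσ ha hb hae hbe
      (Finset.mem_range.1 hn)
  have e3 : ∫ q : (Fin M → Z) × Tape d c.K, ∑ n ∈ Finset.range c.T,
      inner ℝ (gradient (smoothLoss P f c.δ) (runState c f x₁ k n q).w)
        (runState c f x₁ k n q).Δ ∂(runLaw d M P c) =
      ∫ q : (Fin M → Z) × Tape d c.K, ∑ n ∈ Finset.range c.T,
        (smoothLoss P f c.δ ((runState c f x₁ k n q).x + (runState c f x₁ k n q).Δ) -
          smoothLoss P f c.δ (runState c f x₁ k n q).x) ∂(runLaw d M P c) := by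
    rw [integral_finsetSum _ fun n _ => integrable_inner_Δ hm hi hd hL hδ hD0.le k n,
      integral_finsetSum _ fun n _ => integrable_smoothLoss_sub hm hi hd hL hδ hD0.le k n]
    exact Finset.sum_congr rfl fun n _ => integral_inner_Δ hm hi hd hL hδ hD0.le k n
  have j12 : Integrable (fun q : (Fin M → Z) × Tape d c.K => c.D ^ 2 / (2 * c.η) +
      c.η / 2 * ∑ n ∈ Finset.range c.T, ‖(runState c f x₁ k n q).gPriv‖ ^ 2) (runLaw d M P c) :=
    (integrable_const _).add (j1.const_mul _)
  have j123 : Integrable (fun q : (Fin M → Z) × Tape d c.K => c.D ^ 2 / (2 * c.η) +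
      c.η / 2 * ∑ n ∈ Finset.range c.T, ‖(runState c f x₁ k n q).gPriv‖ ^ 2 +
      2 * c.D * ∑ n ∈ Finset.range c.T, ‖(runState c f x₁ k n q).gPriv -
        gradient (smoothLoss P f c.δ) (runState c f x₁ k n q).w‖) (runLaw d M P c) :=
    j12.add (j2.const_mul _)
  have h := integral_mono_of_nonneg (Eventually.of_forall fun _ => by positivity)
    (j123.sub j3) (Eventually.of_forall hpath)
  rw [integral_const_mul] at h
  refine h.trans ?_
  simp only [Pi.sub_apply]
  rw [integral_sub j123 j3, integral_add j12 (j2.const_mul _), integral_add (integrable_const _)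
    (j1.const_mul _), integral_const_mul, integral_const_mul, integral_const, probReal_univ,
    one_smul, e3]
  refine sub_le_sub_right ?_ _
  have h1 : c.η / 2 * ∫ q : (Fin M → Z) × Tape d c.K, ∑ n ∈ Finset.range c.T,
      ‖(runState c f x₁ k n q).gPriv‖ ^ 2 ∂(runLaw d M P c) ≤ c.η / 2 * (c.T * G ^ 2) := by gcongr
  have h2 : 2 * c.D * ∫ q : (Fin M → Z) × Tape d c.K, ∑ n ∈ Finset.range c.T,
      ‖(runState c f x₁ k n q).gPriv - gradient (smoothLoss P f c.δ) (runState c f x₁ k n q).w‖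
        ∂(runLaw d M P c) ≤ 2 * c.D * (c.T * (a + b)) := by gcongr
  have hs : √(c.T : ℝ) * √(c.T : ℝ) = c.T := Real.mul_self_sqrt hT'.le
  have hs0 : 0 < √(c.T : ℝ) := Real.sqrt_pos.2 hT'
  -- The stepsize `D / (G√T)` equalizes the two halves of the regret bound.
  have h3 : c.D ^ 2 / (2 * c.η) = c.D * (G * √c.T) / 2 := by
    rw [hη]; field_simp
  have h4 : c.η / 2 * (c.T * G ^ 2) = c.D * (G * √c.T) / 2 := by
    rw [hη, div_div, div_mul_eq_mul_div, div_eq_div_iff (by positivity) (by positivity)]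
    linear_combination (-(2 * c.D * G ^ 2)) * hs
  linarith

end MainBound

/-! ### From epochs to the random output. -/

section Output

variable {d M : ℕ} {Z : Type*} [MeasurableSpace Z] {P : Measure Z} [IsProbabilityMeasure P]
  {c : Params} {f : Vec d → Z → ℝ} {x₁ : Vec d} {L : NNReal} [NeZero d] [NeZero c.K]
  (hm : Measurable fun p : Vec d × Z => f p.1 p.2) (hi : ∀ x, Integrable (f x) P)
  (hd : ∀ z, Differentiable ℝ fun x => f x z) (hL : ∀ z, LipschitzWith L fun x => f x z)
  (hδ : 0 < c.δ) (hD : c.D = c.δ / c.T) (hT : 0 < c.T)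

theorem integral_uniformOn_fin {K : ℕ} [NeZero K] (φ : Fin K → ℝ) :
    ∫ k, φ k ∂(uniformOn (Set.univ : Set (Fin K))) = (K : ℝ)⁻¹ * ∑ k, φ k := by
  rw [integral_fintype (Integrable.of_finite), Finset.mul_sum]
  refine Finset.sum_congr rfl fun k _ => ?_
  rw [measureReal_def, uniformOn_univ]
  simp

theorem epochAverage_congr_index (S : Fin M → Z) (ω : Tape d c.K) (i : Fin c.K) (k : ℕ) :
    epochAverage c f x₁ S (ω.1, ω.2.1, ω.2.2.1, i) k = epochAverage c f x₁ S ω k := by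
  have h : epochStart c f x₁ S (ω.1, ω.2.1, ω.2.2.1, i) k = epochStart c f x₁ S ω k :=
    epochStart_congr k (fun _ _ => rfl) (fun _ _ _ => rfl) (fun _ _ _ => rfl) (fun _ _ _ => rfl)
  unfold epochAverage epochState
  rw [h]

theorem integrable_goldsteinNorm {F : Vec d → ℝ} (hF : LipschitzWith L F) {δ : ℝ} (hδ' : 0 < δ)
    {y : (Fin M → Z) × Tape d c.K → Vec d} (hy : Measurable y) :
    Integrable (fun q => goldsteinNorm F δ (y q)) (runLaw d M P c) := by
  refine Integrable.of_bound ((measurable_goldsteinNorm hδ').comp hy).aestronglyMeasurable L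
    (Eventually.of_forall fun q => ?_)
  rw [Real.norm_of_nonneg (goldsteinNorm_nonneg _ _ _)]
  exact goldsteinNorm_le hF hδ' _

include hm in
theorem integral_goldsteinNorm_output {F : Vec d → ℝ} (hF : LipschitzWith L F) {δ : ℝ}
    (hδ' : 0 < δ) :
    ∫ q : (Fin M → Z) × Tape d c.K, goldsteinNorm F δ (output c f x₁ q.1 q.2) ∂(runLaw d M P c) =
      (c.K : ℝ)⁻¹ * ∑ k ∈ Finset.range c.K, ∫ q : (Fin M → Z) × Tape d c.K,
        goldsteinNorm F δ (epochAverage c f x₁ q.1 q.2 k) ∂(runLaw d M P c) := by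
  rw [(resample_runLaw (P := P) (M := M) (resample_index (d := d) (c := c))).integral
    (integrable_goldsteinNorm hF hδ' (measurable_output hm))]
  simp only [output, epochAverage_congr_index, integral_uniformOn_fin]
  rw [integral_const_mul, integral_finsetSum Finset.univ fun (k : Fin c.K) _ =>
    integrable_goldsteinNorm hF hδ' (measurable_epochAverage hm (k : ℕ))]
  rw [Finset.sum_range fun k => ∫ q : (Fin M → Z) × Tape d c.K,
        goldsteinNorm F δ (epochAverage c f x₁ q.1 q.2 k) ∂(runLaw d M P c)]

include hm hi hd hL hδ hD hT in
-- The radius `2 * c.δ` is spent half on the distance from the query points to their average, which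
-- is at most `T * D = c.δ`, and half on the smoothing ball.
theorem integral_goldsteinNorm_epochAverage_le (k : ℕ) :
    ∫ q : (Fin M → Z) × Tape d c.K, goldsteinNorm (meanLoss P f) (2 * c.δ)
        (epochAverage c f x₁ q.1 q.2 k) ∂(runLaw d M P c) ≤
      (c.T : ℝ)⁻¹ * ∫ q : (Fin M → Z) × Tape d c.K, ‖∑ n ∈ Finset.range c.T,
        gradient (smoothLoss P f c.δ) (runState c f x₁ k n q).w‖ ∂(runLaw d M P c) := by
  have hT' : (0 : ℝ) < c.T := by exact_mod_cast hT
  have hD0 : 0 ≤ c.D := by rw [hD]; positivity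
  have hTD : c.T * c.D = c.δ := by rw [hD]; field_simp
  rw [← integral_const_mul]
  have hint : Integrable (fun q : (Fin M → Z) × Tape d c.K => (c.T : ℝ)⁻¹ *
      ‖∑ n ∈ Finset.range c.T, gradient (smoothLoss P f c.δ) (runState c f x₁ k n q).w‖)
      (runLaw d M P c) :=
    (integrable_finsetSum _ fun n _ =>
      (memLp_gradient_w hm hi hL hδ n).integrable one_le_two).norm.const_mul _
  refine integral_mono_of_nonneg (Eventually.of_forall fun _ => goldsteinNorm_nonneg _ _ _) hint ?_
  filter_upwards [ae_runLaw tapeLaw_ae_interp] with q hq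
  have h := goldsteinNorm_le_norm_average (differentiable_meanLoss hm hi hd hL)
    (lipschitzWith_meanLoss hi hL) hδ (le_refl (2 * c.δ)) hT
    (fun n => (runState c f x₁ k n q).w) (epochAverage c f x₁ q.1 q.2 k) (fun n hn => ?_)
  · rwa [norm_smul, norm_inv, Real.norm_natCast] at h
  · rw [← hTD]
    exact norm_roundState_w_sub_average_le hD0 (fun t => hq (k, t)) hn

include hm hi hd hL hδ hD hT in
/-- The convergence of the algorithm. -/
theorem integral_goldsteinNorm_output_le (hB₁ : c.B₁ = c.T + 1) (hB₂ : c.B₂ = 1)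
    (hM : c.K * c.epochSize ≤ M) {σ a b G Fstar : ℝ} (hσ : ∀ t, c.σ t = σ) (ha : 0 ≤ a)
    (hb : 0 ≤ b) (hae : 40 * d * L ^ 2 / c.T ≤ a ^ 2)
    (hbe : (Nat.log 2 c.T + 1 : ℕ) * (d * σ ^ 2) ≤ b ^ 2) (hG : 0 < G)
    (hGe : 3 * (a ^ 2 + L ^ 2 + b ^ 2) ≤ G ^ 2) (hη : c.η = c.D / (G * √c.T))
    (hF : BddBelow (Set.range (meanLoss P f))) (hFs : meanLoss P f x₁ - ⨅ x, meanLoss P f x ≤ Fstar) :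
    ∫ q : (Fin M → Z) × Tape d c.K, goldsteinNorm (meanLoss P f) (2 * c.δ)
        (output c f x₁ q.1 q.2) ∂(runLaw d M P c) ≤
      (Fstar + L * c.δ) / (c.K * c.δ) + G / √c.T + 2 * (a + b) := by
  have hT' : (0 : ℝ) < c.T := by exact_mod_cast hT
  have hK' : (0 : ℝ) < c.K := by exact_mod_cast NeZero.pos c.K
  have hD0 : 0 < c.D := by rw [hD]; positivity
  have hLm := lipschitzWith_meanLoss hi hL
  set I : ℕ → ℝ := fun k => ∫ q : (Fin M → Z) × Tape d c.K, ‖∑ n ∈ Finset.range c.T,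
    gradient (smoothLoss P f c.δ) (runState c f x₁ k n q).w‖ ∂(runLaw d M P c) with hI
  set J : ℕ → ℝ := fun k => ∫ q : (Fin M → Z) × Tape d c.K, ∑ n ∈ Finset.range c.T,
    (smoothLoss P f c.δ ((runState c f x₁ k n q).x + (runState c f x₁ k n q).Δ) -
      smoothLoss P f c.δ (runState c f x₁ k n q).x) ∂(runLaw d M P c) with hJ
  have h1 : ∀ k ∈ Finset.range c.K,
      c.D * I k ≤ c.D * (G * √c.T + 2 * c.T * (a + b)) - J k := fun k hk =>
    epoch_bound hm hi hd hL hδ hB₁ hB₂ hD hT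
      ((Nat.mul_le_mul_right _ (Finset.mem_range.1 hk)).trans hM) hσ ha hb hae hbe hG hGe hη
  -- Smoothing raises the value at `x₁` by at most `L * c.δ` and never goes below the infimum of the
  -- original loss.
  have hJsum : -(Fstar + L * c.δ) ≤ ∑ k ∈ Finset.range c.K, J k := by
    have jint : ∀ k, Integrable (fun q : (Fin M → Z) × Tape d c.K => ∑ n ∈ Finset.range c.T,
        (smoothLoss P f c.δ ((runState c f x₁ k n q).x + (runState c f x₁ k n q).Δ) -
          smoothLoss P f c.δ (runState c f x₁ k n q).x)) (runLaw d M P c) := fun k =>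
      integrable_finsetSum _ fun n _ => integrable_smoothLoss_sub hm hi hd hL hδ hD0.le k n
    rw [← integral_finsetSum _ fun k _ => jint k]
    have h2 : ∫ _ : (Fin M → Z) × Tape d c.K, -(Fstar + L * c.δ) ∂(runLaw d M P c) ≤ _ :=
      integral_mono (integrable_const _) (integrable_finsetSum (Finset.range c.K) fun k _ => jint k)
        fun q => by
          simp only
          rw [sum_smoothLoss_sub (smoothLoss P f c.δ) hT]
          have h3 := iInf_le_ballSmooth hLm hF hδ.le (epochStart c f x₁ q.1 q.2 c.K)
          have h4 := ballSmooth_le hLm hδ.le x₁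
          unfold smoothLoss
          linarith
    simpa using h2
  have h2 := Finset.sum_le_sum h1
  rw [← Finset.mul_sum, Finset.sum_sub_distrib, Finset.sum_const, Finset.card_range,
    nsmul_eq_mul] at h2
  rw [integral_goldsteinNorm_output hm hLm (by positivity)]
  have h3 : ∑ k ∈ Finset.range c.K, ∫ q : (Fin M → Z) × Tape d c.K,
      goldsteinNorm (meanLoss P f) (2 * c.δ) (epochAverage c f x₁ q.1 q.2 k) ∂(runLaw d M P c) ≤
      (c.T : ℝ)⁻¹ * ∑ k ∈ Finset.range c.K, I k := by
    rw [Finset.mul_sum]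
    exact Finset.sum_le_sum fun k _ =>
      integral_goldsteinNorm_epochAverage_le hm hi hd hL hδ hD hT k
  have h4 : c.D * ∑ k ∈ Finset.range c.K, I k ≤
      c.K * (c.D * (G * √c.T + 2 * c.T * (a + b))) + (Fstar + L * c.δ) := by linarith
  have hs : √(c.T : ℝ) * √(c.T : ℝ) = c.T := Real.mul_self_sqrt hT'.le
  have hs0 : 0 < √(c.T : ℝ) := Real.sqrt_pos.2 hT'
  calc _ ≤ (c.K : ℝ)⁻¹ * ((c.T : ℝ)⁻¹ * ∑ k ∈ Finset.range c.K, I k) := by gcongr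
    _ = (c.K * c.T * c.D : ℝ)⁻¹ * (c.D * ∑ k ∈ Finset.range c.K, I k) := by field_simp
    _ ≤ (c.K * c.T * c.D : ℝ)⁻¹ *
        (c.K * (c.D * (G * √c.T + 2 * c.T * (a + b))) + (Fstar + L * c.δ)) := by gcongr
    _ = (Fstar + L * c.δ) / (c.K * (c.T * c.D)) + G * √c.T / c.T + 2 * (a + b) := by
        field_simp; ring
    _ = _ := by
        have e1 : (c.T : ℝ) * c.D = c.δ := by rw [hD]; field_simp
        have e2 : G * √c.T / c.T = G / √c.T := by
          nth_rw 2 [← hs]; field_simp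
        rw [e1, e2]

end Output

/-! ### The choice of the parameters -/

section Numerics

/-- With `ℓ = ⌊log₂ T⌋` one has `2 log T ≥ 2ℓ log 2`, and `(2 log 2 - 1) ℓ ≥ 1` as soon as `ℓ ≥ 3`;
hence the threshold `8`. -/
theorem natLog_two_add_one_le {T : ℕ} (hT : 8 ≤ T) :
    ((Nat.log 2 T + 1 : ℕ) : ℝ) ≤ 2 * Real.log T := by
  have h3 : 3 ≤ Nat.log 2 T := Nat.le_log_of_pow_le (by norm_num) (by simpa using hT)
  have h1 : (2 : ℝ) ^ Nat.log 2 T ≤ T := by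
    exact_mod_cast Nat.pow_log_le_self 2 (by omega)
  have h2 := Real.log_le_log (by positivity) h1
  rw [Real.log_pow] at h2
  have h4 := Real.log_two_gt_d9
  have h5 : (3 : ℝ) ≤ Nat.log 2 T := by exact_mod_cast h3
  push_cast
  nlinarith

/-- Removes the circularity of a sample size that must beat its own logarithm. Write `M = Xμ`. Then
`log M` is `log X`, controlled by the logarithm in the hypothesis, plus `log μ ≤ 4 μ^(1/4)`; so `(1
+ log M)²` is at most a multiple of `log (X + 2)² + √μ`, and `2 ^ 38` is large enough for both
parts. -/
theorem one_add_log_sq_le {X M : ℝ} (hX : 1 ≤ X)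
    (hM : 2 ^ 38 * X * Real.log (X + 2) ^ 2 ≤ M) :
    2 ^ 38 * X ≤ M ∧ 8192 * (1 + Real.log M) ^ 2 * X ≤ M := by
  -- Here `X + 2 ≥ 3 > e`.
  have hl : 1 ≤ Real.log (X + 2) := by
    rw [Real.le_log_iff_exp_le (by linarith)]
    linarith [Real.exp_one_lt_d9]
  set l := Real.log (X + 2) with hldef
  have hlX : Real.log X ≤ l := Real.log_le_log (by linarith) (by linarith)
  have hl2 : 1 ≤ l ^ 2 := one_le_pow₀ hl
  have h1 : 2 ^ 38 * X ≤ M := by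
    refine le_trans ?_ hM
    exact le_mul_of_one_le_right (by positivity) hl2
  refine ⟨h1, ?_⟩
  have hX0 : 0 < X := by linarith
  set μ := M / X with hμ
  have hμM : M = X * μ := by rw [hμ]; field_simp
  have hμ1 : 2 ^ 38 ≤ μ := by rw [hμ, le_div_iff₀ hX0]; exact h1
  have hμ2 : 2 ^ 38 * l ^ 2 ≤ μ := by rw [hμ, le_div_iff₀ hX0]; linarith
  have hμ0 : 0 < μ := lt_of_lt_of_le (by norm_num) hμ1
  have hlogM : Real.log M = Real.log X + Real.log μ := by
    rw [hμM, Real.log_mul hX0.ne' hμ0.ne']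
  set s := √μ with hs
  have hs2 : s ^ 2 = μ := Real.sq_sqrt hμ0.le
  have hs1 : 2 ^ 19 ≤ s := by
    rw [hs]
    refine Real.le_sqrt_of_sq_le ?_
    norm_num at hμ1 ⊢
    exact hμ1
  have hs0 : 0 < s := lt_of_lt_of_le (by norm_num) hs1
  have hlogμ : Real.log μ ≤ 4 * √s := by
    have h2 := Real.log_le_self (Real.sqrt_nonneg s)
    rw [Real.log_sqrt hs0.le, hs, Real.log_sqrt hμ0.le] at h2
    linarith
  have hlogμ0 : 0 ≤ Real.log μ := Real.log_nonneg (le_trans (by norm_num) hμ1)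
  have hlogμ2 : Real.log μ ^ 2 ≤ 16 * s := by
    have h2 := pow_le_pow_left₀ hlogμ0 hlogμ 2
    rwa [mul_pow, Real.sq_sqrt hs0.le, show (4 : ℝ) ^ 2 = 16 by norm_num] at h2
  have h3 : (1 + Real.log M) ^ 2 ≤ 8 * l ^ 2 + 32 * s := by
    have h4 : 1 + Real.log M ≤ 2 * l + Real.log μ := by linarith
    have h5 : 0 ≤ 1 + Real.log M := by
      have := Real.log_nonneg hX
      linarith
    have h6 := pow_le_pow_left₀ h5 h4 2
    nlinarith [sq_nonneg (2 * l - Real.log μ)]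
  have h7 : 8192 * (1 + Real.log M) ^ 2 ≤ μ := by
    have h8 : 2 ^ 19 * s ≤ μ := by rw [← hs2, sq]; gcongr
    linarith
  rwa [hμ, le_div_iff₀ hX0] at h7

variable {p q N r ε L X M α β : ℝ}

/-- Both `α³` and `β²` are proportional to `M`, so each summand of the rate yields one bound after
cubing or squaring. The constants are `1024000 = 2 * 80 ^ 3` and `8192 = 2 * 64 ^ 2`, the factor `2`
coming from `2 * r`. -/
theorem rate_lower_bounds (hp : 0 < p) (hq : 0 < q) (hN : 0 < N) (hr : 0 < r) (hε : 0 < ε)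
    (hX : N / (2 * r) * (p ^ 2 / ε ^ 3 + q / ε ^ 2) ≤ X)
    (hα : 0 < α) (hβ : 0 < β) (hα3 : α ^ 3 = p * r * M / N) (hβ2 : β ^ 2 = q * r * M / N)
    (h1 : 2 ^ 38 * X ≤ M) {Λ : ℝ} (h2 : 8192 * Λ ^ 2 * X ≤ M) :
    80 * p / ε ≤ α ∧ 64 * Λ * q / ε ≤ β := by
  have hXp : N / (2 * r) * (p ^ 2 / ε ^ 3) ≤ X := by
    refine le_trans ?_ hX
    gcongr
    exact le_add_of_nonneg_right (by positivity)
  have hXq : N / (2 * r) * (q / ε ^ 2) ≤ X := by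
    refine le_trans ?_ hX
    gcongr
    exact le_add_of_nonneg_left (by positivity)
  constructor
  · refine le_of_pow_le_pow_left₀ (n := 3) (by norm_num) hα.le ?_
    rw [hα3]
    have h3 : 1024000 * (N / (2 * r) * (p ^ 2 / ε ^ 3)) ≤ M := by
      have hX0 : 0 ≤ X := le_trans (by positivity) hXp
      nlinarith
    calc (80 * p / ε) ^ 3 = p * r * (1024000 * (N / (2 * r) * (p ^ 2 / ε ^ 3))) / N := by
          field_simp; norm_num
      _ ≤ p * r * M / N := by gcongr
  · refine le_of_sq_le_sq ?_ hβ.le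
    rw [hβ2]
    have h3 : 8192 * Λ ^ 2 * (N / (2 * r) * (q / ε ^ 2)) ≤ M :=
      (mul_le_mul_of_nonneg_left hXq (by positivity)).trans h2
    calc (64 * Λ * q / ε) ^ 2 = q * r * (8192 * Λ ^ 2 * (N / (2 * r) * (q / ε ^ 2))) / N := by
          field_simp; ring
      _ ≤ q * r * M / N := by gcongr

/-- Ensures that at least one epoch fits into the data: since `rε ≤ N`, dividing `α³` by `α` and
`β²` by `β` bounds the candidate round numbers by a small fraction of `M`. The lower bound on `α ^
2` makes the rounding up harmless. -/
theorem rounds_bounds (hr : 0 < r) (hε : 0 < ε) (hεL : ε ≤ L)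
    (hLp : L ≤ p) (hNL : L * r ≤ N) (hM : 0 < M) (hα : 0 < α) (hβ : 0 < β)
    (hα3 : α ^ 3 = p * r * M / N) (hβ2 : β ^ 2 = q * r * M / N) (h1 : 80 * p / ε ≤ α)
    (h2 : 64 * q / ε ≤ β) : 6400 ≤ α ^ 2 ∧ α ^ 2 ≤ M / 64 ∧ β ≤ M / 64 := by
  have hL : 0 < L := by linarith
  have hp : 0 < p := by linarith
  have hN : 0 < N := lt_of_lt_of_le (by positivity) hNL
  have hrN : r * ε ≤ N := by nlinarith
  refine ⟨?_, ?_, ?_⟩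
  · have h3 : 80 ≤ α := by
      refine le_trans ?_ h1
      rw [le_div_iff₀ hε]
      linarith
    nlinarith
  · have h3 : α ^ 2 = p * r * M / N / α := by rw [← hα3]; field_simp
    rw [h3, div_div, div_le_div_iff₀ (by positivity) (by norm_num)]
    rw [div_le_iff₀ hε] at h1
    have h4 : p * r * 64 ≤ N * α := by
      have h5 : 80 * p * (r * ε) ≤ α * ε * N := mul_le_mul h1 hrN (by positivity) (by positivity)
      have h6 : (80 * p * r) * ε ≤ (N * α) * ε := by linarith
      have h7 := le_of_mul_le_mul_right h6 hε
      nlinarith [mul_pos hp hr]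
    nlinarith
  · have h3 : β = q * r * M / N / β := by rw [← hβ2]; field_simp
    rw [h3, div_div, div_le_div_iff₀ (by positivity) (by norm_num)]
    rw [div_le_iff₀ hε] at h2
    have h4 : q * r * 64 ≤ N * β := by
      have h5 : 64 * q * (r * ε) ≤ β * ε * N := mul_le_mul h2 hrN (by positivity) (by positivity)
      have h6 : (64 * q * r) * ε ≤ (N * β) * ε := by linarith
      have h7 := le_of_mul_le_mul_right h6 hε
      linarith
    nlinarith

/-- The definitions of `α` and `β` say that `α² N/(rM) = p/α` and `β N/(rM) = q/β`, so the
optimization term is of the same order as the two statistical terms. Altogether `40 p/α` uses up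
half of `ε`, and `32 (1 + logM) q/β` the other half. -/
theorem total_error_le {T K logT logM : ℝ} (hp : 0 < p) (hq : 0 < q) (hN : 0 < N) (hr : 0 < r)
    (hε : 0 < ε) (hM : 0 < M) (hα : 0 < α) (hβ : 0 < β)
    (hα3 : α ^ 3 = p * r * M / N) (hβ2 : β ^ 2 = q * r * M / N) (h1 : 80 * p / ε ≤ α)
    (h2 : 64 * (1 + logM) * q / ε ≤ β) (hlog0 : 0 ≤ logT) (hlog : logT ≤ logM)
    (hαT : α ^ 2 ≤ T) (hβT : β ≤ T) (hT : T ≤ 2 * (α ^ 2 + β)) (hK : M ≤ 4 * T * K) :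
    N / (K * r) + 32 * (p / √T) + 4 * (8 * logT * q / T) ≤ ε := by
  have hT0 : 0 < T := hβ.trans_le hβT
  have hK0 : 0 < K := by
    by_contra h
    have : 4 * T * K ≤ 0 := mul_nonpos_of_nonneg_of_nonpos (by positivity) (not_lt.1 h)
    linarith
  have e1 : N / (K * r) ≤ 8 * (p / α) + 8 * (q / β) := by
    have h3 : N / (K * r) ≤ 4 * T * (N / (r * M)) := by
      rw [← mul_div_assoc, div_le_div_iff₀ (by positivity) (by positivity)]
      have := mul_le_mul_of_nonneg_left hK (by positivity : 0 ≤ N * r)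
      linarith
    have h4 : p / α = α ^ 2 * (N / (r * M)) := by
      rw [div_eq_iff hα.ne', show α ^ 2 * (N / (r * M)) * α = α ^ 3 * (N / (r * M)) by ring, hα3]
      field_simp
    have h5 : q / β = β * (N / (r * M)) := by
      rw [div_eq_iff hβ.ne', show β * (N / (r * M)) * β = β ^ 2 * (N / (r * M)) by ring, hβ2]
      field_simp
    have h6 := mul_le_mul_of_nonneg_right hT (by positivity : 0 ≤ 4 * (N / (r * M)))
    rw [h4, h5]
    linarith
  have e2 : p / √T ≤ p / α := by
    gcongr
    exact Real.le_sqrt_of_sq_le hαT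
  have e3 : 8 * logT * q / T ≤ 8 * logM * (q / β) := by
    have hlogM : 0 ≤ logM := hlog0.trans hlog
    rw [mul_div_assoc]
    gcongr
  have e4 : p / α ≤ ε / 80 := by
    rw [div_le_iff₀ hε] at h1
    rw [div_le_div_iff₀ hα (by norm_num)]
    linarith
  have e5 : (1 + logM) * (q / β) ≤ ε / 64 := by
    rw [div_le_iff₀ hε] at h2
    rw [← mul_div_assoc, div_le_div_iff₀ hβ (by norm_num)]
    linarith
  have e6 : 0 ≤ q / β := by positivity
  linarith

end Numerics

/-! ### Constants of the stepsize and of the noise level. -/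

section Choice

variable {d T : ℕ} {L ρ : ℝ}

theorem rpow_three_halves_sq (d : ℕ) : ((d : ℝ) ^ (3 / 2 : ℝ)) ^ 2 = (d : ℝ) ^ 3 := by
  rw [← Real.rpow_natCast, ← Real.rpow_mul (Nat.cast_nonneg _), ← Real.rpow_natCast]
  norm_num

theorem gradBound_sq (d T : ℕ) (L ρ : ℝ) : gradBound d T L ρ ^ 2 = 3 * (80 * d * L ^ 2 / T) +
    3 * L ^ 2 + 3 * (8 * Real.log T * (d : ℝ) ^ (3 / 2 : ℝ) * L / (T * ρ)) ^ 2 :=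
  Real.sq_sqrt (by positivity)

theorem gradBound_pos (hL : 0 < L) : 0 < gradBound d T L ρ := by
  unfold gradBound
  refine Real.sqrt_pos.2 ?_
  positivity

/-- Since `240 ≤ 16²` and `3 ≤ 2²`, the root is at most `16y + 2L + 2b` with `y = √d L/√T`. Division
by `√T ≥ 1` turns `L` into something below `y`. -/
theorem gradBound_div_sqrt_le (hL : 0 < L) (hρ : 0 < ρ) (hd : 1 ≤ d) (hT : 1 ≤ T) :
    gradBound d T L ρ / √T ≤
      18 * (√d * L / √T) + 2 * (8 * Real.log T * ((d : ℝ) ^ (3 / 2 : ℝ) * L / ρ) / T) := by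
  have hT1 : (1 : ℝ) ≤ T := by exact_mod_cast hT
  have hd1 : (1 : ℝ) ≤ d := by exact_mod_cast hd
  have hsT : 1 ≤ √(T : ℝ) := Real.one_le_sqrt.2 hT1
  have hsd : 1 ≤ √(d : ℝ) := Real.one_le_sqrt.2 hd1
  have hlog : 0 ≤ Real.log T := Real.log_nonneg hT1
  set b := 8 * Real.log T * ((d : ℝ) ^ (3 / 2 : ℝ) * L / ρ) / T with hb
  have hb0 : 0 ≤ b := by positivity
  have hb' : 8 * Real.log T * (d : ℝ) ^ (3 / 2 : ℝ) * L / (T * ρ) = b := by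
    rw [hb]; field_simp
  set y := √d * L / √T with hy
  have hy0 : 0 ≤ y := by positivity
  have hy2 : y ^ 2 = d * L ^ 2 / T := by
    rw [hy, div_pow, mul_pow, Real.sq_sqrt (by positivity), Real.sq_sqrt (by positivity)]
  have hG : gradBound d T L ρ ≤ 16 * y + 2 * L + 2 * b := by
    refine le_of_sq_le_sq ?_ (by positivity)
    rw [gradBound_sq, hb', mul_assoc 80, mul_div_assoc 80, ← hy2]
    have := mul_nonneg hy0 hb0
    have := mul_nonneg hy0 hL.le
    have := mul_nonneg hb0 hL.le
    nlinarith [sq_nonneg y, sq_nonneg L, sq_nonneg b]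
  have hLy : L / √T ≤ y := by
    rw [hy]
    gcongr
    exact le_mul_of_one_le_left hL.le hsd
  calc gradBound d T L ρ / √T ≤ (16 * y + 2 * L + 2 * b) / √T := by gcongr
    _ = 16 * y / √T + 2 * (L / √T) + 2 * b / √T := by ring
    _ ≤ 16 * y + 2 * y + 2 * b := by
        gcongr
        · exact div_le_self (by positivity) hsT
        · exact div_le_self (by positivity) hsT
    _ = _ := by ring

theorem sqrt_forty_le (hL : 0 < L) (hT : 1 ≤ T) : √(40 * d * L ^ 2 / T) ≤ 7 * (√d * L / √T) := by
  refine Real.sqrt_le_iff.2 ⟨by positivity, ?_⟩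
  rw [mul_pow, div_pow, mul_pow, Real.sq_sqrt (by positivity), Real.sq_sqrt (by positivity)]
  have : 0 ≤ (d : ℝ) * L ^ 2 / T := by positivity
  rw [mul_assoc 40, mul_div_assoc]
  linarith

/-- The standard deviation of the tree samples. -/
def treeStd (d T : ℕ) (L ρ : ℝ) : ℝ := √(2 * Real.log T) * 4 * d * L / ((1 : ℕ) * T * ρ)

theorem treeStd_sq (hT : 8 ≤ T) :
    treeStd d T L ρ ^ 2 = 32 * Real.log T * (d : ℝ) ^ 2 * L ^ 2 / (T ^ 2 * ρ ^ 2) := by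
  have hT1 : (1 : ℝ) ≤ T := by exact_mod_cast (by omega : 1 ≤ T)
  have hlog : 0 ≤ Real.log T := Real.log_nonneg hT1
  rw [treeStd, div_pow, mul_pow, mul_pow, mul_pow, Real.sq_sqrt (by positivity)]
  simp only [Nat.cast_one, one_mul]
  rw [mul_pow]
  ring

theorem log_pos_of_eight_le (hT : 8 ≤ T) : 0 < Real.log T :=
  Real.log_pos (by exact_mod_cast (by omega : 1 < T))

theorem treeStd_pos (hd : 1 ≤ d) (hL : 0 < L) (hρ : 0 < ρ) (hT : 8 ≤ T) : 0 < treeStd d T L ρ := by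
  have hd' : (0 : ℝ) < d := by exact_mod_cast hd
  have hT' : (0 : ℝ) < T := by exact_mod_cast (by omega : 0 < T)
  have := log_pos_of_eight_le hT
  unfold treeStd
  positivity

theorem tree_variance_le (hρ : 0 < ρ) (hT : 8 ≤ T) :
    (Nat.log 2 T + 1 : ℕ) * (d * treeStd d T L ρ ^ 2) ≤
      (8 * Real.log T * ((d : ℝ) ^ (3 / 2 : ℝ) * L / ρ) / T) ^ 2 := by
  have hT' : (0 : ℝ) < T := by exact_mod_cast (by omega : 0 < T)
  have hlog := log_pos_of_eight_le hT
  calc _ ≤ (2 * Real.log T) * (d * treeStd d T L ρ ^ 2) := by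
        gcongr
        exact natLog_two_add_one_le hT
    _ = 64 * Real.log T ^ 2 * (d : ℝ) ^ 3 * L ^ 2 / (T ^ 2 * ρ ^ 2) := by
        rw [treeStd_sq hT]; ring
    _ = _ := by
        rw [← rpow_three_halves_sq]; field_simp; ring

/-- The logarithm in the noise variance cancels the number of nodes through a round. -/
theorem privacy_loss_le (hd : 1 ≤ d) (hL : 0 < L) (hρ : 0 < ρ) (hT : 8 ≤ T) {α : ℝ} (hα : 1 < α) :
    α * ((Nat.log 2 T + 1 : ℕ) * (4 * d * L / T) ^ 2 / (2 * treeStd d T L ρ ^ 2)) ≤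
      α * ρ ^ 2 / 2 := by
  have hd' : (0 : ℝ) < d := by exact_mod_cast hd
  have hT' : (0 : ℝ) < T := by exact_mod_cast (by omega : 0 < T)
  have hlog := log_pos_of_eight_le hT
  refine (mul_le_mul_of_nonneg_left ?_ (zero_le_one.trans hα.le)).trans_eq
    (mul_div_assoc α (ρ ^ 2) 2).symm
  rw [treeStd_sq hT]
  calc _ ≤ (2 * Real.log T) * (4 * d * L / T) ^ 2 /
        (2 * (32 * Real.log T * (d : ℝ) ^ 2 * L ^ 2 / (T ^ 2 * ρ ^ 2))) := by
        gcongr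
        exact natLog_two_add_one_le hT
    _ = ρ ^ 2 / 2 := by field_simp; norm_num

end Choice

/-! ### Consequences of the sample size. -/

section Parameters

variable {d M : ℕ} {L δ ε ρ Fstar : ℝ}

theorem one_le_dataRate (hd : 1 ≤ d) (hδ : 0 < δ) (hε : 0 < ε) (hεL : ε ≤ L) (hρ : 0 < ρ)
    (hF : 0 ≤ Fstar) : 1 ≤ dataRate d L δ ε ρ Fstar := by
  have hL : 0 < L := by linarith
  have hd1 : (1 : ℝ) ≤ d := by exact_mod_cast hd
  have h1 : 1 ≤ L ^ 3 / ε ^ 3 := by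
    rw [one_le_div (by positivity)]
    gcongr
  have h2 : 0 ≤ Fstar * L ^ 2 / (δ * ε ^ 3) := by positivity
  have h3 : 0 ≤ (d : ℝ) ^ (3 / 2 : ℝ) *
    (Fstar * L / (ρ * δ * ε ^ 2) + L ^ 2 / (ρ * ε ^ 2)) := by positivity
  have h4 : 1 * 1 ≤ (d : ℝ) * (Fstar * L ^ 2 / (δ * ε ^ 3) + L ^ 3 / ε ^ 3) :=
    mul_le_mul hd1 (by linarith) zero_le_one (by positivity)
  unfold dataRate
  linarith

/-- The four terms of the rate are a product, in the shape that the optimization over `T` produces.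
-/
theorem dataRate_eq (hδ : 0 < δ) (hε : 0 < ε) (hρ : 0 < ρ) :
    dataRate d L δ ε ρ Fstar = (Fstar + L * δ) / δ *
      ((√d * L) ^ 2 / ε ^ 3 + (d : ℝ) ^ (3 / 2 : ℝ) * L / ρ / ε ^ 2) := by
  rw [dataRate, mul_pow, Real.sq_sqrt (Nat.cast_nonneg d)]
  field_simp

/-- What the lower bound on the number of data points gives for the parameters. -/
theorem chosenParams_bounds (hd : 1 ≤ d) (hδ : 0 < δ) (hε : 0 < ε) (hεL : ε ≤ L) (hρ : 0 < ρ)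
    (hF : 0 ≤ Fstar)
    (hM : 2 ^ 38 * dataRate d L δ ε ρ Fstar * Real.log (dataRate d L δ ε ρ Fstar + 2) ^ 2 ≤ M) :
    8 ≤ chosenT d M L (δ / 2) ρ Fstar ∧ 0 < M / (2 * chosenT d M L (δ / 2) ρ Fstar) ∧
    (Fstar + L * (δ / 2)) / ((M / (2 * chosenT d M L (δ / 2) ρ Fstar) : ℕ) * (δ / 2)) +
      32 * (√d * L / √(chosenT d M L (δ / 2) ρ Fstar : ℝ)) +
      4 * (8 * Real.log (chosenT d M L (δ / 2) ρ Fstar) * ((d : ℝ) ^ (3 / 2 : ℝ) * L / ρ) /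
        (chosenT d M L (δ / 2) ρ Fstar)) ≤ ε := by
  have hL : 0 < L := by linarith
  have hd1 : (1 : ℝ) ≤ d := by exact_mod_cast hd
  have hX1 := one_le_dataRate hd hδ hε hεL hρ hF
  set X := dataRate d L δ ε ρ Fstar with hX
  obtain ⟨hM1, hM2⟩ := one_add_log_sq_le hX1 hM
  have hM1' : (1 : ℝ) ≤ M := by linarith
  have hM0 : (0 : ℝ) < M := by linarith
  have hlogM : 0 ≤ Real.log M := Real.log_nonneg hM1'
  set r := δ / 2 with hr
  have hr0 : 0 < r := by positivity
  set N := Fstar + L * r with hN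
  have hNL : L * r ≤ N := by linarith
  have hN0 : 0 < N := lt_of_lt_of_le (by positivity) hNL
  set p := √(d : ℝ) * L with hp
  set q := (d : ℝ) ^ (3 / 2 : ℝ) * L / ρ with hq
  have hsd : 1 ≤ √(d : ℝ) := Real.one_le_sqrt.2 hd1
  have hLp : L ≤ p := le_mul_of_one_le_left hL.le hsd
  have hp0 : 0 < p := by linarith
  have hq0 : 0 < q := by positivity
  have hrate : N / (2 * r) * (p ^ 2 / ε ^ 3 + q / ε ^ 2) ≤ X := by
    rw [hX, dataRate_eq hδ hε hρ, show 2 * r = δ by rw [hr]; ring]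
    gcongr
    rw [hN, hr]
    gcongr
    linarith
  set A := √(d : ℝ) * L * r * M / N with hA
  set B := (d : ℝ) ^ (3 / 2 : ℝ) * L * r * M / (N * ρ) with hB
  have hA0 : 0 < A := by positivity
  have hB0 : 0 < B := by positivity
  set α := A ^ (1 / 3 : ℝ) with hα
  set β := B ^ (1 / 2 : ℝ) with hβ
  have hα0 : 0 < α := Real.rpow_pos_of_pos hA0 _
  have hβ0 : 0 < β := Real.rpow_pos_of_pos hB0 _
  have hα3 : α ^ 3 = p * r * M / N := by
    rw [hα, ← Real.rpow_natCast, ← Real.rpow_mul hA0.le]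
    norm_num
    rw [hA, hp]
  have hα2 : A ^ (2 / 3 : ℝ) = α ^ 2 := by
    rw [hα, ← Real.rpow_natCast, ← Real.rpow_mul hA0.le]
    norm_num
  have hβ2 : β ^ 2 = q * r * M / N := by
    rw [hβ, ← Real.rpow_natCast, ← Real.rpow_mul hB0.le]
    norm_num
    rw [hB, hq]
    field_simp
  obtain ⟨h1, h2⟩ := rate_lower_bounds hp0 hq0 hN0 hr0 hε hrate hα0 hβ0 hα3 hβ2 hM1 hM2
  have h2' : 64 * q / ε ≤ β := by
    refine le_trans ?_ h2
    gcongr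
    linarith
  obtain ⟨h3, h4, h5⟩ := rounds_bounds hr0 hε hεL hLp hNL hM0 hα0 hβ0 hα3 hβ2 h1 h2'
  have hTdef : chosenT d M L r ρ Fstar = ⌈max (α ^ 2) β⌉₊ := by
    rw [chosenT, ← hα2]
  set T := chosenT d M L r ρ Fstar with hT
  have hTle : max (α ^ 2) β ≤ T := by rw [hTdef]; exact Nat.le_ceil _
  have hmax : 6400 ≤ max (α ^ 2) β := h3.trans (le_max_left _ _)
  have hTlt : (T : ℝ) < max (α ^ 2) β + 1 := by
    rw [hTdef]; exact Nat.ceil_lt_add_one (by linarith)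
  have hmaxle : max (α ^ 2) β ≤ α ^ 2 + β :=
    max_le (le_add_of_nonneg_right hβ0.le) (le_add_of_nonneg_left (by positivity))
  have hαT : α ^ 2 ≤ T := (le_max_left _ _).trans hTle
  have hβT : β ≤ T := (le_max_right _ _).trans hTle
  have hTu : (T : ℝ) ≤ 2 * (α ^ 2 + β) := by linarith
  have hT8 : 8 ≤ T := by
    have : (8 : ℝ) ≤ T := by linarith
    exact_mod_cast this
  have hTM : (2 * T : ℝ) ≤ M := by linarith
  have hTM' : 2 * T ≤ M := by exact_mod_cast hTM
  have hK : 0 < M / (2 * T) := Nat.div_pos hTM' (by omega)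
  refine ⟨hT8, hK, ?_⟩
  -- Rounding down loses at most a factor `2`, because the quotient is at least `1`.
  have hK4 : (M : ℝ) ≤ 4 * T * (M / (2 * T) : ℕ) := by
    have h6 : M < 2 * T * (M / (2 * T) + 1) := Nat.lt_mul_div_succ M (by omega)
    have h7 : M ≤ 4 * T * (M / (2 * T)) := by nlinarith
    exact_mod_cast h7
  have hT0 : (0 : ℝ) < T := by linarith
  exact total_error_le hp0 hq0 hN0 hr0 hε hM0 hα0 hβ0 hα3 hβ2 h1 h2
    (Real.log_nonneg (by linarith)) (Real.log_le_log hT0 (by linarith)) hαT hβT hTu hK4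

end Parameters

end PrivateO2NC

end

/-! ### Assembly of the main theorem. -/

open PrivateO2NC in
theorem mainTheorem1 :
    ∃ C : ℝ, 0 < C ∧ ∃ p : ℕ,
      ∀ (d : ℕ) [NeZero d] (Z : Type*) [MeasurableSpace Z] (P : Measure Z)
        [IsProbabilityMeasure P] (f : Vec d → Z → ℝ) (F : Vec d → ℝ) (x₁ : Vec d)
        (L Fstar δ ε ρ : ℝ),
        0 < L → 0 < δ → 0 < ε → ε ≤ L → 0 < ρ →
        (∀ x : Vec d, Measurable (f x)) →
        (∀ x : Vec d, Integrable (f x) P) →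
        (∀ z : Z, Differentiable ℝ fun x => f x z) →
        (∀ (z : Z) (x y : Vec d), |f x z - f y z| ≤ L * ‖x - y‖) →
        (∀ x : Vec d, F x = ∫ z, f x z ∂P) →
        BddBelow (Set.range F) →
        F x₁ - ⨅ x, F x ≤ Fstar →
        ∀ M : ℕ,
          C * dataRate d L δ ε ρ Fstar * Real.log (dataRate d L δ ε ρ Fstar + 2) ^ p ≤ (M : ℝ) →
          (∀ α : ℝ, 1 < α →
            IsRDP (fun S : Fin M → Z => outputLaw (chosenParams d M L (δ / 2) ρ Fstar) f x₁ S)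
              α (α * ρ ^ 2 / 2)) ∧
          Integrable
            (fun q : (Fin M → Z) × Tape d (chosenParams d M L (δ / 2) ρ Fstar).K =>
              goldsteinNorm F δ (output (chosenParams d M L (δ / 2) ρ Fstar) f x₁ q.1 q.2))
            ((Measure.pi fun _ : Fin M => P).prod
              (tapeLaw d (chosenParams d M L (δ / 2) ρ Fstar))) ∧
          ∫ q : (Fin M → Z) × Tape d (chosenParams d M L (δ / 2) ρ Fstar).K,
              goldsteinNorm F δ (output (chosenParams d M L (δ / 2) ρ Fstar) f x₁ q.1 q.2)
            ∂((Measure.pi fun _ : Fin M => P).prod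
              (tapeLaw d (chosenParams d M L (δ / 2) ρ Fstar))) ≤ ε := by
  refine ⟨2 ^ 38, by positivity, 2, ?_⟩
  intro d _ Z _ P _ f F x₁ L Fstar δ ε ρ hL hδ hε hεL hρ hmeas hi hd hLip hF hbdd hFs M hM
  have hd1 : 1 ≤ d := NeZero.one_le
  -- Nonnegativity of `Fstar` is automatic, as it dominates the gap between a value and the infimum.
  have hF0 : 0 ≤ Fstar := le_trans (sub_nonneg.2 (ciInf_le hbdd x₁)) hFs
  obtain ⟨hT8, hK, hfinal⟩ := chosenParams_bounds hd1 hδ hε hεL hρ hF0 hM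
  have hm := measurable_uncurry_of_differentiable hmeas hd
  obtain rfl : F = meanLoss P f := funext hF
  set c := chosenParams d M L (δ / 2) ρ Fstar with hc
  have hcT : c.T = chosenT d M L (δ / 2) ρ Fstar := rfl
  have hT8' : 8 ≤ c.T := hT8
  have hT0 : 0 < c.T := by omega
  have hcδ : 0 < c.δ := half_pos hδ
  have : NeZero c.K := ⟨hK.ne'⟩
  have hσ : ∀ t, c.σ t = treeStd d c.T L ρ := fun _ => rfl
  lift L to NNReal using hL.le
  have hLip' : ∀ z, LipschitzWith L fun x => f x z := fun z =>
    LipschitzWith.of_dist_le_mul fun x y => by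
      rw [Real.dist_eq, dist_eq_norm]
      exact hLip z x y
  refine ⟨fun α hα S S' hS => ?_, ?_, ?_⟩
  · refine (renyiDiv_outputLaw_le hL.le hcδ rfl rfl rfl hT0 (treeStd_pos hd1 hL hρ hT8') hσ hm hLip
      hα hS).trans ?_
    exact EReal.coe_le_coe_iff.2 (privacy_loss_le hd1 hL hρ hT8' hα)
  · exact integrable_goldsteinNorm (lipschitzWith_meanLoss hi hLip') hδ (measurable_output hm)
  · have h2δ : 2 * c.δ = δ := by
      change 2 * (δ / 2) = δ
      ring
    have hG0 := gradBound_pos (d := d) (T := c.T) (ρ := ρ) hL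
    have hlog := log_pos_of_eight_le hT8'
    have hT' : (0 : ℝ) < c.T := by exact_mod_cast hT0
    have h := integral_goldsteinNorm_output_le (P := P) (M := M) (x₁ := x₁) (Fstar := Fstar)
      (σ := treeStd d c.T L ρ) (a := √(40 * d * L ^ 2 / c.T))
      (b := 8 * Real.log c.T * ((d : ℝ) ^ (3 / 2 : ℝ) * L / ρ) / c.T)
      (G := gradBound d c.T L ρ) hm hi hd hLip' hcδ rfl hT0 rfl rfl
      (chosenParams_size d M L (δ / 2) ρ Fstar) hσ (Real.sqrt_nonneg _) (by positivity)
      (Real.sq_sqrt (by positivity)).ge (tree_variance_le hρ hT8') hG0 (by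
        rw [gradBound_sq, Real.sq_sqrt (by positivity)]
        refine le_of_sub_nonneg ?_
        have e : 8 * Real.log c.T * (d : ℝ) ^ (3 / 2 : ℝ) * L / (c.T * ρ) =
            8 * Real.log c.T * ((d : ℝ) ^ (3 / 2 : ℝ) * L / ρ) / c.T := by field_simp
        rw [e]
        -- There is slack here: the stepsize is tuned to `80 d L²/T`, while the error analysis gives
        -- `40 d L²/T`.
        have : 0 ≤ (d : ℝ) * L ^ 2 / c.T := by positivity
        ring_nf at this ⊢
        linarith) rfl hbdd hFs
    rw [h2δ] at h
    refine h.trans (le_trans ?_ hfinal)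
    have h1 := gradBound_div_sqrt_le hL hρ hd1 (by omega : 1 ≤ c.T)
    have h2 := sqrt_forty_le (d := d) hL (by omega : 1 ≤ c.T)
    change (Fstar + L * (δ / 2)) / ((M / (2 * c.T) : ℕ) * (δ / 2)) + _ + _ ≤ _
    rw [← hcT]
    linarith
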